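/- Rectangles have a width and a height; a partial packing of a strip packing instance (a strip $[0,W]\times[0,\infty)$ and finitely many rectangles $r_1,\dots,r_m$ of width at most $W$) assigns a position of the lower left corner to some of the rectangles, the placed ones. It is feasible if the placed rectangles lie in the strip and their open regions are pairwise disjoint. A point $p$ is a feasible location for a new rectangle $r_{new}$ if placing its lower left corner at $p$ keeps the packing feasible; $p$ is BL-stable if all sufficiently small shifts of $r_{new}$ from $p$ to the left, and all sufficiently small shifts downwards, are infeasible. The holes of the packing are the closures of the connected regions of $[0,W]\times[0,\sum_i h(r_i)]$ minus the closed placed rectangles. A nice hole is a set $S\subset\mathbb{R}^2$ consisting of a closed rectilinear Jordan curve and its inner region such that, in a clockwise traversal of the curve, (i) no three consecutive edges run left, down, right (right notch), (ii) none run down, right, up (top notch), (iii) none run right, up, left (left notch), and (iv) at most one vertex is entered by a downward edge and left by a rightward edge (falling corner). Let $nv(S)$ be the number of its vertices. It is stored as a cyclic doubly-linked list of its vertices in clockwise order, together with pointers to its leftmost edge (the vertical edge in a left, up, right sequence), to its rightmost edge (the vertical edge in a right, down, left sequence) and to the falling corner, if there is one. **Theorem.** There are an algorithm and a constant $c$ such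 that the following holds. Let $S$ be a nice hole, with integral vertex coordinates, of a feasible partial packing all of whose placed rectangles have positive width and height, and let $r_{new}$ be a rectangle with positive integral width and height. Given $S$ in the above data structure and the dimensions of $r_{new}$, the algorithm computes exactly the set of all feasible BL-stable locations $p$ for $r_{new}$ such that $r_{new}$, placed at $p$, lies within $S$, in at most $c\cdot nv(S)$ steps, i.e. in $O(nv(S))$ time. Here an algorithm is a program for a random access machine on integers with indirect addressing, in which every addition, subtraction, comparison and memory access costs one step. -/

import Mathlib

open Set

namespace StripPacking

/-! ### Rectangles, instances, partial packings -/

/-- A rectangle, given by its width and its height. -/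
structure Rectangle where
  width : ℝ
  height : ℝ
  width_nonneg : 0 ≤ width
  height_nonneg : 0 ≤ height

/-- The closed region occupied by `r` when its lower left corner is at `p`. -/
def Rectangle.closedAt (r : Rectangle) (p : ℝ × ℝ) : Set (ℝ × ℝ) :=
  Icc p.1 (p.1 + r.width) ×ˢ Icc p.2 (p.2 + r.height)

/-- The open region occupied by `r` when its lower left corner is at `p`. -/
def Rectangle.openAt (r : Rectangle) (p : ℝ × ℝ) : Set (ℝ × ℝ) :=
  Ioo p.1 (p.1 + r.width) ×ˢ Ioo p.2 (p.2 + r.height)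

/-- A strip packing instance: a strip `[0, W] × [0, ∞)` and finitely many rectangles
(repetitions allowed), none of them wider than the strip. -/
structure Instance where
  W : ℝ
  W_nonneg : 0 ≤ W
  size : ℕ
  rect : Fin size → Rectangle
  width_le : ∀ i, (rect i).width ≤ W

/-- A partial packing: the position of the lower left corner for every placed rectangle,
`none` for every unplaced one. -/
abbrev PartialPacking (I : Instance) : Type := Fin I.size → Option (ℝ × ℝ)

/-- The containment constraints for the rectangle `r` placed at `p` in the strip of width `W`. -/
def Contained (W : ℝ) (r : Rectangle) (p : ℝ × ℝ) : Prop :=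
  0 ≤ p.1 ∧ p.1 + r.width ≤ W ∧ 0 ≤ p.2

/-- A partial packing is feasible if the placed rectangles satisfy the containment constraints
and pairwise do not overlap. -/
def Feasible (I : Instance) (sp : PartialPacking I) : Prop :=
  (∀ i p, sp i = some p → Contained I.W (I.rect i) p) ∧
  (∀ i j p q, i ≠ j → sp i = some p → sp j = some q →
    Disjoint ((I.rect i).openAt p) ((I.rect j).openAt q))

/-- `p` is a feasible location for the (further) rectangle `r` with regard to the feasible partial
packing `sp`: placing `r` at `p`, with the placed rectangles staying where they are, violates
neither a containment nor a non-overlap constraint. -/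
def FeasibleLocation (I : Instance) (sp : PartialPacking I) (r : Rectangle) (p : ℝ × ℝ) : Prop :=
  Contained I.W r p ∧ ∀ i q, sp i = some q → Disjoint ((I.rect i).openAt q) (r.openAt p)

/-- `r`, placed at `p`, is Bottom-Left-stable with regard to `sp`: all sufficiently small shifts
to the left are infeasible, and so are all sufficiently small downward shifts. -/
def BLStableLocation (I : Instance) (sp : PartialPacking I) (r : Rectangle) (p : ℝ × ℝ) : Prop :=
  (∃ ε > 0, ∀ x ∈ Ioo (p.1 - ε) p.1, ¬ FeasibleLocation I sp r (x, p.2)) ∧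
  (∃ ε > 0, ∀ y ∈ Ioo (p.2 - ε) p.2, ¬ FeasibleLocation I sp r (p.1, y))

/-- The part of the strip, cut off at the height `∑ h(r)` over all rectangles of the instance,
which is not covered by the (closed) placed rectangles. -/
def freeRegion (I : Instance) (sp : PartialPacking I) : Set (ℝ × ℝ) :=
  (Icc 0 I.W ×ˢ Icc 0 (∑ i, (I.rect i).height)) \
    {z | ∃ i q, sp i = some q ∧ z ∈ (I.rect i).closedAt q}

/-- The holes of a partial packing are the closures of the connected regions of its free region. -/
def IsHoleOfPacking (I : Instance) (sp : PartialPacking I) (S : Set (ℝ × ℝ)) : Prop :=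
  ∃ z ∈ freeRegion I sp, S = closure (pathComponentIn (freeRegion I sp) z)

/-! ### Rectilinear curves and holes

A closed rectilinear arc with `n` vertices is given by the cyclic sequence `V : ZMod n → ℤ × ℤ` of
its vertices; its `i`-th edge joins `V i` and `V (i + 1)`. -/

/-- A point with integral coordinates as a point of the plane. -/
def toPlane (q : ℤ × ℤ) : ℝ × ℝ := ((q.1 : ℝ), (q.2 : ℝ))

section Arc

variable {n : ℕ} (V : ZMod n → ℤ × ℤ)

def Leftward (i : ZMod n) : Prop := (V (i + 1)).2 = (V i).2 ∧ (V (i + 1)).1 < (V i).1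

def Rightward (i : ZMod n) : Prop := (V (i + 1)).2 = (V i).2 ∧ (V i).1 < (V (i + 1)).1

def Upward (i : ZMod n) : Prop := (V (i + 1)).1 = (V i).1 ∧ (V i).2 < (V (i + 1)).2

def Downward (i : ZMod n) : Prop := (V (i + 1)).1 = (V i).1 ∧ (V (i + 1)).2 < (V i).2

def Horizontal (i : ZMod n) : Prop := Leftward V i ∨ Rightward V i

def Vertical (i : ZMod n) : Prop := Upward V i ∨ Downward V i

/-- The `i`-th edge, as a closed segment in the plane. -/
def edgeSeg (i : ZMod n) : Set (ℝ × ℝ) := segment ℝ (toPlane (V i)) (toPlane (V (i + 1)))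

/-- The curve traced by the edges. -/
def curve : Set (ℝ × ℝ) := ⋃ i, edgeSeg V i

/-- `V` is the cyclic vertex sequence of a closed rectilinear arc: horizontal and vertical edges of
positive length alternate (so the edges are maximal segments), and two different edges
meet at most in a common end vertex at which one of them follows the other. -/
def IsClosedRectilinearArc : Prop :=
  (∀ i, (Horizontal V i ∧ Vertical V (i + 1)) ∨ (Vertical V i ∧ Horizontal V (i + 1))) ∧
  (∀ i j, i ≠ j → ∀ p ∈ edgeSeg V i ∩ edgeSeg V j,
    (j = i + 1 ∧ p = toPlane (V j)) ∨ (i = j + 1 ∧ p = toPlane (V i)))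

/-- The vertex sequence runs clockwise: the signed area of the polygon is negative. -/
def IsClockwise [NeZero n] : Prop :=
  ∑ i, ((V i).1 * (V (i + 1)).2 - (V (i + 1)).1 * (V i).2) < 0

/-- The inner region of a closed curve `J`: the bounded connected region of its complement. -/
def innerRegion (J : Set (ℝ × ℝ)) : Set (ℝ × ℝ) :=
  {p | p ∈ Jᶜ ∧ Bornology.IsBounded (pathComponentIn Jᶜ p)}

/-- `S` is a hole whose `n` vertices, in clockwise order, are `V 0, V 1, …, V (n - 1)`. -/
def IsHole [NeZero n] (S : Set (ℝ × ℝ)) : Prop :=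
  IsClosedRectilinearArc V ∧ IsClockwise V ∧ S = curve V ∪ innerRegion (curve V)

/-- Edge `i` is a leftmost edge: a vertical edge with both neighbouring edges and the
interior to its right. -/
def IsLeftmostEdge (i : ZMod n) : Prop := Leftward V (i - 1) ∧ Upward V i ∧ Rightward V (i + 1)

/-- Edge `i` is a rightmost edge: a vertical edge with both neighbouring edges and the
interior to its left. -/
def IsRightmostEdge (i : ZMod n) : Prop := Rightward V (i - 1) ∧ Downward V i ∧ Leftward V (i + 1)

/-- Edge `i` is a left notch: a vertical edge with both neighbouring edges to its left and the
interior to its right. -/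
def IsLeftNotch (i : ZMod n) : Prop := Rightward V (i - 1) ∧ Upward V i ∧ Leftward V (i + 1)

/-- Edge `i` is a right notch: a vertical edge with both neighbouring edges to its right and the
interior to its left. -/
def IsRightNotch (i : ZMod n) : Prop := Leftward V (i - 1) ∧ Downward V i ∧ Rightward V (i + 1)

/-- Edge `i` is a top notch: a horizontal edge with both neighbouring edges above it and the
interior below it. -/
def IsTopNotch (i : ZMod n) : Prop := Downward V (i - 1) ∧ Rightward V i ∧ Upward V (i + 1)

/-- Vertex `i` is a falling corner: it is entered by a downward and left by a rightward edge. -/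
def IsFallingCorner (i : ZMod n) : Prop := Downward V (i - 1) ∧ Rightward V i

/-- A BLS-hole: no right notch, no top notch, at most one falling corner. -/
def IsBLSHole [NeZero n] (S : Set (ℝ × ℝ)) : Prop :=
  IsHole V S ∧ (∀ i, ¬ IsRightNotch V i) ∧ (∀ i, ¬ IsTopNotch V i) ∧
  (∀ i j, IsFallingCorner V i → IsFallingCorner V j → i = j)

/-- A nice hole: a BLS-hole without left notch. -/
def IsNiceHole [NeZero n] (S : Set (ℝ × ℝ)) : Prop :=
  IsBLSHole V S ∧ ∀ i, ¬ IsLeftNotch V i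

end Arc

/-! ### The machine model

Structured programs for a random access machine with integer registers and an integer memory
with indirect addressing. Arithmetic consists of addition, subtraction and comparison;
every elementary operation costs one unit of time. -/

/-- The contents of the registers and of the memory. -/
structure State where
  reg : ℕ → ℤ
  mem : ℤ → ℤ

/-- Integer expressions: constants, registers, memory cells at a computed address, sums,
differences. -/
inductive AExp where
  | lit (k : ℤ)
  | reg (r : ℕ)
  | load (a : AExp)
  | add (a b : AExp)
  | sub (a b : AExp)

def AExp.eval (s : State) : AExp → ℤ
  | lit k => k
  | reg r => s.reg r
  | load a => s.mem (a.eval s)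
  | add a b => a.eval s + b.eval s
  | sub a b => a.eval s - b.eval s

/-- The number of elementary operations in the evaluation of an expression. -/
def AExp.cost : AExp → ℕ
  | lit _ => 1
  | reg _ => 1
  | load a => a.cost + 1
  | add a b => a.cost + b.cost + 1
  | sub a b => a.cost + b.cost + 1

/-- Conditions. -/
inductive BExp where
  | le (a b : AExp)
  | not (b : BExp)
  | and (b c : BExp)

def BExp.eval (s : State) : BExp → Prop
  | le a b => a.eval s ≤ b.eval s
  | not b => ¬ b.eval s
  | and b c => b.eval s ∧ c.eval s

def BExp.cost : BExp → ℕ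
  | le a b => a.cost + b.cost + 1
  | not b => b.cost + 1
  | and b c => b.cost + c.cost + 1

/-- Programs. -/
inductive Program where
  | skip
  | assign (r : ℕ) (e : AExp)
  | store (a e : AExp)
  | seq (c d : Program)
  | ifElse (b : BExp) (c d : Program)
  | loop (b : BExp) (c : Program)

/-- `Runs c s t s'`: started in the state `s`, the program `c` halts after `t` time units in the
state `s'`. -/
inductive Runs : Program → State → ℕ → State → Prop where
  | skip (s : State) : Runs .skip s 1 s
  | assign (r : ℕ) (e : AExp) (s : State) :
      Runs (.assign r e) s (e.cost + 1) ⟨Function.update s.reg r (e.eval s), s.mem⟩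
  | store (a e : AExp) (s : State) :
      Runs (.store a e) s (a.cost + e.cost + 1)
        ⟨s.reg, Function.update s.mem (a.eval s) (e.eval s)⟩
  | seq {c d : Program} {s s' s'' : State} {t u : ℕ} :
      Runs c s t s' → Runs d s' u s'' → Runs (.seq c d) s (t + u) s''
  | ifTrue {b : BExp} {c d : Program} {s s' : State} {t : ℕ} :
      b.eval s → Runs c s t s' → Runs (.ifElse b c d) s (b.cost + 1 + t) s'
  | ifFalse {b : BExp} {c d : Program} {s s' : State} {t : ℕ} :
      ¬ b.eval s → Runs d s t s' → Runs (.ifElse b c d) s (b.cost + 1 + t) s'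
  | loopFalse {b : BExp} {c : Program} {s : State} :
      ¬ b.eval s → Runs (.loop b c) s (b.cost + 1) s
  | loopTrue {b : BExp} {c : Program} {s s' s'' : State} {t u : ℕ} :
      b.eval s → Runs c s t s' → Runs (.loop b c) s' u s'' →
      Runs (.loop b c) s (b.cost + 1 + t + u) s''

/-- The state `s` holds the input: the hole with vertex sequence `V`, and the dimensions `w`, `h`
of the new rectangle.

The vertices form a cyclic doubly-linked list in clockwise order, whose nodes may lie
anywhere at positive addresses: the node at the address `a` consists of the cells `a`, `a + 1`
(the coordinates of the vertex), `a + 2` (the address of the next node) and `a + 3` (the address of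
the previous node). Registers `0` and `1` point to the leftmost and to the rightmost edge (to the
node of the end vertex where the clockwise traversal enters the edge), register `2` points to the
falling corner or is `0` if there is none, registers `3` and `4` contain `w` and `h`, and
register `5` contains an address from which on the memory is free. All other registers and memory
cells are arbitrary. -/
def HoldsInput {n : ℕ} (s : State) (V : ZMod n → ℤ × ℤ) (w h : ℤ) : Prop :=
  ∃ adr : ZMod n → ℤ,
    (∀ i, 0 < adr i ∧ adr i + 3 < s.reg 5) ∧
    (∀ i j, i ≠ j → 4 ≤ |adr i - adr j|) ∧
    (∀ i, s.mem (adr i) = (V i).1 ∧ s.mem (adr i + 1) = (V i).2 ∧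
      s.mem (adr i + 2) = adr (i + 1) ∧ s.mem (adr i + 3) = adr (i - 1)) ∧
    (∃ i, IsLeftmostEdge V i ∧ s.reg 0 = adr i) ∧
    (∃ i, IsRightmostEdge V i ∧ s.reg 1 = adr i) ∧
    ((∃ i, IsFallingCorner V i ∧ s.reg 2 = adr i) ∨
      ((∀ i, ¬ IsFallingCorner V i) ∧ s.reg 2 = 0)) ∧
    s.reg 3 = w ∧ s.reg 4 = h

/-- The set of points output in the state `s`: register `0` contains the number of points, and
the coordinates of the points are stored one after another from the address in register `1` on. -/
def outputPoints (s : State) : Set (ℤ × ℤ) :=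
  {q | ∃ k : ℕ, (k : ℤ) < s.reg 0 ∧
    q = (s.mem (s.reg 1 + 2 * k), s.mem (s.reg 1 + 2 * k + 1))}

end StripPacking

open StripPacking

namespace StripPacking

/-! ### Execution of loop-free programs, and loops with a decreasing measure -/

/-! The theorem rests on the fact that a nice hole is the region between two step functions over a
common interval. Without left and right notches, the boundary can reverse its horizontal direction
only at leftmost and rightmost edges. Take a leftmost edge `e` of largest abscissa and follow the
rightward edges after it and the leftward edges before it. No further horizontal edge can get
between these two chains: it would have to begin at a vertical edge with both neighbours to its
right, which is a leftmost edge beyond `e` or a right notch. Hence the chain that turns back first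
turns back into the other one (`Chains.top_end_eq`), and the curve consists of the two chains and
the vertical edges at both ends (`exists_monotone_chains`). An elementary Jordan argument,
`Profile.union_innerRegion`, identifies `S` with a `profileRegion`.

For a small shift to the left or downwards of a rectangle in `S`, feasibility amounts to staying in
`S` (`IsHoleOfPacking.stable_iff`). A stable rectangle therefore rests on the maximum of the lower
function over its width, and its left side is at the left end of the hole or at a breakpoint of one
of the functions (`stable_profileRegion`, `Columns.stableIn_iff`). So each breakpoint carries at
most one candidate, which is decided by the maximum of the lower and the minimum of the upper
function over a window of width `w`, and by the values just to the left.

The program merges the chains into columns on which both functions are constant; their number is at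
most the number of edges in the chains. Upper values are stored negated, so that both extrema are
maxima over a sliding window. These are maintained as in a queue made of two stacks: suffix maxima
for a front part, one running maximum for a back part. Every round of a loop lowers an integer
measure that is initially linear in the number of vertices, and `runs_loop` turns this into the time
bound. -/

/-- A bound on the running time of a loop-free program. -/
def Program.bound : Program → ℕ
  | .skip => 1
  | .assign _ e => e.cost + 1
  | .store a e => a.cost + e.cost + 1
  | .seq c d => c.bound + d.bound
  -- The sum bounds either branch. The value for loops below is a default: the bound is applied to
  -- loop-free programs only.
  | .ifElse b c d => b.cost + 1 + (c.bound + d.bound)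
  | .loop _ _ => 0

def Program.LoopFree : Program → Prop
  | .skip => True
  | .assign _ _ => True
  | .store _ _ => True
  | .seq c d => c.LoopFree ∧ d.LoopFree
  | .ifElse _ c d => c.LoopFree ∧ d.LoopFree
  | .loop _ _ => False

open Classical in
/-- The final state of a loop-free program. -/
noncomputable def Program.exec : Program → State → State
  | .skip, s => s
  | .assign r e, s => ⟨Function.update s.reg r (e.eval s), s.mem⟩
  | .store a e, s => ⟨s.reg, Function.update s.mem (a.eval s) (e.eval s)⟩
  | .seq c d, s => d.exec (c.exec s)
  | .ifElse b c d, s => if b.eval s then c.exec s else d.exec s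
  | .loop _ _, s => s

theorem Program.runs_exec {c : Program} (hc : c.LoopFree) (s : State) :
    ∃ t ≤ c.bound, Runs c s t (c.exec s) := by
  induction c generalizing s with
  | skip => exact ⟨1, le_rfl, .skip s⟩
  | assign r e => exact ⟨_, le_rfl, .assign r e s⟩
  | store a e => exact ⟨_, le_rfl, .store a e s⟩
  | seq c d ihc ihd =>
    obtain ⟨t, ht, hr⟩ := ihc hc.1 s
    obtain ⟨u, hu, hr'⟩ := ihd hc.2 (c.exec s)
    exact ⟨t + u, Nat.add_le_add ht hu, .seq hr hr'⟩
  | ifElse b c d ihc ihd =>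
    by_cases hb : b.eval s
    · obtain ⟨t, ht, hr⟩ := ihc hc.1 s
      refine ⟨b.cost + 1 + t, ?_, ?_⟩
      · simp only [Program.bound]; omega
      · simp only [Program.exec, if_pos hb]; exact .ifTrue hb hr
    · obtain ⟨t, ht, hr⟩ := ihd hc.2 s
      refine ⟨b.cost + 1 + t, ?_, ?_⟩
      · simp only [Program.bound]; omega
      · simp only [Program.exec, if_neg hb]; exact .ifFalse hb hr
  | loop b c _ => exact hc.elim

/-- A loop whose body decreases a measure runs in time linear in the measure. -/
theorem runs_loop {b : BExp} {c : Program} (hc : c.LoopFree) {Inv : ℕ → State → Prop}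
    (step : ∀ N s, Inv N s → b.eval s → ∃ N' < N, Inv N' (c.exec s)) {N : ℕ} {s : State}
    (hs : Inv N s) :
    ∃ t s', t ≤ (b.cost + 1 + c.bound) * (N + 1) ∧ Runs (.loop b c) s t s' ∧
      (∃ N', Inv N' s') ∧ ¬ b.eval s' := by
  induction N using Nat.strong_induction_on generalizing s with
  | _ N ih =>
    by_cases hb : b.eval s
    · obtain ⟨N', hN', hinv⟩ := step N s hs hb
      obtain ⟨t, s', ht, hr, hi, hn⟩ := ih N' hN' hinv
      obtain ⟨u, hu, hr'⟩ := Program.runs_exec hc s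
      refine ⟨b.cost + 1 + u + t, s', ?_, .loopTrue hb hr' hr, hi, hn⟩
      -- The drop of the measure frees the allowance of one round, which pays for the round just
      -- made.
      have : (b.cost + 1 + c.bound) * (N' + 1 + 1) ≤ (b.cost + 1 + c.bound) * (N + 1) :=
        Nat.mul_le_mul_left _ (by omega)
      rw [Nat.mul_succ] at this
      omega
    · refine ⟨b.cost + 1, s, ?_, .loopFalse hb, ⟨N, hs⟩, hb⟩
      have : (b.cost + 1 + c.bound) * 1 ≤ (b.cost + 1 + c.bound) * (N + 1) :=
        Nat.mul_le_mul_left _ (by omega)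
      omega

/-! ### Rectilinear arcs without left and right notches are monotone -/

section Monotone

variable {n : ℕ} {V : ZMod n → ℤ × ℤ}

theorem edgeSeg_of_horizontal {i : ZMod n} (h : (V (i + 1)).2 = (V i).2) :
    edgeSeg V i = {p : ℝ × ℝ | p.1 ∈ uIcc ((V i).1 : ℝ) (V (i + 1)).1 ∧ p.2 = ((V i).2 : ℝ)} := by
  unfold edgeSeg toPlane
  rw [h, ← Prod.image_mk_segment_left, segment_eq_uIcc]
  ext ⟨x, y⟩
  simp only [mem_image, Prod.mk.injEq, mem_ofPred_eq]
  constructor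
  · rintro ⟨z, hz, rfl, rfl⟩; exact ⟨hz, rfl⟩
  · rintro ⟨hz, rfl⟩; exact ⟨x, hz, rfl, rfl⟩

theorem edgeSeg_of_vertical {i : ZMod n} (h : (V (i + 1)).1 = (V i).1) :
    edgeSeg V i = {p : ℝ × ℝ | p.1 = ((V i).1 : ℝ) ∧ p.2 ∈ uIcc ((V i).2 : ℝ) (V (i + 1)).2} := by
  unfold edgeSeg toPlane
  rw [h, ← Prod.image_mk_segment_right, segment_eq_uIcc]
  ext ⟨x, y⟩
  simp only [mem_image, Prod.mk.injEq, mem_ofPred_eq]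
  constructor
  · rintro ⟨z, hz, rfl, rfl⟩; exact ⟨rfl, hz⟩
  · rintro ⟨rfl, hz⟩; exact ⟨y, hz, rfl, rfl⟩

theorem Horizontal.snd_eq {i : ZMod n} (h : Horizontal V i) : (V (i + 1)).2 = (V i).2 :=
  h.elim And.left And.left

theorem Vertical.fst_eq {i : ZMod n} (h : Vertical V i) : (V (i + 1)).1 = (V i).1 :=
  h.elim And.left And.left

theorem Horizontal.not_vertical {i : ZMod n} (h : Horizontal V i) : ¬ Vertical V i := by
  rintro (⟨h1, h2⟩ | ⟨h1, h2⟩) <;> rcases h with ⟨h3, h4⟩ | ⟨h3, h4⟩ <;> omega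

theorem Rightward.not_leftward {i : ZMod n} (h : Rightward V i) : ¬ Leftward V i := by
  rintro ⟨h1, h2⟩; have := h.2; omega

theorem Rightward.horizontal {i : ZMod n} (h : Rightward V i) : Horizontal V i := .inr h

theorem Leftward.horizontal {i : ZMod n} (h : Leftward V i) : Horizontal V i := .inl h

variable (hV : IsClosedRectilinearArc V)

namespace IsClosedRectilinearArc

include hV

theorem vertical_add_one {i : ZMod n} (h : Horizontal V i) : Vertical V (i + 1) := by
  rcases hV.1 i with h' | h'
  · exact h'.2
  · exact absurd h'.1 h.not_vertical

theorem horizontal_add_one {i : ZMod n} (h : Vertical V i) : Horizontal V (i + 1) := by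
  rcases hV.1 i with h' | h'
  · exact absurd h h'.1.not_vertical
  · exact h'.2

theorem vertical_of_add_one {i : ZMod n} (h : Horizontal V (i + 1)) : Vertical V i := by
  rcases hV.1 i with h' | h'
  · exact absurd h'.2 h.not_vertical
  · exact h'.1

theorem horizontal_of_add_one {i : ZMod n} (h : Vertical V (i + 1)) : Horizontal V i := by
  rcases hV.1 i with h' | h'
  · exact h'.1
  · exact absurd h h'.2.not_vertical

/-- A horizontal and a vertical edge which do not follow each other do not meet. -/
theorem not_meet {l v : ZMod n} (hl : Horizontal V l) (hv : Vertical V v)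
    (h1 : v ≠ l + 1) (h2 : l ≠ v + 1)
    (hx : min (V l).1 (V (l + 1)).1 ≤ (V v).1) (hx' : (V v).1 ≤ max (V l).1 (V (l + 1)).1)
    (hy : min (V v).2 (V (v + 1)).2 ≤ (V l).2) (hy' : (V l).2 ≤ max (V v).2 (V (v + 1)).2) :
    False := by
  have hne : l ≠ v := by rintro rfl; exact hl.not_vertical hv
  have := hV.2 l v hne (((V v).1 : ℝ), ((V l).2 : ℝ)) ⟨?_, ?_⟩
  · rcases this with h | h
    · exact h1 h.1
    · exact h2 h.1
  · rw [edgeSeg_of_horizontal hl.snd_eq]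
    refine ⟨?_, rfl⟩
    rw [mem_uIcc]
    simp only [Int.cast_le]
    omega
  · rw [edgeSeg_of_vertical hv.fst_eq]
    refine ⟨rfl, ?_⟩
    rw [mem_uIcc]
    simp only [Int.cast_le]
    omega

/-- Different horizontal edges over the same unit interval have different heights. -/
theorem eq_of_overlap {l m : ZMod n} (hl : Horizontal V l) (hm : Horizontal V m) {k : ℤ}
    (h1 : min (V l).1 (V (l + 1)).1 ≤ k) (h2 : k < max (V l).1 (V (l + 1)).1)
    (h3 : min (V m).1 (V (m + 1)).1 ≤ k) (h4 : k < max (V m).1 (V (m + 1)).1)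
    (hy : (V l).2 = (V m).2) : l = m := by
  by_contra hne
  -- The midpoint `k + 1 / 2` of the unit interval gives a common point of the two edges that is not
  -- integral, whereas different edges meet only at vertices.
  have aux : ∀ a b : ℤ, min a b ≤ k → k < max a b → (k : ℝ) + 1 / 2 ∈ uIcc (a : ℝ) b := by
    intro a b h h'
    rw [mem_uIcc]
    rcases le_total a b with hab | hab
    · rw [min_eq_left hab] at h
      rw [max_eq_right hab] at h'
      have h1 : (a : ℝ) ≤ k := by exact_mod_cast h
      have h2 : (k : ℝ) + 1 ≤ b := by exact_mod_cast h'
      left; constructor <;> linarith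
    · rw [min_eq_right hab] at h
      rw [max_eq_left hab] at h'
      have h1 : (b : ℝ) ≤ k := by exact_mod_cast h
      have h2 : (k : ℝ) + 1 ≤ a := by exact_mod_cast h'
      right; constructor <;> linarith
  have key : ∀ a : ℤ, (k : ℝ) + 1 / 2 ≠ a := by
    intro a ha
    have h2 : ((2 * k + 1 : ℤ) : ℝ) = (2 * a : ℤ) := by push_cast; linarith
    have : 2 * k + 1 = 2 * a := by exact_mod_cast h2
    omega
  have := hV.2 l m hne ((k : ℝ) + 1 / 2, ((V l).2 : ℝ)) ⟨?_, ?_⟩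
  · rcases this with h | h <;> exact key _ (congrArg Prod.fst h.2)
  · rw [edgeSeg_of_horizontal hl.snd_eq]
    exact ⟨aux _ _ h1 h2, rfl⟩
  · rw [edgeSeg_of_horizontal hm.snd_eq]
    exact ⟨aux _ _ h3 h4, by simp [hy]⟩

/-- Otherwise the vertical edge between the two lower edges would cross or touch the upper edge `i`.
This carries the order of the chains over a step of the lower one. -/
theorem bot_lt_of_bot_step {i j : ZMod n} (hi : Rightward V i) (hj : Leftward V (j + 1 + 1))
    (hj' : Leftward V j) (h1 : (V i).1 ≤ (V (j + 1 + 1)).1)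
    (h2 : (V (j + 1 + 1)).1 ≤ (V (i + 1)).1) (hlt : (V (j + 1 + 1)).2 < (V i).2) :
    (V j).2 < (V i).2 := by
  by_contra hcon
  have hv : Vertical V (j + 1) := hV.vertical_add_one hj'.horizontal
  have e1 := hv.fst_eq
  have e2 := hj'.1
  refine hV.not_meet hi.horizontal hv ?_ ?_ ?_ ?_ ?_ ?_
  · intro h
    exact hi.not_leftward (add_right_cancel h ▸ hj')
  · rintro rfl; exact hi.not_leftward hj
  all_goals omega

/-- The counterpart for a step of the upper chain: its vertical edge would cross or touch the lower
edge `j`. -/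
theorem bot_lt_of_top_step {i j : ZMod n} (hi : Rightward V i) (hi' : Rightward V (i + 1 + 1))
    (hj : Leftward V j) (h1 : (V (j + 1)).1 ≤ (V (i + 1)).1)
    (h2 : (V (i + 1)).1 ≤ (V j).1) (hlt : (V j).2 < (V i).2) :
    (V j).2 < (V (i + 1 + 1)).2 := by
  by_contra hcon
  have hv : Vertical V (i + 1) := hV.vertical_add_one hi.horizontal
  have e1 := hv.fst_eq
  have e2 := hi.1
  refine hV.not_meet hj.horizontal hv ?_ ?_ ?_ ?_ ?_ ?_
  · intro h
    exact hi.not_leftward (add_right_cancel h ▸ hj)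
  · rintro rfl; exact hi'.not_leftward hj
  all_goals omega

end IsClosedRectilinearArc

/-- The horizontal edge `l` lies over or under the unit interval `[k, k + 1]`. -/
def Spans (V : ZMod n → ℤ × ℤ) (l : ZMod n) (k : ℤ) : Prop :=
  (Rightward V l ∧ (V l).1 ≤ k ∧ k < (V (l + 1)).1) ∨
    (Leftward V l ∧ (V (l + 1)).1 ≤ k ∧ k < (V l).1)

theorem Spans.horizontal {l : ZMod n} {k : ℤ} (h : Spans V l k) : Horizontal V l :=
  h.elim (fun h => .inr h.1) (fun h => .inl h.1)

/-- Over the unit interval `[k, k + 1]` the rightward edge `i` is the next one above the leftward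
edge `j`. -/
structure Adjacent (V : ZMod n → ℤ × ℤ) (k : ℤ) (i j : ZMod n) : Prop where
  top : Rightward V i
  top_le : (V i).1 ≤ k
  lt_top : k < (V (i + 1)).1
  bot : Leftward V j
  bot_le : (V (j + 1)).1 ≤ k
  lt_bot : k < (V j).1
  lt : (V j).2 < (V i).2
  next : ∀ l, Spans V l k → (V l).2 ≤ (V j).2 ∨ (V i).2 ≤ (V l).2

namespace IsClosedRectilinearArc

include hV

/-- A vertical edge at `k + 1` which starts between two adjacent edges ends between them. -/
theorem between_step {k : ℤ} {i j i' j' l m v : ZMod n} (hA : Adjacent V k i j)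
    (hi' : (i' = i ∧ k + 1 < (V (i + 1)).1) ∨
      (i' = i + 1 + 1 ∧ (V (i + 1)).1 = k + 1 ∧ Rightward V i'))
    (hj' : (j' = j ∧ k + 1 < (V j).1) ∨ (j = j' + 1 + 1 ∧ (V j).1 = k + 1 ∧ Leftward V j'))
    (hl : Horizontal V l) (hm : Horizontal V m)
    (hlk : min (V l).1 (V (l + 1)).1 = k + 1) (hmk : max (V m).1 (V (m + 1)).1 = k + 1)
    (hv : Vertical V v) (hvx : (V v).1 = k + 1)
    (hlvm : (l + 1 = v ∧ v + 1 = m) ∨ (m + 1 = v ∧ v + 1 = l))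
    (h1 : (V j').2 < (V l).2) (h2 : (V l).2 < (V i').2) :
    (V j).2 < (V m).2 ∧ (V m).2 < (V i).2 := by
  have evx := hv.fst_eq
  have el := hl.snd_eq
  have em := hm.snd_eq
  have hi'R : Rightward V i' := by
    rcases hi' with h | h
    · rw [h.1]; exact hA.top
    · exact h.2.2
  have hj'L : Leftward V j' := by
    rcases hj' with h | h
    · rw [h.1]; exact hA.bot
    · exact h.2.2
  have hvy : ((V v).2 = (V l).2 ∧ (V (v + 1)).2 = (V m).2) ∨
      ((V v).2 = (V m).2 ∧ (V (v + 1)).2 = (V l).2) := by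
    rcases hlvm with ⟨rfl, rfl⟩ | ⟨rfl, rfl⟩
    · exact .inl ⟨el, rfl⟩
    · exact .inr ⟨em, rfl⟩
  have hneighbour : ∀ u, (v = u + 1 ∨ u = v + 1) → u = l ∨ u = m := by
    rintro u (hu | rfl)
    · rcases hlvm with ⟨h, -⟩ | ⟨h, -⟩
      · left; exact add_right_cancel (hu.symm.trans h.symm)
      · right; exact add_right_cancel (hu.symm.trans h.symm)
    · rcases hlvm with ⟨-, h⟩ | ⟨-, h⟩
      · exact .inr h
      · exact .inl h
  have t1 := hA.top.1
  have t2 := hA.top.2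
  have t3 := hA.top_le
  have t4 := hA.lt_top
  have b1 := hA.bot.1
  have b2 := hA.bot.2
  have b3 := hA.bot_le
  have b4 := hA.lt_bot
  -- the edge `v` meets neither `i'` nor `j'`
  have hi'x : (V i').1 ≤ k + 1 ∧ k + 1 < (V (i' + 1)).1 := by
    rcases hi' with ⟨rfl, h⟩ | ⟨rfl, h, h'⟩
    · omega
    · have := (hV.vertical_add_one hA.top.horizontal).fst_eq
      have := h'.2
      omega
  have hj'x : (V (j' + 1)).1 ≤ k + 1 ∧ k + 1 < (V j').1 := by
    rcases hj' with ⟨rfl, h⟩ | ⟨rfl, h, h'⟩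
    · omega
    · have := (hV.vertical_add_one h'.horizontal).fst_eq
      have := h'.2
      omega
  have free : ∀ u, Horizontal V u → min (V u).1 (V (u + 1)).1 ≤ k + 1 →
      k + 1 < max (V u).1 (V (u + 1)).1 → (V u).2 ≠ (V l).2 →
      ¬ (min (V l).2 (V m).2 ≤ (V u).2 ∧ (V u).2 ≤ max (V l).2 (V m).2) := by
    intro u hu hu1 hu2 hne ⟨hu3, hu4⟩
    have hul : u ≠ l := fun h => hne (by rw [h])
    have hum : u ≠ m := by rintro rfl; omega
    refine hV.not_meet hu hv ?_ ?_ ?_ ?_ ?_ ?_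
    · intro h; rcases hneighbour u (.inl h) with h | h <;> contradiction
    · intro h; rcases hneighbour u (.inr h) with h | h <;> contradiction
    all_goals omega
  have f1 := free i' hi'R.horizontal (by omega) (by omega) (by omega)
  have f2 := free j' hj'L.horizontal (by omega) (by omega) (by omega)
  constructor
  · rcases hj' with ⟨rfl, h⟩ | ⟨rfl, h, h'⟩
    · omega
    -- `f2` keeps `m` above `j'`. At the height of `j` or lower, `m` would end on the vertical edge
    -- that joins `j'` to `j`.
    by_contra hcon
    have hw := hV.vertical_add_one h'.horizontal
    have := hw.fst_eq
    have := h'.1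
    refine hV.not_meet hm hw ?_ ?_ ?_ ?_ ?_ ?_
    · intro hh
      rw [← add_right_cancel hh] at hmk
      omega
    · rintro rfl
      rcases hlvm with ⟨rfl, hh⟩ | ⟨rfl, rfl⟩
      · rw [← add_right_cancel (add_right_cancel hh)] at h1
        omega
      · omega
    all_goals omega
  · rcases hi' with ⟨rfl, h⟩ | ⟨rfl, h, h'⟩
    · omega
    by_contra hcon
    have hw := hV.vertical_add_one hA.top.horizontal
    have := hw.fst_eq
    refine hV.not_meet hm hw ?_ ?_ ?_ ?_ ?_ ?_
    · intro hh
      have hmi := add_right_cancel hh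
      subst hmi
      rcases hlvm with ⟨rfl, hh⟩ | ⟨rfl, rfl⟩
      · rw [hh] at evx
        omega
      · omega
    · rintro rfl
      omega
    all_goals omega

/-- An edge between the new pair either spans `[k, k + 1]` already, against the old adjacency, or
begins at the abscissa `k + 1`. In the second case consider the horizontal edge at the other end of
its vertical edge at `k + 1`. If that one extends to the left, it lies between the old pair by
`between_step`; if it extends to the right, the vertical edge is a leftmost edge or a right notch.
-/
theorem adjacent_step (hR : ∀ i, ¬ IsRightNotch V i) {k : ℤ} {i j i' j' : ZMod n}
    (hk : ∀ e, IsLeftmostEdge V e → (V e).1 ≠ k + 1) (hA : Adjacent V k i j)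
    (hi' : (i' = i ∧ k + 1 < (V (i + 1)).1) ∨
      (i' = i + 1 + 1 ∧ (V (i + 1)).1 = k + 1 ∧ Rightward V i'))
    (hj' : (j' = j ∧ k + 1 < (V j).1) ∨ (j = j' + 1 + 1 ∧ (V j).1 = k + 1 ∧ Leftward V j')) :
    Adjacent V (k + 1) i' j' := by
  have t3 := hA.top_le
  have t4 := hA.lt_top
  have b3 := hA.bot_le
  have b4 := hA.lt_bot
  have hlt := hA.lt
  have hi'R : Rightward V i' := by
    rcases hi' with h | h
    · rw [h.1]; exact hA.top
    · exact h.2.2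
  have hj'L : Leftward V j' := by
    rcases hj' with h | h
    · rw [h.1]; exact hA.bot
    · exact h.2.2
  have hi'x : (V i').1 ≤ k + 1 ∧ k + 1 < (V (i' + 1)).1 := by
    rcases hi' with ⟨rfl, h⟩ | ⟨rfl, h, h'⟩
    · omega
    · have := (hV.vertical_add_one hA.top.horizontal).fst_eq
      have := h'.2
      omega
  have hj'x : (V (j' + 1)).1 ≤ k + 1 ∧ k + 1 < (V j').1 := by
    rcases hj' with ⟨rfl, h⟩ | ⟨rfl, h, h'⟩
    · omega
    · have := (hV.vertical_add_one h'.horizontal).fst_eq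
      have := h'.2
      omega
  have hlt1 : (V j).2 < (V i').2 := by
    rcases hi' with ⟨rfl, h⟩ | ⟨rfl, h, h'⟩
    · exact hlt
    · exact hV.bot_lt_of_top_step hA.top h' hA.bot (by omega) (by omega) hlt
  have hlt2 : (V j').2 < (V i').2 := by
    rcases hj' with ⟨rfl, h⟩ | ⟨rfl, h, h'⟩
    · exact hlt1
    · exact hV.bot_lt_of_bot_step hi'R hA.bot h' (by omega) (by omega) hlt1
  refine ⟨hi'R, hi'x.1, hi'x.2, hj'L, hj'x.1, hj'x.2, hlt2, ?_⟩
  intro l hl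
  by_contra! hcon
  have hlH := hl.horizontal
  have t1 := hA.top.1
  have hspan : min (V l).1 (V (l + 1)).1 ≤ k + 1 ∧ k + 1 < max (V l).1 (V (l + 1)).1 := by
    rcases hl with h | h <;> omega
  by_cases hlo : min (V l).1 (V (l + 1)).1 ≤ k
  · have hlk : Spans V l k := by
      rcases hl with h | h
      · exact .inl ⟨h.1, by omega, by omega⟩
      · exact .inr ⟨h.1, by omega, by omega⟩
    have el := hlH.snd_eq
    have h1 : (V j).2 < (V l).2 := by
      rcases hj' with ⟨rfl, h⟩ | ⟨rfl, h, h'⟩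
      · exact hcon.1
      by_contra hle
      have hw := hV.vertical_add_one h'.horizontal
      have := hw.fst_eq
      have := h'.1
      refine hV.not_meet hlH hw ?_ ?_ ?_ ?_ ?_ ?_
      · intro hh
        rw [← add_right_cancel hh] at hcon
        omega
      · rintro rfl; omega
      all_goals omega
    have h2 : (V l).2 < (V i).2 := by
      rcases hi' with ⟨rfl, h⟩ | ⟨rfl, h, h'⟩
      · exact hcon.2
      by_contra hle
      have hw := hV.vertical_add_one hA.top.horizontal
      have := hw.fst_eq
      refine hV.not_meet hlH hw ?_ ?_ ?_ ?_ ?_ ?_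
      · intro hh
        rw [← add_right_cancel hh] at hspan
        omega
      · rintro rfl; omega
      all_goals omega
    rcases hA.next l hlk with h | h <;> omega
  · have hlo' : min (V l).1 (V (l + 1)).1 = k + 1 := by omega
    rcases hl with hl | hl
    · obtain ⟨m, rfl⟩ : ∃ m, l = m + 1 + 1 := ⟨l - 1 - 1, by ring⟩
      have hv := hV.vertical_of_add_one hlH
      have hvx := hv.fst_eq
      have hmH := hV.horizontal_of_add_one hv
      rcases hmH with hm | hm
      · rcases hv with hv | hv
        · exact hk (m + 1) ⟨by simpa using hm, hv, hl.1⟩ (by omega)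
        · exact hR (m + 1) ⟨by simpa using hm, hv, hl.1⟩
      · have := hm.2
        have := hV.between_step hA hi' hj' hlH hm.horizontal hlo' (by omega) hv (by omega)
          (.inr ⟨rfl, rfl⟩) hcon.1 hcon.2
        rcases hA.next m (.inl ⟨hm, by omega, by omega⟩) with h | h <;> omega
    · have hv := hV.vertical_add_one hlH
      have hvx := hv.fst_eq
      have hmH := hV.horizontal_add_one hv
      rcases hmH with hm | hm
      · have := hm.2
        have := hV.between_step hA hi' hj' hlH hm.horizontal hlo' (by omega) hv (by omega)
          (.inl ⟨rfl, rfl⟩) hcon.1 hcon.2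
        rcases hA.next _ (.inr ⟨hm, by omega, by omega⟩) with h | h <;> omega
      · rcases hv with hv | hv
        · exact hk (l + 1) ⟨by simpa using hl.1, hv, hm⟩ (by omega)
        · exact hR (l + 1) ⟨by simpa using hl.1, hv, hm⟩

/-- An edge over the first unit interval, strictly between the two in height, would touch the
vertical edge `e`. -/
theorem adjacent_leftmost {e : ZMod n} (he : Upward V e) (ht : Rightward V (e + 1)) {j : ZMod n}
    (hj : Leftward V j) (hje : e = j + 1) : Adjacent V (V e).1 (e + 1) j := by
  have h1 := he.1
  have h2 := he.2
  have h3 := ht.2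
  have h4 := hj.1
  have h5 := hj.2
  subst hje
  refine ⟨ht, h1.le, by omega, hj, le_rfl, h5, by omega, ?_⟩
  intro l hl
  by_contra! hcon
  have hs : min (V l).1 (V (l + 1)).1 ≤ (V (j + 1)).1 ∧
      (V (j + 1)).1 < max (V l).1 (V (l + 1)).1 := by
    rcases hl with h | h <;> omega
  refine hV.not_meet hl.horizontal (.inl he) ?_ ?_ ?_ ?_ ?_ ?_
  · intro hh
    rw [add_right_cancel hh] at hcon
    omega
  · rintro rfl; omega
  all_goals omega

end IsClosedRectilinearArc

/-! ### The two chains issuing from a leftmost edge -/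

/-- The rightward edges `T 0, …, T (p - 1)` which follow the leftmost edge `e`, and the leftward
edges `B (q - 1), …, B 0` which precede it. -/
structure Chains (V : ZMod n → ℤ × ℤ) (e : ZMod n) (T B : ℕ → ZMod n) (p q : ℕ) : Prop where
  leftmost : Upward V e
  top_zero : T 0 = e + 1
  top_succ : ∀ a, T (a + 1) = T a + 1 + 1
  bot_zero : e = B 0 + 1
  bot_succ : ∀ b, B b = B (b + 1) + 1 + 1
  top_pos : 0 < p
  bot_pos : 0 < q
  top : ∀ a < p, Rightward V (T a)
  bot : ∀ b < q, Leftward V (B b)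
  top_end : Leftward V (T p)
  bot_end : Rightward V (B q)

namespace Chains

variable {e : ZMod n} {T B : ℕ → ZMod n} {p q : ℕ} (C : Chains V e T B p q)

include C

/-- Every edge belongs to one of the chains, or joins consecutive edges of them. -/
theorem edge_cases (hend : T p = B (q - 1)) [NeZero n] (i : ZMod n) :
    i = e ∨ (∃ a < p, i = T a ∨ i = T a + 1) ∨ (∃ b < q, i = B b ∨ i = B b + 1) := by
  -- Induction on the number of steps from `e`: the traversal never leaves the listed edges, since
  -- `hend` leads from the end of the upper chain into the lower one.
  suffices h : ∀ r : ℕ, ∀ i : ZMod n, i = e + r →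
      i = e ∨ (∃ a < p, i = T a ∨ i = T a + 1) ∨ (∃ b < q, i = B b ∨ i = B b + 1) from
    h (i - e).val i (by rw [ZMod.natCast_zmod_val]; ring)
  intro r
  induction r with
  | zero => intro i hi; left; simpa using hi
  | succ r ih =>
    intro i hi
    have hi : i = (e + r) + 1 := by rw [hi]; push_cast; ring
    have hp := C.top_pos
    have hq := C.bot_pos
    rcases ih _ rfl with h | ⟨a, ha, h | h⟩ | ⟨b, hb, h | h⟩
    · exact .inr (.inl ⟨0, C.top_pos, .inl (by rw [hi, h, C.top_zero])⟩)
    · exact .inr (.inl ⟨a, ha, .inr (by rw [hi, h])⟩)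
    · by_cases hap : a + 1 < p
      · exact .inr (.inl ⟨a + 1, hap, .inl (by rw [hi, h, C.top_succ])⟩)
      · refine .inr (.inr ⟨q - 1, by omega, .inl ?_⟩)
        rw [hi, h, ← C.top_succ, ← hend]
        congr 1; omega
    · exact .inr (.inr ⟨b, hb, .inr (by rw [hi, h])⟩)
    · rcases b with _ | b
      · exact .inr (.inl ⟨0, hp, .inl (by rw [hi, h, C.top_zero, ← C.bot_zero])⟩)
      · exact .inr (.inr ⟨b, by omega, .inl (by rw [hi, h, C.bot_succ b])⟩)

/-- Consecutive edges of a chain have the same direction, so `e` is the only place where a leftward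
edge is followed by a rightward one. -/
theorem leftmost_unique (hend : T p = B (q - 1)) [NeZero n] {i : ZMod n}
    (hi : IsLeftmostEdge V i) : i = e := by
  have hH : ¬ Horizontal V i := fun h => h.not_vertical (.inl hi.2.1)
  rcases C.edge_cases hend i with h | ⟨a, ha, rfl | rfl⟩ | ⟨b, hb, rfl | rfl⟩
  · exact h
  · exact absurd (C.top a ha).horizontal hH
  · have := hi.1
    rw [add_sub_cancel_right] at this
    exact absurd this (C.top a ha).not_leftward
  · exact absurd (C.bot b hb).horizontal hH
  · rcases b with _ | b
    · rw [C.bot_zero]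
    · have := hi.2.2
      rw [← C.bot_succ] at this
      exact absurd (C.bot b (by omega)) this.not_leftward

theorem rightmost_unique (hend : T p = B (q - 1)) [NeZero n] {i : ZMod n}
    (hi : IsRightmostEdge V i) : i + 1 = T p := by
  have hH : ¬ Horizontal V i := fun h => h.not_vertical (.inr hi.2.1)
  rcases C.edge_cases hend i with rfl | ⟨a, ha, rfl | rfl⟩ | ⟨b, hb, rfl | rfl⟩
  · have h1 := hi.2.1.2
    have h2 := C.leftmost.2
    omega
  · exact absurd (C.top a ha).horizontal hH
  · by_cases hap : a + 1 < p
    · have := hi.2.2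
      rw [← C.top_succ] at this
      exact absurd this (C.top _ hap).not_leftward
    · rw [← C.top_succ]
      congr 1; omega
  · exact absurd (C.bot b hb).horizontal hH
  · have := hi.1
    rw [add_sub_cancel_right] at this
    exact absurd (C.bot b hb) this.not_leftward

include hV

theorem top_right {a : ℕ} (ha : a < p) : (V (T a + 1)).1 = (V (T (a + 1))).1 := by
  rw [C.top_succ]
  exact (hV.vertical_add_one (C.top a ha).horizontal).fst_eq.symm

theorem bot_left {b : ℕ} (hb : b + 1 < q) : (V (B (b + 1) + 1)).1 = (V (B b)).1 := by
  rw [C.bot_succ b]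
  exact (hV.vertical_add_one (C.bot _ hb).horizontal).fst_eq.symm

theorem top_ge {a : ℕ} (ha : a ≤ p) : (V e).1 + a ≤ (V (T a)).1 := by
  induction a with
  | zero => rw [C.top_zero, C.leftmost.1]; simp
  | succ a ih =>
    rw [← C.top_right hV ha]
    have := (C.top a ha).2
    have := ih (by omega)
    push_cast
    omega

theorem bot_ge {b : ℕ} (hb : b < q) : (V e).1 + b ≤ (V (B b + 1)).1 := by
  induction b with
  | zero => rw [← C.bot_zero]; simp
  | succ b ih =>
    rw [C.bot_left hV hb]
    have := (C.bot b (by omega)).2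
    have := ih (by omega)
    push_cast
    omega

/-- Induction on `k` from the abscissa of `e`: one unit to the right, each chain advances by at most
one edge. The maximality `he` excludes the leftmost edges that `adjacent_step` has to avoid. -/
theorem adjacent (hR : ∀ i, ¬ IsRightNotch V i)
    (he : ∀ i, IsLeftmostEdge V i → (V i).1 ≤ (V e).1) {k : ℤ} (hk : (V e).1 ≤ k) :
    ∀ a b, a < p → b < q → (V (T a)).1 ≤ k → k < (V (T a + 1)).1 →
      (V (B b + 1)).1 ≤ k → k < (V (B b)).1 → Adjacent V k (T a) (B b) := by
  induction k, hk using Int.leInduction with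
  | base =>
    intro a b ha hb h1 h2 h3 h4
    have := C.top_ge hV ha.le
    have := C.bot_ge hV hb
    obtain rfl : a = 0 := by omega
    obtain rfl : b = 0 := by omega
    rw [C.top_zero]
    exact hV.adjacent_leftmost C.leftmost (C.top_zero ▸ C.top 0 C.top_pos) (C.bot 0 C.bot_pos)
      C.bot_zero
  | succ k hk ih =>
    intro a b ha hb h1 h2 h3 h4
    obtain ⟨a', ha', g1, g2, g3⟩ : ∃ a' < p, (V (T a')).1 ≤ k ∧ k < (V (T a' + 1)).1 ∧
        ((T a = T a' ∧ k + 1 < (V (T a' + 1)).1) ∨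
          (T a = T a' + 1 + 1 ∧ (V (T a' + 1)).1 = k + 1 ∧ Rightward V (T a))) := by
      by_cases h : (V (T a)).1 ≤ k
      · exact ⟨a, ha, h, by omega, .inl ⟨rfl, h2⟩⟩
      · have ha0 : a ≠ 0 := by
          rintro rfl
          rw [C.top_zero, C.leftmost.1] at h
          exact h hk
        obtain ⟨a', rfl⟩ : ∃ a', a = a' + 1 := Nat.exists_eq_succ_of_ne_zero ha0
        have r := C.top_right hV (a := a') (by omega)
        have := (C.top a' (by omega)).2
        exact ⟨a', by omega, by omega, by omega,
          .inr ⟨C.top_succ a', by omega, C.top _ ha⟩⟩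
    obtain ⟨b', hb', f1, f2, f3⟩ : ∃ b' < q, (V (B b' + 1)).1 ≤ k ∧ k < (V (B b')).1 ∧
        ((B b = B b' ∧ k + 1 < (V (B b')).1) ∨
          (B b' = B b + 1 + 1 ∧ (V (B b')).1 = k + 1 ∧ Leftward V (B b))) := by
      by_cases h : (V (B b + 1)).1 ≤ k
      · exact ⟨b, hb, h, by omega, .inl ⟨rfl, h4⟩⟩
      · have hb0 : b ≠ 0 := by
          rintro rfl
          rw [← C.bot_zero] at h
          exact h hk
        obtain ⟨b', rfl⟩ : ∃ b', b = b' + 1 := Nat.exists_eq_succ_of_ne_zero hb0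
        have r := C.bot_left hV (b := b') hb
        have := (C.bot b' (by omega)).2
        exact ⟨b', by omega, by omega, by omega,
          .inr ⟨C.bot_succ b', by omega, C.bot _ hb⟩⟩
    refine hV.adjacent_step hR ?_ (ih a' b' ha' hb' g1 g2 f1 f2) g3 f3
    intro i hi
    have := he i hi
    omega

theorem exists_top {k : ℤ} (h1 : (V e).1 ≤ k) (h2 : k < (V (T p)).1) :
    ∃ a < p, (V (T a)).1 ≤ k ∧ k < (V (T a + 1)).1 := by
  have hex : ∃ a, k < (V (T a)).1 := ⟨p, h2⟩
  classical
  have hp : Nat.find hex ≤ p := Nat.find_min' hex h2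
  have hpos : Nat.find hex ≠ 0 := by
    intro h0
    have := Nat.find_spec hex
    rw [h0, C.top_zero, C.leftmost.1] at this
    omega
  obtain ⟨a, ha⟩ := Nat.exists_eq_succ_of_ne_zero hpos
  have h3 := Nat.find_min hex (m := a) (by omega)
  have h4 := Nat.find_spec hex
  rw [ha] at h4
  refine ⟨a, by omega, by omega, ?_⟩
  rw [C.top_right hV (by omega)]
  exact h4

theorem exists_bot {k : ℤ} (h1 : (V e).1 ≤ k) (h2 : k < (V (B (q - 1))).1) :
    ∃ b < q, (V (B b + 1)).1 ≤ k ∧ k < (V (B b)).1 := by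
  have hex : ∃ b, k < (V (B b)).1 := ⟨q - 1, h2⟩
  classical
  have hq := C.bot_pos
  have hp : Nat.find hex ≤ q - 1 := Nat.find_min' hex h2
  refine ⟨Nat.find hex, by omega, ?_, Nat.find_spec hex⟩
  by_cases hpos : Nat.find hex = 0
  · rw [hpos, ← C.bot_zero]; exact h1
  · obtain ⟨b, hb⟩ := Nat.exists_eq_succ_of_ne_zero hpos
    have h3 := Nat.find_min hex (m := b) (by omega)
    rw [hb, Nat.succ_eq_add_one, C.bot_left hV (by omega)]
    omega

/-- The two chains end at the same rightmost edge. -/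
theorem top_end_eq (hR : ∀ i, ¬ IsRightNotch V i) (hL : ∀ i, ¬ IsLeftNotch V i)
    (he : ∀ i, IsLeftmostEdge V i → (V i).1 ≤ (V e).1) : T p = B (q - 1) := by
  have hp := C.top_pos
  have hq := C.bot_pos
  obtain ⟨p, rfl⟩ := Nat.exists_eq_succ_of_ne_zero hp.ne'
  obtain ⟨q, rfl⟩ := Nat.exists_eq_succ_of_ne_zero hq.ne'
  have hge := C.top_ge hV (a := p + 1) le_rfl
  have hge' := C.bot_ge hV (b := q) (by omega)
  have hq2 := (C.bot q (by omega)).2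
  simp only [Nat.succ_eq_add_one, Nat.add_sub_cancel] at *
  -- Suppose the upper chain turns back first. It turns downwards, since turning upwards makes a
  -- left notch. By adjacency the turning edge `T (p + 1)` is not above the lower edge `B b`; if it
  -- were strictly below, the vertical edge at the turn would run into `B b`. So both have the same
  -- height and overlap, hence coincide. The other case is symmetric.
  rcases le_total (V (T (p + 1))).1 (V (B q)).1 with hle | hle
  · obtain ⟨b, hb, hb1, hb2⟩ := C.exists_bot hV (k := (V (T (p + 1))).1 - 1)
      (by push_cast at hge; omega) (by simp; omega)
    have r := C.top_right hV (a := p) (by omega)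
    have hT := C.top p (by omega)
    have hTe := C.top_end
    have hA := C.adjacent hV hR he (k := (V (T (p + 1))).1 - 1) (by push_cast at hge; omega)
      p b (by omega) hb (by have := hT.2; omega) (by omega) hb1 hb2
    rw [C.top_succ p] at hA hTe hb1 hb2 hle ⊢
    have hv := hV.vertical_add_one hT.horizontal
    have hvx := hv.fst_eq
    have hd : Downward V (T p + 1) := by
      rcases hv with hu | hd
      · exact absurd ⟨by simpa using hT, hu, hTe⟩ (hL (T p + 1))
      · exact hd
    have hd2 := hd.2
    have hTe2 := hTe.2
    have hT1 := hT.1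
    have hlt := hA.lt
    have hbL := C.bot b hb
    have hend : T p + 1 + 1 = B b := by
      rcases hA.next _ (.inr ⟨hTe, by omega, by omega⟩) with h | h
      · rcases h.eq_or_lt with h | h
        · exact hV.eq_of_overlap hTe.horizontal hbL.horizontal
            (k := (V (T p + 1 + 1)).1 - 1) (by omega) (by omega) (by omega) (by omega) h
        · exfalso
          refine hV.not_meet hbL.horizontal hv ?_ ?_ ?_ ?_ ?_ ?_
          · intro hh
            exact hT.not_leftward (add_right_cancel hh ▸ hbL)
          · intro hh; rw [hh] at h; omega
          all_goals omega
      · omega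
    -- Otherwise the edge two places before `B b` would be the leftward edge `B (b + 1)`, but it is
    -- the rightward edge `T p`.
    have : b = q := by
      by_contra hne
      have h2 := C.bot (b + 1) (by omega)
      rw [C.bot_succ b] at hend
      rw [← add_right_cancel (add_right_cancel hend)] at h2
      exact hT.not_leftward h2
    rw [hend, this]
  · obtain ⟨a, ha, ha1, ha2⟩ := C.exists_top hV (k := (V (B q)).1 - 1)
      (by omega) (by simp; omega)
    have hB := C.bot q (by omega)
    have hBe := C.bot_end
    have hA := C.adjacent hV hR he (k := (V (B q)).1 - 1) (by omega)
      a q ha (by omega) ha1 ha2 (by omega) (by omega)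
    rw [C.bot_succ q] at hB hA ha1 ha2 hle hge' hq2 ⊢
    have hv := hV.vertical_add_one hBe.horizontal
    have hvx := hv.fst_eq
    have hd : Downward V (B (q + 1) + 1) := by
      rcases hv with hu | hd
      · exact absurd ⟨by simpa using hBe, hu, hB⟩ (hL (B (q + 1) + 1))
      · exact hd
    have hd2 := hd.2
    have hBe2 := hBe.2
    have hB1 := hBe.1
    have hlt := hA.lt
    have hbT := C.top a ha
    have hend : T a = B (q + 1) := by
      rcases hA.next _ (.inl ⟨hBe, by omega, by omega⟩) with h | h
      · omega
      · rcases h.eq_or_lt with h | h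
        · exact hV.eq_of_overlap hbT.horizontal hBe.horizontal
            (k := (V (B (q + 1) + 1 + 1)).1 - 1) (by omega) (by omega) (by omega) (by omega) h
        · exfalso
          refine hV.not_meet hbT.horizontal hv ?_ ?_ ?_ ?_ ?_ ?_
          · intro hh
            rw [← add_right_cancel hh] at h; omega
          · intro hh; exact hbT.not_leftward (hh ▸ hB)
          all_goals omega
    have : a = p := by
      by_contra hne
      have h2 := C.top (a + 1) (by omega)
      rw [C.top_succ a, hend] at h2
      exact h2.not_leftward hB
    rw [C.top_succ p, ← this, hend]

/-- The top chain lies above the bottom chain. -/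
theorem bot_lt_top (hR : ∀ i, ¬ IsRightNotch V i)
    (he : ∀ i, IsLeftmostEdge V i → (V i).1 ≤ (V e).1) {a b : ℕ} (ha : a < p) (hb : b < q)
    (h1 : (V (T a)).1 ≤ (V (B b)).1) (h2 : (V (B b + 1)).1 ≤ (V (T a + 1)).1) :
    (V (B b)).2 < (V (T a)).2 := by
  have g1 := C.top_ge hV ha.le
  have g2 := C.bot_ge hV hb
  have g3 := (C.top a ha).2
  have g4 := (C.bot b hb).2
  -- If the horizontal ranges share a single abscissa, adjacency just to its left concerns one of
  -- the edges and the neighbour of the other in its chain; the step lemmas carry the inequality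
  -- across.
  rcases h1.eq_or_lt with h1 | h1
  · obtain ⟨a, rfl⟩ : ∃ a', a = a' + 1 := Nat.exists_eq_succ_of_ne_zero (by
      rintro rfl
      rw [C.top_zero, C.leftmost.1] at h1
      omega)
    have r := C.top_right hV (a := a) (by omega)
    have g5 := (C.top a (by omega)).2
    have hA := C.adjacent hV hR he (k := (V (T (a + 1))).1 - 1) (by push_cast at g1; omega)
      a b (by omega) hb (by omega) (by omega) (by omega) (by omega)
    have hT := C.top (a + 1) ha
    rw [C.top_succ a] at hT ⊢
    exact hV.bot_lt_of_top_step hA.top hT hA.bot (by omega) (by omega) hA.lt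
  rcases h2.eq_or_lt with h2 | h2
  · obtain ⟨b, rfl⟩ : ∃ b', b = b' + 1 := Nat.exists_eq_succ_of_ne_zero (by
      rintro rfl
      rw [← C.bot_zero] at h2
      omega)
    have r := C.bot_left hV hb
    have g5 := (C.bot b (by omega)).2
    have hA := C.adjacent hV hR he (k := (V (B b)).1 - 1) (by push_cast at g2; omega)
      a b ha (by omega) (by omega) (by omega) (by omega) (by omega)
    have hB := C.bot b (by omega)
    have hlt := hA.lt
    rw [C.bot_succ b] at hB r hlt
    exact hV.bot_lt_of_bot_step hA.top hB (C.bot _ hb) (by omega) (by omega) hlt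
  · exact (C.adjacent hV hR he (k := max (V (T a)).1 (V (B b + 1)).1) (by omega)
      a b ha hb (by omega) (by omega) (by omega) (by omega)).lt

theorem top_lt {a a' : ℕ} (h : a < a') (ha : a' ≤ p) : (V (T a)).1 < (V (T a')).1 := by
  induction a', h using Nat.le_induction with
  | base =>
    rw [← C.top_right hV ha]
    exact (C.top a ha).2
  | succ a' h ih =>
    have := ih (by omega)
    rw [← C.top_right hV ha]
    exact this.trans (C.top a' ha).2

theorem bot_lt {b b' : ℕ} (h : b < b') (hb : b' < q) : (V (B b)).1 < (V (B b')).1 := by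
  induction b', h using Nat.le_induction with
  | base =>
    rw [← C.bot_left hV hb]
    exact (C.bot (b + 1) hb).2
  | succ b' h ih =>
    have := ih (by omega)
    rw [← C.bot_left hV hb] at this
    exact this.trans (C.bot (b' + 1) hb).2

/-- Abscissae increase strictly along a chain, so its edges are distinct. This makes bounds in `p +
q` linear in the number of vertices. -/
theorem length_le [NeZero n] : p ≤ n ∧ q ≤ n := by
  constructor
  · have := Finset.card_le_card_of_injOn (s := Finset.range p) (t := Finset.univ) T (by simp) (by
      intro a ha b hb hab
      simp only [Finset.coe_range, mem_Iio] at ha hb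
      by_contra hne
      rcases Nat.lt_or_gt_of_ne hne with h | h
      · have := C.top_lt hV h hb.le
        rw [hab] at this; omega
      · have := C.top_lt hV h ha.le
        rw [hab] at this; omega)
    simpa [ZMod.card] using this
  · have := Finset.card_le_card_of_injOn (s := Finset.range q) (t := Finset.univ) B (by simp) (by
      intro a ha b hb hab
      simp only [Finset.coe_range, mem_Iio] at ha hb
      by_contra hne
      rcases Nat.lt_or_gt_of_ne hne with h | h
      · have := C.bot_lt hV h hb
        rw [hab] at this; omega
      · have := C.bot_lt hV h ha
        rw [hab] at this; omega)
    simpa [ZMod.card] using this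

end Chains

include hV in
-- Every second edge is horizontal. A chain that never reversed would have strictly increasing
-- abscissae, yet after `n` terms it is back at its first edge.
theorem exists_chains [NeZero n] {e : ZMod n} (he : IsLeftmostEdge V e) :
    ∃ (T B : ℕ → ZMod n) (p q : ℕ), Chains V e T B p q := by
  classical
  set T : ℕ → ZMod n := fun a => e + 1 + 2 * a with hT
  set B : ℕ → ZMod n := fun b => e - 1 - 2 * b with hB
  have hTs : ∀ a, T (a + 1) = T a + 1 + 1 := by intro a; simp only [hT]; push_cast; ring
  have hBs : ∀ b, B b = B (b + 1) + 1 + 1 := by intro b; simp only [hB]; push_cast; ring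
  have hT0 : T 0 = e + 1 := by simp [hT]
  have hB0 : e = B 0 + 1 := by simp [hB]
  have hTR : Rightward V (T 0) := by rw [hT0]; exact he.2.2
  have hBL : Leftward V (B 0) := by simpa [hB] using he.1
  have hTH : ∀ a, Horizontal V (T a) := by
    intro a
    induction a with
    | zero => exact hTR.horizontal
    | succ a ih => rw [hTs]; exact hV.horizontal_add_one (hV.vertical_add_one ih)
  have hBH : ∀ b, Horizontal V (B b) := by
    intro b
    induction b with
    | zero => exact hBL.horizontal
    | succ b ih =>
      rw [hBs] at ih
      exact hV.horizontal_of_add_one (hV.vertical_of_add_one ih)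
  have hexT : ∃ a, Leftward V (T a) := by
    by_contra! hcon
    have hR : ∀ a, Rightward V (T a) := fun a => (hTH a).resolve_left (hcon a)
    have hlt : ∀ a, (V (T a)).1 < (V (T (a + 1))).1 := by
      intro a
      rw [hTs, (hV.vertical_add_one (hTH a)).fst_eq]
      exact (hR a).2
    have := strictMono_nat_of_lt_succ hlt (NeZero.pos n)
    simp [hT] at this
  have hexB : ∃ b, Rightward V (B b) := by
    by_contra! hcon
    have hR : ∀ b, Leftward V (B b) := fun b => (hBH b).resolve_right (hcon b)
    have hlt : ∀ b, (V (B b)).1 < (V (B (b + 1))).1 := by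
      intro b
      have h1 := (hV.vertical_add_one (hBH (b + 1))).fst_eq
      rw [← hBs] at h1
      rw [h1]
      exact (hR (b + 1)).2
    have := strictMono_nat_of_lt_succ hlt (NeZero.pos n)
    simp [hB] at this
  refine ⟨T, B, Nat.find hexT, Nat.find hexB, he.2.1, hT0, hTs, hB0, hBs, ?_, ?_, ?_, ?_,
    Nat.find_spec hexT, Nat.find_spec hexB⟩
  · rw [Nat.find_pos]; exact hTR.not_leftward
  · rw [Nat.find_pos]; exact fun h => h.not_leftward hBL
  · intro a ha
    exact (hTH a).resolve_left (Nat.find_min hexT ha)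
  · intro b hb
    exact (hBH b).resolve_right (Nat.find_min hexB hb)

include hV in
/-- The boundary of a hole without left and right notches consists of a leftmost edge, an upper
chain, a rightmost edge and a lower chain. -/
theorem exists_monotone_chains [NeZero n] (hR : ∀ i, ¬ IsRightNotch V i)
    (hL : ∀ i, ¬ IsLeftNotch V i) {e : ZMod n} (he : IsLeftmostEdge V e) :
    ∃ (T B : ℕ → ZMod n) (p q : ℕ), Chains V e T B p q ∧ T p = B (q - 1) ∧
      ∀ a < p, ∀ b < q, (V (T a)).1 ≤ (V (B b)).1 → (V (B b + 1)).1 ≤ (V (T a + 1)).1 →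
        (V (B b)).2 < (V (T a)).2 := by
  classical
  -- The argument needs a leftmost edge of largest abscissa. Once its chains have closed up there is
  -- no other leftmost edge, so it is the given `e`.
  obtain ⟨e', he', hmax⟩ := Finset.exists_max_image
    (Finset.univ.filter fun i => IsLeftmostEdge V i) (fun i => (V i).1) ⟨e, by simpa using he⟩
  simp only [Finset.mem_filter, Finset.mem_univ, true_and] at he' hmax
  obtain ⟨T, B, p, q, C⟩ := exists_chains hV he'
  have hend := C.top_end_eq hV hR hL hmax
  obtain rfl := C.leftmost_unique hend he
  exact ⟨T, B, p, q, C, hend, fun a ha b hb => C.bot_lt_top hV hR hmax ha hb⟩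

end Monotone

/-! ### Regions between two step functions -/

/-- The step functions with the values `g k` and `f k` over `[k, k + 1]`, `x₀ ≤ k < x₁`, bound a
region from below and from above. -/
structure Profile (f g : ℤ → ℤ) (x₀ x₁ : ℤ) : Prop where
  lt : x₀ < x₁
  below : ∀ k, x₀ ≤ k → k < x₁ → g k < f k
  below_left : ∀ k, x₀ < k → k < x₁ → g k < f (k - 1)
  below_right : ∀ k, x₀ < k → k < x₁ → g (k - 1) < f k

/-- The region between two step functions. -/
def profileRegion (f g : ℤ → ℤ) (x₀ x₁ : ℤ) : Set (ℝ × ℝ) :=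
  {p | ∃ k, x₀ ≤ k ∧ k < x₁ ∧ (k : ℝ) ≤ p.1 ∧ p.1 ≤ k + 1 ∧ (g k : ℝ) ≤ p.2 ∧ p.2 ≤ f k}

section Region

variable {f g : ℤ → ℤ} {x₀ x₁ : ℤ}

theorem profileRegion_eq_iUnion : profileRegion f g x₀ x₁ =
    ⋃ k ∈ Ico x₀ x₁, Icc (k : ℝ) (k + 1) ×ˢ Icc (g k : ℝ) (f k) := by
  ext p
  simp only [profileRegion, mem_ofPred_eq, mem_iUnion, mem_prod, mem_Icc, mem_Ico]
  constructor
  · rintro ⟨k, h1, h2, h3, h4, h5, h6⟩; exact ⟨k, ⟨h1, h2⟩, ⟨h3, h4⟩, h5, h6⟩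
  · rintro ⟨k, ⟨h1, h2⟩, ⟨h3, h4⟩, h5, h6⟩; exact ⟨k, h1, h2, h3, h4, h5, h6⟩

theorem isCompact_profileRegion : IsCompact (profileRegion f g x₀ x₁) := by
  rw [profileRegion_eq_iUnion]
  exact (finite_Ico x₀ x₁).isCompact_biUnion fun k _ => isCompact_Icc.prod isCompact_Icc

theorem abs_sub_le_one_of_mem {k l : ℤ} {x : ℝ} (h1 : (k : ℝ) ≤ x) (h2 : x ≤ k + 1)
    (h3 : (l : ℝ) ≤ x) (h4 : x ≤ l + 1) : k = l ∨ (k = l + 1 ∧ x = k) ∨ (l = k + 1 ∧ x = l) := by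
  have h5 : k ≤ l + 1 := by have : (k : ℝ) ≤ (l + 1 : ℤ) := by push_cast; linarith
                            exact_mod_cast this
  have h6 : l ≤ k + 1 := by have : (l : ℝ) ≤ (k + 1 : ℤ) := by push_cast; linarith
                            exact_mod_cast this
  rcases (show k = l ∨ k = l + 1 ∨ l = k + 1 by omega) with h | h | h
  · exact .inl h
  · right; left; refine ⟨h, ?_⟩; subst h; push_cast at *; linarith
  · right; right; refine ⟨h, ?_⟩; subst h; push_cast at *; linarith

/-- The vertical ray from a point outside of the region upwards or downwards avoids the region. -/
theorem Profile.ray_avoids (P : Profile f g x₀ x₁) {p : ℝ × ℝ} (hp : p ∉ profileRegion f g x₀ x₁) :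
    (∀ y ≤ p.2, (p.1, y) ∉ profileRegion f g x₀ x₁) ∨
      ∀ y ≥ p.2, (p.1, y) ∉ profileRegion f g x₀ x₁ := by
  by_contra! hcon
  obtain ⟨⟨y, hy, k, k1, k2, k3, k4, k5, k6⟩, z, hz, l, l1, l2, l3, l4, l5, l6⟩ := hcon
  dsimp only at *
  -- The vertical line through `p` meets column `k` below `p` and column `l` above it, which forces
  -- `f k < g l`. But the two columns are equal or neighbours.
  have hk : (f k : ℝ) < p.2 := by
    by_contra! h
    exact hp ⟨k, k1, k2, k3, k4, k5.trans hy, h⟩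
  have hl : p.2 < g l := by
    by_contra! h
    exact hp ⟨l, l1, l2, l3, l4, h, le_trans hz l6⟩
  have hlt : f k < g l := by exact_mod_cast hk.trans hl
  rcases abs_sub_le_one_of_mem k3 k4 l3 l4 with rfl | ⟨rfl, -⟩ | ⟨rfl, -⟩
  · have := P.below k k1 k2; omega
  · have := P.below_right (l + 1) (by omega) k2
    rw [add_sub_cancel_right] at this; omega
  · have := P.below_left (k + 1) (by omega) l2
    rw [add_sub_cancel_right] at this; omega

/-- The boundary of a region between step functions is part of the set `J`. -/
structure Profile.Bounds (f g : ℤ → ℤ) (x₀ x₁ : ℤ) (J : Set (ℝ × ℝ)) : Prop where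
  top : ∀ k, x₀ ≤ k → k < x₁ → ∀ x : ℝ, k ≤ x → x ≤ k + 1 → (x, (f k : ℝ)) ∈ J
  bot : ∀ k, x₀ ≤ k → k < x₁ → ∀ x : ℝ, k ≤ x → x ≤ k + 1 → (x, (g k : ℝ)) ∈ J
  top_step : ∀ k, x₀ < k → k < x₁ → ∀ y ∈ uIcc (f (k - 1) : ℝ) (f k), ((k : ℝ), y) ∈ J
  bot_step : ∀ k, x₀ < k → k < x₁ → ∀ y ∈ uIcc (g (k - 1) : ℝ) (g k), ((k : ℝ), y) ∈ J
  left : ∀ y ∈ Icc (g x₀ : ℝ) (f x₀), ((x₀ : ℝ), y) ∈ J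
  right : ∀ y ∈ Icc (g (x₁ - 1) : ℝ) (f (x₁ - 1)), ((x₁ : ℝ), y) ∈ J

/-- Within one column an open rectangle surrounds the point. Over a breakpoint `m` (the case
`main`), the steps belong to `J`, so the point is above both floors and below both ceilings, and a
box inside the two neighbouring columns surrounds it. -/
theorem Profile.Bounds.mem_interior_of_notMem {J : Set (ℝ × ℝ)} (hJ : Profile.Bounds f g x₀ x₁ J)
    (P : Profile f g x₀ x₁) {p : ℝ × ℝ}
    (hp : p ∈ profileRegion f g x₀ x₁) (hpJ : p ∉ J) : p ∈ interior (profileRegion f g x₀ x₁) := by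
  have main : ∀ m : ℤ, p.1 = m → (x₀ < m → ((g (m - 1) : ℝ) ≤ p.2 ∧ p.2 ≤ f (m - 1)) ∨
      (m < x₁ ∧ (g m : ℝ) ≤ p.2 ∧ p.2 ≤ f m)) → (m = x₀ → (g m : ℝ) ≤ p.2 ∧ p.2 ≤ f m) →
      x₀ ≤ m → m ≤ x₁ → p ∈ interior (profileRegion f g x₀ x₁) := by
    intro m hm hmid hleft h0 h1
    obtain ⟨x, y⟩ := p
    dsimp only at *
    subst hm
    rcases h0.eq_or_lt with rfl | h0
    · exact absurd (hJ.left y (hleft rfl)) hpJ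
    rcases h1.eq_or_lt with rfl | h1
    · rcases hmid h0 with h | h
      · exact absurd (hJ.right y h) hpJ
      · exact absurd h.1 (lt_irrefl _)
    have ht : y ∉ uIcc (f (m - 1) : ℝ) (f m) := fun h => hpJ (hJ.top_step m h0 h1 y h)
    have hb : y ∉ uIcc (g (m - 1) : ℝ) (g m) := fun h => hpJ (hJ.bot_step m h0 h1 y h)
    have b1 : (g m : ℝ) < f m := by exact_mod_cast P.below m h0.le h1
    have b2 : (g (m - 1) : ℝ) < f (m - 1) := by
      exact_mod_cast P.below (m - 1) (by omega) (by omega)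
    have b3 : (g m : ℝ) < f (m - 1) := by exact_mod_cast P.below_left m h0 h1
    have b4 : (g (m - 1) : ℝ) < f m := by exact_mod_cast P.below_right m h0 h1
    have hy : ((g (m - 1) : ℝ) < y ∧ (g m : ℝ) < y) ∧ y < f (m - 1) ∧ y < f m := by
      rw [mem_uIcc] at ht hb
      push Not at ht hb
      rcases hmid h0 with ⟨h2, h3⟩ | ⟨-, h2, h3⟩
      · have e1 : (g m : ℝ) < y := by
          by_contra! h; exact (hb.1 h2).not_ge h
        have e2 : y < f m := by
          by_contra! h; exact (ht.2 h).not_ge h3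
        refine ⟨⟨?_, e1⟩, ?_, e2⟩
        · exact hb.2 e1.le
        · by_contra! h; exact (ht.1 h).not_gt e2
      · have e1 : (g (m - 1) : ℝ) < y := by
          by_contra! h; exact (hb.2 h2).not_ge h
        have e2 : y < f (m - 1) := by
          by_contra! h; exact (ht.1 h).not_ge h3
        refine ⟨⟨e1, hb.1 e1.le⟩, e2, ?_⟩
        by_contra! h; exact (ht.2 h).not_gt e2
    rw [mem_interior]
    refine ⟨Ioo ((m : ℝ) - 1) (m + 1) ×ˢ Ioo (max (g (m - 1) : ℝ) (g m)) (min (f (m - 1)) (f m)),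
      ?_, isOpen_Ioo.prod isOpen_Ioo, ⟨⟨by simp, by simp⟩, ?_⟩⟩
    · rintro ⟨x', y'⟩ ⟨⟨c1, c2⟩, c3, c4⟩
      dsimp only at *
      rw [max_lt_iff] at c3
      rw [lt_min_iff] at c4
      rcases le_total (m : ℝ) x' with c | c
      · exact ⟨m, h0.le, h1, c, c2.le, c3.2.le, c4.2.le⟩
      · exact ⟨m - 1, by omega, by omega, by push_cast; exact c1.le, by push_cast; simpa using c,
          c3.1.le, c4.1.le⟩
    · exact ⟨max_lt hy.1.1 hy.1.2, lt_min hy.2.1 hy.2.2⟩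
  obtain ⟨k, k1, k2, k3, k4, k5, k6⟩ := hp
  rcases k3.eq_or_lt with h | h3
  · exact main k h.symm (fun _ => .inr ⟨k2, k5, k6⟩) (fun _ => ⟨k5, k6⟩) k1 k2.le
  rcases k4.eq_or_lt with h | h4
  · refine main (k + 1) (by rw [h]; push_cast; rfl) (fun _ => .inl ?_) (fun _ => by omega)
      (by omega) (by omega)
    rw [add_sub_cancel_right]; exact ⟨k5, k6⟩
  have h5 : (g k : ℝ) < p.2 := k5.lt_of_ne fun h => hpJ (by
    have := hJ.bot k k1 k2 p.1 k3 k4; rwa [h] at this)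
  have h6 : p.2 < f k := k6.lt_of_ne fun h => hpJ (by
    have := hJ.top k k1 k2 p.1 k3 k4; rwa [← h] at this)
  rw [mem_interior]
  refine ⟨Ioo (k : ℝ) (k + 1) ×ˢ Ioo (g k : ℝ) (f k), ?_, isOpen_Ioo.prod isOpen_Ioo,
    ⟨⟨h3, h4⟩, h5, h6⟩⟩
  rintro q ⟨⟨c1, c2⟩, c3, c4⟩
  exact ⟨k, k1, k2, c1.le, c2.le, c3.le, c4.le⟩

theorem not_isBounded_pathComponentIn_of_ray {F : Set (ℝ × ℝ)} {p : ℝ × ℝ}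
    (h : (∀ y ≤ p.2, (p.1, y) ∈ F) ∨ ∀ y ≥ p.2, (p.1, y) ∈ F) :
    ¬ Bornology.IsBounded (pathComponentIn F p) := by
  intro hb
  rcases h with h | h
  · have hsub : ({p.1} ×ˢ Iic p.2 : Set (ℝ × ℝ)) ⊆ pathComponentIn F p := by
      refine IsPathConnected.subset_pathComponentIn ?_ ⟨rfl, self_mem_Iic⟩ ?_
      · exact ((convex_singleton _).prod (convex_Iic _)).isPathConnected ⟨p, rfl, self_mem_Iic⟩
      · rintro ⟨x, y⟩ ⟨rfl, hy⟩; exact h y hy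
    have := ((hb.subset hsub).image_snd).bddBelow
    obtain ⟨c, hc⟩ := this
    have := hc ⟨(p.1, min p.2 (c - 1)), ⟨rfl, mem_Iic.2 (min_le_left _ _)⟩, rfl⟩
    have := min_le_right p.2 (c - 1)
    dsimp only at *
    linarith
  · have hsub : ({p.1} ×ˢ Ici p.2 : Set (ℝ × ℝ)) ⊆ pathComponentIn F p := by
      refine IsPathConnected.subset_pathComponentIn ?_ ⟨rfl, self_mem_Ici⟩ ?_
      · exact ((convex_singleton _).prod (convex_Ici _)).isPathConnected ⟨p, rfl, self_mem_Ici⟩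
      · rintro ⟨x, y⟩ ⟨rfl, hy⟩; exact h y hy
    have := ((hb.subset hsub).image_snd).bddAbove
    obtain ⟨c, hc⟩ := this
    have := hc ⟨(p.1, max p.2 (c + 1)), ⟨rfl, mem_Ici.2 (le_max_left _ _)⟩, rfl⟩
    have := le_max_right p.2 (c + 1)
    dsimp only at *
    linarith

/-- The rectilinear Jordan curve theorem for the boundary of a region between step functions. -/
theorem Profile.union_innerRegion {J : Set (ℝ × ℝ)} (P : Profile f g x₀ x₁)
    (hJ : Profile.Bounds f g x₀ x₁ J) (hsub : J ⊆ profileRegion f g x₀ x₁) :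
    J ∪ innerRegion J = profileRegion f g x₀ x₁ := by
  apply Subset.antisymm
  · rintro p (hp | ⟨hpJ, hb⟩)
    · exact hsub hp
    · by_contra hp
      -- From a point outside the region a vertical ray escapes to infinity without meeting `J`.
      refine not_isBounded_pathComponentIn_of_ray ?_ hb
      rcases P.ray_avoids hp with h | h
      · exact .inl fun y hy hyJ => h y hy (hsub hyJ)
      · exact .inr fun y hy hyJ => h y hy (hsub hyJ)
  · intro p hp
    by_cases hpJ : p ∈ J
    · exact .inl hpJ
    refine .inr ⟨hpJ, ?_⟩
    have hc : IsCompact (profileRegion f g x₀ x₁) := isCompact_profileRegion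
    -- The complement of `J` is covered by two disjoint open sets, the interior and the complement
    -- of the region. A component that meets the interior therefore stays in it and is bounded.
    refine hc.isBounded.subset (Subset.trans (IsPreconnected.subset_left_of_subset_union
      isOpen_interior hc.isClosed.isOpen_compl ?_ ?_ ?_ ?_) interior_subset)
    · exact disjoint_compl_right.mono_left interior_subset
    · intro q hq
      have hqJ : q ∉ J := pathComponentIn_subset hq
      by_cases hqr : q ∈ profileRegion f g x₀ x₁
      · exact .inl (hJ.mem_interior_of_notMem P hqr hqJ)
      · exact .inr hqr
    · exact ⟨p, mem_pathComponentIn_self hpJ, hJ.mem_interior_of_notMem P hp hpJ⟩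
    · exact (isPathConnected_pathComponentIn hpJ).isConnected.isPreconnected

end Region

theorem exists_unit_interval {a b : ℤ} (hab : a < b) {x : ℝ} (h1 : (a : ℝ) ≤ x) (h2 : x ≤ b) :
    ∃ k, a ≤ k ∧ k < b ∧ (k : ℝ) ≤ x ∧ x ≤ k + 1 := by
  rcases h2.eq_or_lt with rfl | h2
  · exact ⟨b - 1, by omega, by omega, by push_cast; linarith, by push_cast; linarith⟩
  · exact ⟨⌊x⌋, Int.le_floor.2 h1, Int.floor_lt.2 h2, Int.floor_le x, (Int.lt_floor_add_one x).le⟩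

/-! ### The hole as the region between the step functions of its two chains -/

section Chains

variable {n : ℕ} {V : ZMod n → ℤ × ℤ} {e : ZMod n} {T B : ℕ → ZMod n} {p q : ℕ}

/-- The step functions `f` and `g` follow the upper and the lower chain. -/
structure Follows (V : ZMod n → ℤ × ℤ) (T B : ℕ → ZMod n) (p q : ℕ) (f g : ℤ → ℤ) : Prop where
  top : ∀ a < p, ∀ k, (V (T a)).1 ≤ k → k < (V (T a + 1)).1 → f k = (V (T a)).2
  bot : ∀ b < q, ∀ k, (V (B b + 1)).1 ≤ k → k < (V (B b)).1 → g k = (V (B b)).2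

/-- The edges of one chain lie over disjoint sets of unit intervals, so at most one edge prescribes
the value on each. The value `0` elsewhere is arbitrary. -/
theorem Chains.exists_follows (hV : IsClosedRectilinearArc V) (C : Chains V e T B p q) :
    ∃ f g, Follows V T B p q f g := by
  have h1 : ∀ k : ℤ, ∃ y, ∀ a < p, (V (T a)).1 ≤ k → k < (V (T a + 1)).1 → y = (V (T a)).2 := by
    intro k
    by_cases h : ∃ a < p, (V (T a)).1 ≤ k ∧ k < (V (T a + 1)).1
    · obtain ⟨a, ha, h1, h2⟩ := h
      refine ⟨(V (T a)).2, fun a' ha' h3 h4 => ?_⟩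
      obtain rfl : a = a' := by
        by_contra hne
        rw [C.top_right hV ha] at h2
        rw [C.top_right hV ha'] at h4
        rcases Nat.lt_or_gt_of_ne hne with hlt | hlt
        · rcases (show a + 1 ≤ a' from hlt).eq_or_lt with rfl | hlt
          · omega
          · have := C.top_lt hV hlt ha'.le; omega
        · rcases (show a' + 1 ≤ a from hlt).eq_or_lt with rfl | hlt
          · omega
          · have := C.top_lt hV hlt ha.le; omega
      rfl
    · exact ⟨0, fun a ha h1 h2 => absurd ⟨a, ha, h1, h2⟩ h⟩
  have h2 : ∀ k : ℤ, ∃ y, ∀ b < q, (V (B b + 1)).1 ≤ k → k < (V (B b)).1 → y = (V (B b)).2 := by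
    intro k
    by_cases h : ∃ b < q, (V (B b + 1)).1 ≤ k ∧ k < (V (B b)).1
    · obtain ⟨b, hb, h1, h2⟩ := h
      refine ⟨(V (B b)).2, fun b' hb' h3 h4 => ?_⟩
      obtain rfl : b = b' := by
        by_contra hne
        rcases Nat.lt_or_gt_of_ne hne with hlt | hlt
        · obtain ⟨c, rfl⟩ := Nat.exists_eq_add_of_lt hlt
          rw [C.bot_left hV hb'] at h3
          rcases Nat.eq_zero_or_pos c with rfl | hc
          · simp only [add_zero] at h3; omega
          · have := C.bot_lt hV (b := b) (b' := b + c) (by omega) (by omega); omega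
        · obtain ⟨c, rfl⟩ := Nat.exists_eq_add_of_lt hlt
          rw [C.bot_left hV hb] at h1
          rcases Nat.eq_zero_or_pos c with rfl | hc
          · simp only [add_zero] at h1; omega
          · have := C.bot_lt hV (b := b') (b' := b' + c) (by omega) (by omega); omega
      rfl
    · exact ⟨0, fun b hb h1 h2 => absurd ⟨b, hb, h1, h2⟩ h⟩
  choose f hf using h1
  choose g hg using h2
  exact ⟨f, g, fun a ha k => hf k a ha, fun b hb k => hg k b hb⟩

variable {f g : ℤ → ℤ}

/-- The inequalities across a breakpoint use `hsep` for edges whose ranges may share only one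
abscissa, whence its non-strict hypotheses. -/
theorem Chains.profile (hV : IsClosedRectilinearArc V) (C : Chains V e T B p q)
    (hend : T p = B (q - 1))
    (hsep : ∀ a < p, ∀ b < q, (V (T a)).1 ≤ (V (B b)).1 → (V (B b + 1)).1 ≤ (V (T a + 1)).1 →
        (V (B b)).2 < (V (T a)).2) (F : Follows V T B p q f g) :
    Profile f g (V e).1 (V (T p)).1 := by
  have hge := C.top_ge hV (a := p) le_rfl
  have hp := C.top_pos
  refine ⟨by omega, fun k h1 h2 => ?_, fun k h1 h2 => ?_, fun k h1 h2 => ?_⟩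
  · obtain ⟨a, ha, a1, a2⟩ := C.exists_top hV h1 h2
    obtain ⟨b, hb, b1, b2⟩ := C.exists_bot hV h1 (by rwa [← hend])
    rw [F.top a ha k a1 a2, F.bot b hb k b1 b2]
    exact hsep a ha b hb (by omega) (by omega)
  · obtain ⟨a, ha, a1, a2⟩ := C.exists_top hV (k := k - 1) (by omega) (by omega)
    obtain ⟨b, hb, b1, b2⟩ := C.exists_bot hV h1.le (by rwa [← hend])
    rw [F.top a ha _ a1 a2, F.bot b hb k b1 b2]
    exact hsep a ha b hb (by omega) (by omega)
  · obtain ⟨a, ha, a1, a2⟩ := C.exists_top hV h1.le h2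
    obtain ⟨b, hb, b1, b2⟩ := C.exists_bot hV (k := k - 1) (by omega) (by rw [← hend]; omega)
    rw [F.top a ha _ a1 a2, F.bot b hb _ b1 b2]
    exact hsep a ha b hb (by omega) (by omega)

theorem Chains.mem_top (C : Chains V e T B p q) {a : ℕ} (ha : a < p) {x : ℝ}
    (h1 : ((V (T a)).1 : ℝ) ≤ x) (h2 : x ≤ (V (T a + 1)).1) :
    (x, ((V (T a)).2 : ℝ)) ∈ curve V := by
  refine mem_iUnion.2 ⟨T a, ?_⟩
  rw [edgeSeg_of_horizontal (C.top a ha).1]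
  exact ⟨mem_uIcc.2 (.inl ⟨h1, h2⟩), rfl⟩

theorem Chains.mem_bot (C : Chains V e T B p q) {b : ℕ} (hb : b < q) {x : ℝ}
    (h1 : ((V (B b + 1)).1 : ℝ) ≤ x) (h2 : x ≤ (V (B b)).1) :
    (x, ((V (B b)).2 : ℝ)) ∈ curve V := by
  refine mem_iUnion.2 ⟨B b, ?_⟩
  rw [edgeSeg_of_horizontal (C.bot b hb).1]
  exact ⟨mem_uIcc.2 (.inr ⟨h1, h2⟩), rfl⟩

theorem Chains.bounds (hV : IsClosedRectilinearArc V) (C : Chains V e T B p q)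
    (hend : T p = B (q - 1)) (F : Follows V T B p q f g) :
    Profile.Bounds f g (V e).1 (V (T p)).1 (curve V) := by
  have hp := C.top_pos
  have hq := C.bot_pos
  have cast_le : ∀ {a b : ℤ}, a ≤ b → (a : ℝ) ≤ b := fun h => by exact_mod_cast h
  have cast_lt : ∀ {a b : ℤ}, a < b → (a : ℝ) + 1 ≤ b := fun h => by exact_mod_cast h
  constructor
  · intro k h1 h2 x h3 h4
    obtain ⟨a, ha, a1, a2⟩ := C.exists_top hV h1 h2
    rw [F.top a ha k a1 a2]
    exact C.mem_top ha ((cast_le a1).trans h3) (h4.trans (cast_lt a2))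
  · intro k h1 h2 x h3 h4
    obtain ⟨b, hb, b1, b2⟩ := C.exists_bot hV h1 (by rwa [← hend])
    rw [F.bot b hb k b1 b2]
    exact C.mem_bot hb ((cast_le b1).trans h3) (h4.trans (cast_lt b2))
  · intro k h1 h2 y hy
    obtain ⟨a, ha, a1, a2⟩ := C.exists_top hV h1.le h2
    rw [F.top a ha k a1 a2] at hy
    rcases a1.eq_or_lt with a1 | a1
    · obtain ⟨a, rfl⟩ : ∃ a', a = a' + 1 := Nat.exists_eq_succ_of_ne_zero (by
        rintro rfl
        rw [C.top_zero, C.leftmost.1] at a1; omega)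
      have ha' := C.top a (by omega)
      have r := C.top_right hV (a := a) (by omega)
      have := ha'.2
      rw [F.top a (by omega) (k - 1) (by omega) (by omega)] at hy
      refine mem_iUnion.2 ⟨T a + 1, ?_⟩
      rw [edgeSeg_of_vertical (hV.vertical_add_one ha'.horizontal).fst_eq, ← C.top_succ, ha'.1, r,
        a1]
      exact ⟨rfl, hy⟩
    · rw [F.top a ha (k - 1) (by omega) (by omega), uIcc_self] at hy
      rw [mem_singleton_iff.1 hy]
      exact C.mem_top ha (cast_le a1.le) (cast_le a2.le)
  · intro k h1 h2 y hy
    obtain ⟨b, hb, b1, b2⟩ := C.exists_bot hV h1.le (by rwa [← hend])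
    rw [F.bot b hb k b1 b2] at hy
    rcases b1.eq_or_lt with b1 | b1
    · obtain ⟨b, rfl⟩ : ∃ b', b = b' + 1 := Nat.exists_eq_succ_of_ne_zero (by
        rintro rfl
        rw [← C.bot_zero] at b1; omega)
      have hb' := C.bot (b + 1) hb
      have r := C.bot_left hV hb
      have := (C.bot b (by omega)).2
      rw [F.bot b (by omega) (k - 1) (by omega) (by omega)] at hy
      refine mem_iUnion.2 ⟨B (b + 1) + 1, ?_⟩
      rw [edgeSeg_of_vertical (hV.vertical_add_one hb'.horizontal).fst_eq, ← C.bot_succ, hb'.1, b1,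
        uIcc_comm]
      exact ⟨rfl, hy⟩
    · rw [F.bot b hb (k - 1) (by omega) (by omega), uIcc_self] at hy
      rw [mem_singleton_iff.1 hy]
      exact C.mem_bot hb (cast_le b1.le) (cast_le b2.le)
  · intro y hy
    have h0 := C.top 0 hp
    have g0 := C.bot 0 hq
    rw [F.top 0 hp _ (by rw [C.top_zero, C.leftmost.1]) (by
        have := h0.2; rw [C.top_zero, C.leftmost.1] at this; rwa [C.top_zero]),
      F.bot 0 hq _ (by rw [← C.bot_zero]) (by have := g0.2; rwa [← C.bot_zero] at this),
      ← g0.1, ← C.bot_zero, C.top_zero] at hy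
    refine mem_iUnion.2 ⟨e, ?_⟩
    rw [edgeSeg_of_vertical C.leftmost.1]
    exact ⟨rfl, Icc_subset_uIcc hy⟩
  · intro y hy
    obtain ⟨a, rfl⟩ := Nat.exists_eq_succ_of_ne_zero hp.ne'
    have ha := C.top a (by omega)
    have r := C.top_right hV (a := a) (by omega)
    have := ha.2
    have g0 := (C.bot (q - 1) (by omega)).2
    simp only [Nat.succ_eq_add_one] at *
    have hy' : (V (B (q - 1) + 1)).1 ≤ (V (T (a + 1))).1 - 1 := by rw [hend]; omega
    rw [F.top a (by omega) _ (by omega) (by omega),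
      F.bot (q - 1) (by omega) _ hy' (by rw [← hend]; omega), ← hend] at hy
    refine mem_iUnion.2 ⟨T a + 1, ?_⟩
    rw [edgeSeg_of_vertical (hV.vertical_add_one ha.horizontal).fst_eq, ← C.top_succ, ha.1, r]
    exact ⟨rfl, uIcc_comm (α := ℝ) _ _ ▸ Icc_subset_uIcc hy⟩

theorem Chains.curve_subset [NeZero n] (hV : IsClosedRectilinearArc V) (C : Chains V e T B p q)
    (hend : T p = B (q - 1)) (F : Follows V T B p q f g) (P : Profile f g (V e).1 (V (T p)).1) :
    curve V ⊆ profileRegion f g (V e).1 (V (T p)).1 := by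
  have hp := C.top_pos
  have hq := C.bot_pos
  have hlt := P.lt
  have h0 := C.top 0 hp
  have g0 := C.bot 0 hq
  have htop : ∀ a < p, (V e).1 ≤ (V (T a)).1 ∧ (V (T a + 1)).1 ≤ (V (T p)).1 := by
    intro a ha
    have := C.top_ge hV ha.le
    refine ⟨by omega, ?_⟩
    rw [C.top_right hV ha]
    rcases (show a + 1 ≤ p from ha).eq_or_lt with h | h
    · rw [h]
    · exact (C.top_lt hV h le_rfl).le
  have hbot : ∀ b < q, (V e).1 ≤ (V (B b + 1)).1 ∧ (V (B b)).1 ≤ (V (T p)).1 := by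
    intro b hb
    have := C.bot_ge hV hb
    refine ⟨by omega, ?_⟩
    rw [hend]
    rcases (show b ≤ q - 1 by omega).eq_or_lt with h | h
    · rw [h]
    · exact (C.bot_lt hV h (by omega)).le
  have hbelow : ∀ k, (V e).1 ≤ k → k < (V (T p)).1 → (g k : ℝ) ≤ f k := fun k h1 h2 => by
    exact_mod_cast (P.below k h1 h2).le
  have hfl : f (V e).1 = (V (e + 1)).2 := by
    rw [F.top 0 hp _ (by rw [C.top_zero, C.leftmost.1]) (by
      have := h0.2; rw [C.top_zero, C.leftmost.1] at this; rwa [C.top_zero]), C.top_zero]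
  have hgl : g (V e).1 = (V e).2 := by
    rw [F.bot 0 hq _ (by rw [← C.bot_zero]) (by have := g0.2; rwa [← C.bot_zero] at this),
      ← g0.1, ← C.bot_zero]
  intro z hz
  obtain ⟨i, hi⟩ := mem_iUnion.1 hz
  have hE : z ∈ edgeSeg V e → z ∈ profileRegion f g (V e).1 (V (T p)).1 := by
    intro hz
    rw [edgeSeg_of_vertical C.leftmost.1] at hz
    obtain ⟨z1, z2⟩ := hz
    rw [uIcc_of_le (by exact_mod_cast C.leftmost.2.le)] at z2
    refine ⟨(V e).1, le_rfl, hlt, z1.ge, by rw [z1]; simp, ?_, ?_⟩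
    · rw [hgl]; exact z2.1
    · rw [hfl]; exact z2.2
  rcases C.edge_cases hend i with rfl | ⟨a, ha, rfl | rfl⟩ | ⟨b, hb, rfl | rfl⟩
  · exact hE hi
  · have hT := C.top a ha
    rw [edgeSeg_of_horizontal hT.1, uIcc_of_le (by exact_mod_cast hT.2.le)] at hi
    obtain ⟨k, k1, k2, k3, k4⟩ := exists_unit_interval hT.2 hi.1.1 hi.1.2
    have h1 := htop a ha
    refine ⟨k, by omega, by omega, k3, k4, ?_, ?_⟩
    · rw [hi.2, ← F.top a ha k k1 k2]; exact hbelow k (by omega) (by omega)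
    · rw [hi.2, ← F.top a ha k k1 k2]
  · have hT := C.top a ha
    have r := C.top_right hV ha
    have h1 := htop a ha
    have hlt := hT.2
    rw [edgeSeg_of_vertical (hV.vertical_add_one hT.horizontal).fst_eq, ← C.top_succ, hT.1, r] at hi
    obtain ⟨z1, z2⟩ := hi
    have f1 := F.top a ha ((V (T (a + 1))).1 - 1) (by omega) (by omega)
    by_cases hap : a + 1 < p
    · have f2 := F.top (a + 1) hap (V (T (a + 1))).1 le_rfl (C.top _ hap).2
      have h2 := htop _ hap
      have := (C.top _ hap).2
      have b1 : (g (V (T (a + 1))).1 : ℝ) ≤ f ((V (T (a + 1))).1 - 1) := by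
        exact_mod_cast (P.below_left _ (by omega) (by omega)).le
      have b2 : (g ((V (T (a + 1))).1 - 1) : ℝ) ≤ f (V (T (a + 1))).1 := by
        exact_mod_cast (P.below_right _ (by omega) (by omega)).le
      rw [← f1, ← f2] at z2
      -- The vertical edge lies in the neighbouring column with the higher ceiling; by `b1` or `b2`
      -- the floor of that column is not above the lower end of the edge.
      rcases mem_uIcc.1 z2 with z2 | z2
      · exact ⟨_, by omega, by omega, z1.ge, by rw [z1]; simp, b1.trans z2.1, z2.2⟩
      · exact ⟨(V (T (a + 1))).1 - 1, by omega, by omega, by rw [z1]; push_cast; simp,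
          by rw [z1]; push_cast; simp, b2.trans z2.1, z2.2⟩
    · obtain rfl : a + 1 = p := by omega
      have g1 := (C.bot (q - 1) (by omega)).2
      have f2 := F.bot (q - 1) (by omega) ((V (T (a + 1))).1 - 1) (by rw [hend]; omega)
        (by rw [hend]; omega)
      rw [← f1, hend, ← f2, hend, uIcc_comm, ← hend, uIcc_of_le (hbelow _ (by omega) (by omega))]
        at z2
      exact ⟨(V (T (a + 1))).1 - 1, by omega, by omega, by rw [z1]; push_cast; simp,
          by rw [z1]; push_cast; simp, z2.1, z2.2⟩
  · have hB := C.bot b hb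
    rw [edgeSeg_of_horizontal hB.1, uIcc_comm, uIcc_of_le (by exact_mod_cast hB.2.le)] at hi
    obtain ⟨k, k1, k2, k3, k4⟩ := exists_unit_interval hB.2 hi.1.1 hi.1.2
    have h1 := hbot b hb
    refine ⟨k, by omega, by omega, k3, k4, ?_, ?_⟩
    · rw [hi.2, ← F.bot b hb k k1 k2]
    · rw [hi.2, ← F.bot b hb k k1 k2]; exact hbelow k (by omega) (by omega)
  · rcases b with _ | b
    · rw [← C.bot_zero] at hi
      exact hE hi
    have hB := C.bot (b + 1) hb
    have hB' := C.bot b (by omega)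
    have r := C.bot_left hV hb
    have h1 := hbot _ hb
    have h2 := hbot b (by omega)
    have hlt := hB.2
    have hlt' := hB'.2
    rw [edgeSeg_of_vertical (hV.vertical_add_one hB.horizontal).fst_eq, ← C.bot_succ, hB.1, r] at hi
    obtain ⟨z1, z2⟩ := hi
    have f1 := F.bot b (by omega) ((V (B b)).1 - 1) (by omega) (by omega)
    have f2 := F.bot (b + 1) hb (V (B b)).1 (by omega) (by omega)
    have b1 : (g (V (B b)).1 : ℝ) ≤ f ((V (B b)).1 - 1) := by
      exact_mod_cast (P.below_left _ (by omega) (by omega)).le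
    have b2 : (g ((V (B b)).1 - 1) : ℝ) ≤ f (V (B b)).1 := by
      exact_mod_cast (P.below_right _ (by omega) (by omega)).le
    rw [← f1, ← f2] at z2
    rcases mem_uIcc.1 z2 with z2 | z2
    · exact ⟨(V (B b)).1, by omega, by omega, z1.ge, by rw [z1]; simp, z2.1, z2.2.trans b2⟩
    · exact ⟨(V (B b)).1 - 1, by omega, by omega, by rw [z1]; push_cast; simp,
        by rw [z1]; push_cast; simp, z2.1, z2.2.trans b1⟩

end Chains

/-! ### Feasible locations in a hole -/

section Packing

theorem Rectangle.closure_openAt {r : Rectangle} (hw : 0 < r.width) (hh : 0 < r.height)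
    (p : ℝ × ℝ) : closure (r.openAt p) = r.closedAt p := by
  rw [Rectangle.openAt, Rectangle.closedAt, closure_prod_eq, closure_Ioo (by linarith),
    closure_Ioo (by linarith)]

theorem Rectangle.isOpen_openAt (r : Rectangle) (p : ℝ × ℝ) : IsOpen (r.openAt p) :=
  isOpen_Ioo.prod isOpen_Ioo

theorem Rectangle.openAt_subset_closedAt (r : Rectangle) (p : ℝ × ℝ) :
    r.openAt p ⊆ r.closedAt p :=
  prod_mono Ioo_subset_Icc_self Ioo_subset_Icc_self

variable {I : Instance} {sp : PartialPacking I} {S : Set (ℝ × ℝ)} {r : Rectangle}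

theorem IsHoleOfPacking.subset (hS : IsHoleOfPacking I sp S) :
    S ⊆ Icc 0 I.W ×ˢ Icc 0 (∑ i, (I.rect i).height) := by
  obtain ⟨z, hz, rfl⟩ := hS
  exact closure_minimal (pathComponentIn_subset.trans sdiff_subset) (isClosed_Icc.prod isClosed_Icc)

/-- An open placed rectangle that met `S`, the closure of a component, would meet the component
itself, which avoids all placed rectangles. -/
theorem IsHoleOfPacking.feasibleLocation (hS : IsHoleOfPacking I sp S) {p : ℝ × ℝ}
    (hp : r.closedAt p ⊆ S) : FeasibleLocation I sp r p := by
  have hw := r.width_nonneg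
  have hh := r.height_nonneg
  constructor
  · have h1 := hS.subset (hp (show p ∈ r.closedAt p from ⟨⟨le_rfl, by linarith⟩, le_rfl, by linarith⟩))
    have h2 := hS.subset (hp (show (p.1 + r.width, p.2) ∈ r.closedAt p from
      ⟨⟨by simpa, le_rfl⟩, le_rfl, by simpa⟩))
    exact ⟨h1.1.1, h2.1.2, h1.2.1⟩
  · intro i q hq
    rw [Set.disjoint_left]
    intro z hz hz'
    obtain ⟨z₀, hz₀, rfl⟩ := hS
    obtain ⟨y, hy, hyC⟩ := mem_closure_iff.1 (hp (r.openAt_subset_closedAt p hz')) _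
      ((I.rect i).isOpen_openAt q) hz
    exact (pathComponentIn_subset hyC).2 ⟨i, q, hq, (I.rect i).openAt_subset_closedAt q hy⟩

/-- A feasible shift of a location in the hole, which is not too far, stays in the hole. -/
theorem IsHoleOfPacking.closedAt_subset (hS : IsHoleOfPacking I sp S)
    (hpos : ∀ i, sp i ≠ none → 0 < (I.rect i).width ∧ 0 < (I.rect i).height)
    (hw : 0 < r.width) (hh : 0 < r.height) {p q : ℝ × ℝ} (hp : r.closedAt p ⊆ S)
    (hq : FeasibleLocation I sp r q) (hle : q.2 ≤ p.2) (hne : (r.openAt p ∩ r.openAt q).Nonempty) :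
    r.closedAt q ⊆ S := by
  have hfree : r.openAt q ⊆ freeRegion I sp := by
    rintro ⟨x, y⟩ hz
    have hz' := hz
    obtain ⟨⟨h1, h2⟩, h3, h4⟩ := hz
    obtain ⟨⟨g1, g2, g3⟩, hdisj⟩ := hq
    -- The free region is cut off at the height `∑ h`. Since `q` is not higher than `p`, the copy at
    -- `q` stays below the cut because the copy at `p` does.
    have htop := hS.subset (hp (show (p.1, p.2 + r.height) ∈ r.closedAt p from
      ⟨⟨le_rfl, by simpa using hw.le⟩, by simpa using hh.le, le_rfl⟩))
    have htop := htop.2.2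
    dsimp only at *
    refine ⟨⟨⟨by linarith, by linarith⟩, by linarith, by dsimp only; linarith⟩, ?_⟩
    rintro ⟨i, q', hq', hmem⟩
    obtain ⟨p1, p2⟩ := hpos i (by rw [hq']; simp)
    -- Positive dimensions make a closed placed rectangle the closure of its open region, so an open
    -- copy disjoint from the latter also avoids the former.
    rw [← Rectangle.closure_openAt p1 p2] at hmem
    obtain ⟨u, hu, hu'⟩ := mem_closure_iff.1 hmem _ (r.isOpen_openAt q) hz'
    exact Set.disjoint_left.1 (hdisj i q' hq') hu' hu
  obtain ⟨z₀, hz₀, rfl⟩ := hS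
  obtain ⟨u, hu, hu'⟩ := hne
  -- The open copy at `q` is path connected, free, and contains a point of the component; hence it
  -- lies in the component.
  obtain ⟨v, hv, hvC⟩ := mem_closure_iff.1 (hp (r.openAt_subset_closedAt p hu)) _
    (r.isOpen_openAt q) hu'
  rw [← Rectangle.closure_openAt hw hh]
  apply closure_mono
  rw [← pathComponentIn_congr hvC]
  exact IsPathConnected.subset_pathComponentIn
    (((convex_Ioo _ _).prod (convex_Ioo _ _)).isPathConnected ⟨v, hv⟩) hv hfree

/-- In a hole, the stable locations depend only on the hole. -/
theorem IsHoleOfPacking.stable_iff (hS : IsHoleOfPacking I sp S)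
    (hpos : ∀ i, sp i ≠ none → 0 < (I.rect i).width ∧ 0 < (I.rect i).height)
    (hw : 0 < r.width) (hh : 0 < r.height) (p : ℝ × ℝ) :
    (FeasibleLocation I sp r p ∧ BLStableLocation I sp r p ∧ r.closedAt p ⊆ S) ↔
      r.closedAt p ⊆ S ∧ (∃ ε > 0, ∀ x ∈ Ioo (p.1 - ε) p.1, ¬ r.closedAt (x, p.2) ⊆ S) ∧
        ∃ ε > 0, ∀ y ∈ Ioo (p.2 - ε) p.2, ¬ r.closedAt (p.1, y) ⊆ S := by
  constructor
  · rintro ⟨-, ⟨⟨ε, hε, h1⟩, δ, hδ, h2⟩, hp⟩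
    exact ⟨hp, ⟨ε, hε, fun x hx h => h1 x hx (hS.feasibleLocation h)⟩, δ, hδ,
      fun y hy h => h2 y hy (hS.feasibleLocation h)⟩
  · rintro ⟨hp, ⟨ε, hε, h1⟩, δ, hδ, h2⟩
    -- Shifts shorter than the width or the height keep the open copies overlapping, which ties a
    -- feasible shifted copy to the same hole.
    refine ⟨hS.feasibleLocation hp, ⟨⟨min ε r.width, lt_min hε hw, fun x hx h => ?_⟩,
      min δ r.height, lt_min hδ hh, fun y hy h => ?_⟩, hp⟩
    · have e1 := min_le_left ε r.width
      have e2 := min_le_right ε r.width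
      obtain ⟨hx1, hx2⟩ := hx
      refine h1 x ⟨by linarith, hx2⟩ (hS.closedAt_subset hpos hw hh hp h le_rfl ?_)
      exact ⟨((p.1 + (x + r.width)) / 2, p.2 + r.height / 2),
        ⟨⟨by dsimp only; linarith, by dsimp only; linarith⟩, by dsimp only; linarith,
          by dsimp only; linarith⟩,
        ⟨by dsimp only; linarith, by dsimp only; linarith⟩, by dsimp only; linarith,
          by dsimp only; linarith⟩
    · have e1 := min_le_left δ r.height
      have e2 := min_le_right δ r.height
      obtain ⟨hy1, hy2⟩ := hy
      refine h2 y ⟨by linarith, hy2⟩ (hS.closedAt_subset hpos hw hh hp h hy2.le ?_)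
      exact ⟨(p.1 + r.width / 2, (p.2 + (y + r.height)) / 2),
        ⟨⟨by dsimp only; linarith, by dsimp only; linarith⟩, by dsimp only; linarith,
          by dsimp only; linarith⟩,
        ⟨by dsimp only; linarith, by dsimp only; linarith⟩, by dsimp only; linarith,
          by dsimp only; linarith⟩

end Packing

/-! ### Stable locations in the region between two step functions -/

section Stable

variable {f g : ℤ → ℤ} {x₀ x₁ : ℤ} {r : Rectangle}

/-- Only columns that the open horizontal range of the rectangle meets impose a condition, so a side
may touch an obstructing column. -/
theorem closedAt_subset_profileRegion_iff (hw : 0 < r.width) (p : ℝ × ℝ) :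
    r.closedAt p ⊆ profileRegion f g x₀ x₁ ↔ x₀ ≤ p.1 ∧ p.1 + r.width ≤ x₁ ∧
      ∀ k, x₀ ≤ k → k < x₁ → k < p.1 + r.width → p.1 < k + 1 →
        g k ≤ p.2 ∧ p.2 + r.height ≤ f k := by
  have hh := r.height_nonneg
  constructor
  · intro h
    refine ⟨?_, ?_, ?_⟩
    · obtain ⟨k, k1, k2, k3, -⟩ := h (show p ∈ r.closedAt p from
        ⟨⟨le_rfl, by linarith⟩, le_rfl, by linarith⟩)
      have : (x₀ : ℝ) ≤ k := by exact_mod_cast k1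
      linarith
    · obtain ⟨k, k1, k2, k3, k4, -⟩ := h (show (p.1 + r.width, p.2) ∈ r.closedAt p from
        ⟨⟨by simpa using hw.le, le_rfl⟩, le_rfl, by simpa⟩)
      have : (k : ℝ) + 1 ≤ x₁ := by exact_mod_cast k2
      dsimp only at *
      linarith
    · intro k k1 k2 k3 k4
      obtain ⟨x, hx, hx'⟩ := exists_between
        (show max (k : ℝ) p.1 < min ((k : ℝ) + 1) (p.1 + r.width) by simp [*])
      rw [max_lt_iff] at hx
      rw [lt_min_iff] at hx'
      have key : ∀ y, (x, y) ∈ r.closedAt p → (g k : ℝ) ≤ y ∧ y ≤ f k := by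
        intro y hy
        obtain ⟨l, l1, l2, l3, l4, l5, l6⟩ := h hy
        dsimp only at *
        have h1 : (l : ℝ) < k + 1 := by linarith
        have h2 : (k : ℝ) < l + 1 := by linarith
        have h1 : l < k + 1 := by exact_mod_cast h1
        have h2 : k < l + 1 := by exact_mod_cast h2
        obtain rfl : l = k := by omega
        exact ⟨l5, l6⟩
      exact ⟨(key p.2 ⟨⟨hx.2.le, hx'.2.le⟩, le_rfl, by simpa⟩).1,
        (key (p.2 + r.height) ⟨⟨hx.2.le, hx'.2.le⟩, by simpa, le_rfl⟩).2⟩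
  · rintro ⟨h1, h2, h3⟩ ⟨x, y⟩ ⟨⟨a1, a2⟩, b1, b2⟩
    dsimp only at *
    -- The column of the point is found by `⌊x⌋`, except on the right side of the rectangle, where
    -- the column to the left of the point is the one that the open range meets.
    obtain ⟨k, k1, k2, k3, k4, k5, k6⟩ : ∃ k, x₀ ≤ k ∧ k < x₁ ∧ (k : ℝ) < p.1 + r.width ∧
        p.1 < k + 1 ∧ (k : ℝ) ≤ x ∧ x ≤ k + 1 := by
      rcases a2.lt_or_eq with a2 | a2
      · have := Int.floor_le x
        have := Int.lt_floor_add_one x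
        refine ⟨⌊x⌋, Int.le_floor.2 (by linarith), Int.floor_lt.2 (by linarith), ?_, ?_, ?_, ?_⟩ <;>
          linarith
      · have := Int.le_ceil x
        have := Int.ceil_lt_add_one x
        have e1 : x₀ < ⌈x⌉ := Int.lt_ceil.2 (by linarith)
        have e2 : ⌈x⌉ ≤ x₁ := Int.ceil_le.2 (by linarith)
        refine ⟨⌈x⌉ - 1, by omega, by omega, ?_, ?_, ?_, ?_⟩ <;> push_cast <;> linarith
    obtain ⟨c1, c2⟩ := h3 k k1 k2 k3 k4
    exact ⟨k, k1, k2, k5, k6, by dsimp only; linarith, by dsimp only; linarith⟩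

/-- The integral description of the stable locations of a rectangle of width `w` and height `h`
in the region between two step functions. -/
structure StableIn (f g : ℤ → ℤ) (x₀ x₁ w h x y : ℤ) : Prop where
  left_le : x₀ ≤ x
  le_right : x + w ≤ x₁
  isGreatest : IsGreatest (g '' Ico x (x + w)) y
  le_top : ∀ k ∈ Ico x (x + w), y + h ≤ f k
  blocked : x = x₀ ∨ y < g (x - 1) ∨ f (x - 1) < y + h

theorem stable_profileRegion {w h : ℤ} (hrw : r.width = w) (hrh : r.height = h) (hw : 0 < w) :
    {p | r.closedAt p ⊆ profileRegion f g x₀ x₁ ∧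
      (∃ ε > 0, ∀ x ∈ Ioo (p.1 - ε) p.1, ¬ r.closedAt (x, p.2) ⊆ profileRegion f g x₀ x₁) ∧
      ∃ ε > 0, ∀ y ∈ Ioo (p.2 - ε) p.2, ¬ r.closedAt (p.1, y) ⊆ profileRegion f g x₀ x₁} =
    toPlane '' {q | StableIn f g x₀ x₁ w h q.1 q.2} := by
  have hw' : (0 : ℝ) < w := by exact_mod_cast hw
  have hfit := fun p : ℝ × ℝ =>
    closedAt_subset_profileRegion_iff (f := f) (g := g) (x₀ := x₀) (x₁ := x₁) (r := r)
      (by rwa [hrw]) p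
  simp only [hfit, hrw, hrh]
  ext p
  simp only [mem_ofPred_eq, mem_image]
  constructor
  · rintro ⟨⟨h1, h2, h3⟩, ⟨ε, hε, hl⟩, δ, hδ, hd⟩
    -- The rectangle rests on some floor. Otherwise every relevant floor, being an integer below
    -- `p.2`, is at most `⌈p.2⌉ - 1`, and the rectangle could sink a little.
    obtain ⟨k₀, k1, k2, k3, k4, k5⟩ : ∃ k, x₀ ≤ k ∧ k < x₁ ∧ (k : ℝ) < p.1 + w ∧ p.1 < k + 1 ∧
        (g k : ℝ) = p.2 := by
      by_contra! hcon
      have hc := Int.ceil_lt_add_one p.2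
      obtain ⟨y, hy, hy'⟩ := exists_between
        (show max (p.2 - δ) (⌈p.2⌉ - 1) < p.2 by simp [hδ]; linarith)
      rw [max_lt_iff] at hy
      refine hd y ⟨hy.1, hy'⟩ ⟨h1, h2, fun k k1 k2 k3 k4 => ?_⟩
      obtain ⟨c1, c2⟩ := h3 k k1 k2 k3 k4
      have c3 : (g k : ℝ) < p.2 := c1.lt_of_ne (hcon k k1 k2 k3 k4)
      have c4 : g k < ⌈p.2⌉ := Int.lt_ceil.2 c3
      have c5 : (g k : ℝ) + 1 ≤ ⌈p.2⌉ := by exact_mod_cast c4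
      exact ⟨by linarith, by linarith⟩
    have hc := Int.ceil_lt_add_one p.1
    have hc' := Int.le_ceil p.1
    obtain ⟨m, hm⟩ : ∃ m, ⌈p.1⌉ = m + 1 := ⟨⌈p.1⌉ - 1, by omega⟩
    rw [hm] at hc hc'
    push_cast at hc hc'
    -- A shift to the left that stays to the right of `m` enters a new column only if `p.1 = m + 1`,
    -- and then only column `m`. So stability forces `p.1` to be an integer and column `m` to
    -- obstruct.
    have hblock : p.1 = m + 1 ∧ (m < x₀ ∨ p.2 < g m ∨ f m < p.2 + h) := by
      by_contra hcon
      obtain ⟨x, hx, hx'⟩ := exists_between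
        (show max (p.1 - ε) m < p.1 by simp [hε]; linarith)
      rw [max_lt_iff] at hx
      have h0m : x₀ ≤ m := by
        by_contra hlt
        apply hcon
        have : (m : ℝ) + 1 ≤ x₀ := by exact_mod_cast (by omega : m + 1 ≤ x₀)
        exact ⟨by linarith, .inl (by omega)⟩
      have h0m' : (x₀ : ℝ) ≤ m := by exact_mod_cast h0m
      refine hl x ⟨hx.1, hx'⟩ ⟨by linarith, by linarith, fun k k1 k2 k3 k4 => ?_⟩
      have hmk : m ≤ k := by
        have : (m : ℝ) < k + 1 := by linarith
        have : m < k + 1 := by exact_mod_cast this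
        omega
      by_cases hpk : p.1 < k + 1
      · exact h3 k k1 k2 (by linarith) hpk
      · have hkm : k = m := by
          by_contra hne
          have : (m : ℝ) + 1 ≤ k := by exact_mod_cast (by omega : m + 1 ≤ k)
          linarith
        subst hkm
        by_contra hno
        apply hcon
        refine ⟨by linarith, ?_⟩
        by_contra! hno'
        exact hno ⟨hno'.2.1, hno'.2.2⟩
    obtain ⟨hp1, hblock⟩ := hblock
    have hIco : ∀ k : ℤ, k ∈ Ico (m + 1) (m + 1 + w) ↔ (k : ℝ) < p.1 + w ∧ p.1 < k + 1 := by
      intro k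
      rw [hp1, mem_Ico]
      constructor
      · rintro ⟨a, b⟩
        exact ⟨by exact_mod_cast b, by exact_mod_cast (by omega : m + 1 < k + 1)⟩
      · rintro ⟨a, b⟩
        have a : k < m + 1 + w := by exact_mod_cast a
        have b : m + 1 < k + 1 := by exact_mod_cast b
        omega
    have h1' : x₀ ≤ m + 1 := by rw [hp1] at h1; exact_mod_cast h1
    have h2' : m + 1 + w ≤ x₁ := by rw [hp1] at h2; exact_mod_cast h2
    refine ⟨(m + 1, g k₀), ⟨h1', h2', ⟨⟨k₀, (hIco k₀).2 ⟨k3, k4⟩, rfl⟩, ?_⟩, ?_, ?_⟩, ?_⟩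
    · rintro _ ⟨k, hk, rfl⟩
      obtain ⟨a, b⟩ := (hIco k).1 hk
      have hk' := mem_Ico.1 hk
      have := (h3 k (by omega) (by omega) a b).1
      rw [← k5] at this
      exact_mod_cast this
    · intro k hk
      obtain ⟨a, b⟩ := (hIco k).1 hk
      have hk' := mem_Ico.1 hk
      have := (h3 k (by omega) (by omega) a b).2
      rw [← k5] at this
      exact_mod_cast this
    · dsimp only
      rw [add_sub_cancel_right]
      rw [← k5] at hblock
      rcases hblock with hb | hb | hb
      · left; omega
      · right; left; exact_mod_cast hb
      · right; right; exact_mod_cast hb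
    · exact Prod.ext (by simp [toPlane, hp1]) (by simp [toPlane, k5])
  · rintro ⟨⟨x, y⟩, ⟨h1, h2, ⟨⟨k₀, hk₀, rfl⟩, hub⟩, htop, hbl⟩, rfl⟩
    simp only [toPlane] at *
    have h1' : (x₀ : ℝ) ≤ x := by exact_mod_cast h1
    have h2' : (x : ℝ) + w ≤ x₁ := by exact_mod_cast h2
    refine ⟨⟨h1', h2', fun k k1 k2 k3 k4 => ?_⟩, ⟨1, one_pos, ?_⟩, ⟨1, one_pos, ?_⟩⟩
    · have k3 : k < x + w := by exact_mod_cast k3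
      have k4 : x < k + 1 := by exact_mod_cast k4
      have hk : k ∈ Ico x (x + w) := ⟨by omega, k3⟩
      exact ⟨by exact_mod_cast hub ⟨k, hk, rfl⟩, by exact_mod_cast htop k hk⟩
    · rintro x' ⟨hx1, hx2⟩ ⟨c1, c2, c3⟩
      rcases hbl with rfl | hbl
      · linarith
      have hne : x₀ ≤ x - 1 := by
        have : (x₀ : ℝ) < x := by linarith
        have : x₀ < x := by exact_mod_cast this
        omega
      have hw1 : (1 : ℝ) ≤ w := by exact_mod_cast hw
      obtain ⟨d1, d2⟩ := c3 (x - 1) hne (by omega) (by push_cast; linarith) (by push_cast; linarith)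
      have d1 : g (x - 1) ≤ g k₀ := by exact_mod_cast d1
      have d2 : g k₀ + h ≤ f (x - 1) := by exact_mod_cast d2
      omega
    · rintro y' ⟨hy1, hy2⟩ ⟨c1, c2, c3⟩
      obtain ⟨a, b⟩ := mem_Ico.1 hk₀
      have := (c3 k₀ (by omega) (by omega) (by exact_mod_cast b)
        (by exact_mod_cast (by omega : x < k₀ + 1))).1
      linarith

end Stable

/-! ### Step functions given by a list of common columns -/

/-- The step functions `f` and `g` have the values `-N k` and `G k` between `X k` and `X (k + 1)`. -/
structure Columns (f g : ℤ → ℤ) (x₀ : ℤ) (m : ℕ) (X G N : ℕ → ℤ) : Prop where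
  zero : X 0 = x₀
  lt : ∀ k < m, X k < X (k + 1)
  val : ∀ k < m, ∀ j, X k ≤ j → j < X (k + 1) → g j = G k ∧ f j = -N k

/-- The records of the columns `0, …, m - 1` are stored from the address `M` on. -/
def HoldsColumns (mem : ℤ → ℤ) (M : ℤ) (m : ℕ) (X G N : ℕ → ℤ) : Prop :=
  ∀ k < m, mem (M + 5 * k) = X k ∧ mem (M + 5 * k + 1) = G k ∧ mem (M + 5 * k + 2) = N k

section Columns

variable {f g : ℤ → ℤ} {x₀ : ℤ} {m : ℕ} {X G N : ℕ → ℤ}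

theorem Columns.snoc (C : Columns f g x₀ m X G N) {x a b : ℤ} (hx : X m < x)
    (hval : ∀ j, X m ≤ j → j < x → g j = a ∧ f j = -b) :
    Columns f g x₀ (m + 1) (Function.update X (m + 1) x) (Function.update G m a)
      (Function.update N m b) := by
  constructor
  · rw [Function.update_of_ne (by omega), C.zero]
  · intro k hk
    rw [Function.update_of_ne (by omega)]
    rcases (Nat.lt_succ_iff.1 hk).eq_or_lt with rfl | hk
    · rwa [Function.update_self]
    · rw [Function.update_of_ne (by omega)]; exact C.lt k hk
  · intro k hk j h1 h2
    rw [Function.update_of_ne (by omega)] at h1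
    rcases (Nat.lt_succ_iff.1 hk).eq_or_lt with rfl | hk
    · rw [Function.update_self] at h2 ⊢
      rw [Function.update_self]
      exact hval j h1 h2
    · rw [Function.update_of_ne (by omega)] at h2 ⊢
      rw [Function.update_of_ne (by omega)]
      exact C.val k hk j h1 h2

/-- A record has five cells. Three are filled here; the other two are reserved for suffix maxima. -/
theorem HoldsColumns.snoc {mem mem' : ℤ → ℤ} {M : ℤ} (H : HoldsColumns mem M m X G N)
    (hmem : ∀ a < M + 5 * m, mem' a = mem a) {x a b : ℤ} (h0 : mem' (M + 5 * m) = X m)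
    (h1 : mem' (M + 5 * m + 1) = a) (h2 : mem' (M + 5 * m + 2) = b) :
    HoldsColumns mem' M (m + 1) (Function.update X (m + 1) x) (Function.update G m a)
      (Function.update N m b) := by
  intro k hk
  rw [Function.update_of_ne (by omega)]
  rcases (Nat.lt_succ_iff.1 hk).eq_or_lt with rfl | hk
  · rw [Function.update_self, Function.update_self]
    exact ⟨h0, h1, h2⟩
  · rw [Function.update_of_ne (by omega), Function.update_of_ne (by omega), hmem _ (by omega),
      hmem _ (by omega), hmem _ (by omega)]
    exact H k hk

end Columns

/-! ### Merging the two chains into columns -/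

namespace Merge

/-- Store the record of a column. -/
def record : Program :=
  .seq (.store (.reg 10) (.reg 8)) <|
  .seq (.store (.add (.reg 10) (.lit 1)) (.load (.add (.reg 7) (.lit 1)))) <|
  .seq (.store (.add (.reg 10) (.lit 2)) (.sub (.lit 0) (.load (.add (.reg 6) (.lit 1))))) <|
  .assign 10 (.add (.reg 10) (.lit 5))

/-- Go to the next column. -/
def advance : Program :=
  .seq (.assign 12 (.load (.load (.add (.reg 6) (.lit 2))))) <|
  .seq (.assign 13 (.load (.load (.add (.reg 7) (.lit 3))))) <|
  .seq (.ifElse (.le (.reg 12) (.reg 13)) (.assign 8 (.reg 12)) (.assign 8 (.reg 13))) <|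
  .seq (.ifElse (.le (.reg 12) (.reg 13))
    (.assign 6 (.load (.add (.load (.add (.reg 6) (.lit 2))) (.lit 2)))) .skip) <|
  .ifElse (.le (.reg 13) (.reg 12))
    (.assign 7 (.load (.add (.load (.add (.reg 7) (.lit 3))) (.lit 3)))) .skip

def guard : BExp := .not (.le (.reg 9) (.reg 8))

def body : Program := .seq record advance

/-- Registers `6` and `7` point to the current nodes of the upper and the lower chain, register `8`
contains the current abscissa, register `9` the last one, and register `10` the address of the
next record. -/
def init : Program :=
  .seq (.assign 6 (.load (.add (.reg 0) (.lit 2)))) <|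
  .seq (.assign 7 (.reg 0)) <|
  .seq (.assign 8 (.load (.reg 0))) <|
  .seq (.assign 9 (.load (.reg 1))) <|
  .assign 10 (.reg 5)

theorem exec_init (s : State) :
    (init.exec s).mem = s.mem ∧ (init.exec s).reg 6 = s.mem (s.reg 0 + 2) ∧
    (init.exec s).reg 7 = s.reg 0 ∧ (init.exec s).reg 8 = s.mem (s.reg 0) ∧
    (init.exec s).reg 9 = s.mem (s.reg 1) ∧ (init.exec s).reg 10 = s.reg 5 ∧
    (init.exec s).reg 3 = s.reg 3 ∧ (init.exec s).reg 4 = s.reg 4 ∧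
    (init.exec s).reg 5 = s.reg 5 := by
  simp [init, Program.exec, AExp.eval]

/-- The nodes read lie below the record being written, so the stores do not disturb the later loads.
-/
theorem exec_record (s : State) (h6 : s.reg 6 + 1 < s.reg 10) (h7 : s.reg 7 + 1 < s.reg 10) :
    (record.exec s).reg 10 = s.reg 10 + 5 ∧ (∀ i, i ≠ 10 → (record.exec s).reg i = s.reg i) ∧
    (record.exec s).mem (s.reg 10) = s.reg 8 ∧
    (record.exec s).mem (s.reg 10 + 1) = s.mem (s.reg 7 + 1) ∧
    (record.exec s).mem (s.reg 10 + 2) = - s.mem (s.reg 6 + 1) ∧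
    ∀ a < s.reg 10, (record.exec s).mem a = s.mem a := by
  refine ⟨?_, ?_, ?_, ?_, ?_, ?_⟩
  · simp [record, Program.exec, AExp.eval]
  · intro i hi
    simp [record, Program.exec, AExp.eval, hi]
  · simp [record, Program.exec, AExp.eval, Function.update_apply]
  · simp [record, Program.exec, AExp.eval, Function.update_apply, h7.ne]
  · simp [record, Program.exec, AExp.eval, Function.update_apply, h6.ne,
      (show s.reg 6 + 1 ≠ s.reg 10 + 1 by omega)]
  · intro a ha
    simp [record, Program.exec, AExp.eval, Function.update_apply, ha.ne,
      (show a ≠ s.reg 10 + 1 by omega), (show a ≠ s.reg 10 + 2 by omega)]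

theorem exec_advance (s : State) {t b xt xb : ℤ} (ht : s.mem (s.reg 6 + 2) = t)
    (hb : s.mem (s.reg 7 + 3) = b) (hxt : s.mem t = xt) (hxb : s.mem b = xb) :
    (advance.exec s).mem = s.mem ∧ (advance.exec s).reg 8 = min xt xb ∧
    (advance.exec s).reg 6 = (if xt ≤ xb then s.mem (t + 2) else s.reg 6) ∧
    (advance.exec s).reg 7 = (if xb ≤ xt then s.mem (b + 3) else s.reg 7) ∧
    ∀ i ∉ ({6, 7, 8, 12, 13} : Finset ℕ), (advance.exec s).reg i = s.reg i := by
  by_cases h1 : xt ≤ xb <;> by_cases h2 : xb ≤ xt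
  all_goals
    refine ⟨?_, ?_, ?_, ?_, fun i hi => ?_⟩
    · simp [advance, Program.exec, AExp.eval, BExp.eval, ht, hb, hxt, hxb, h1, h2]
    · simp [advance, Program.exec, AExp.eval, BExp.eval, ht, hb, hxt, hxb, h1, h2]
      try omega
    · simp [advance, Program.exec, AExp.eval, BExp.eval, ht, hb, hxt, hxb, h1, h2]
    · simp [advance, Program.exec, AExp.eval, BExp.eval, ht, hb, hxt, hxb, h1, h2]
    · simp only [Finset.mem_insert, Finset.mem_singleton, not_or] at hi
      simp [advance, Program.exec, AExp.eval, BExp.eval, ht, hb, hxt, hxb, h1, h2, hi]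

variable {n : ℕ} {V : ZMod n → ℤ × ℤ} {e : ZMod n} {T B : ℕ → ZMod n} {p q : ℕ} {f g : ℤ → ℤ}

/-- The nodes of the cyclic list lie at the addresses `adr i` below `M`. -/
structure HoldsList (mem : ℤ → ℤ) (M : ℤ) (V : ZMod n → ℤ × ℤ) (adr : ZMod n → ℤ) : Prop where
  lt : ∀ i, adr i + 3 < M
  fst : ∀ i, mem (adr i) = (V i).1
  snd : ∀ i, mem (adr i + 1) = (V i).2
  next : ∀ i, mem (adr i + 2) = adr (i + 1)
  prev : ∀ i, mem (adr (i + 1) + 3) = adr i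

/-- The invariant of the loop: `m` records are written. -/
structure Inv (V : ZMod n → ℤ × ℤ) (e : ZMod n) (T B : ℕ → ZMod n) (p q : ℕ) (f g : ℤ → ℤ)
    (adr : ZMod n → ℤ) (M w h : ℤ) (m : ℕ) (X G N : ℕ → ℤ) (s : State) : Prop where
  reg3 : s.reg 3 = w
  reg4 : s.reg 4 = h
  reg5 : s.reg 5 = M
  reg8 : s.reg 8 = X m
  reg9 : s.reg 9 = (V (T p)).1
  reg10 : s.reg 10 = M + 5 * m
  list : HoldsList s.mem M V adr
  columns : Columns f g (V e).1 m X G N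
  holds : HoldsColumns s.mem M m X G N
  le : X m ≤ (V (T p)).1

/-- The current nodes, if the end is not reached. -/
def At (V : ZMod n → ℤ × ℤ) (T B : ℕ → ZMod n) (p q : ℕ) (adr : ZMod n → ℤ) (a b : ℕ)
    (s : State) : Prop :=
  a < p ∧ b < q ∧ s.reg 6 = adr (T a) ∧ s.reg 7 = adr (B b + 1) ∧
    (V (T a)).1 ≤ s.reg 8 ∧ s.reg 8 < (V (T a + 1)).1 ∧
    (V (B b + 1)).1 ≤ s.reg 8 ∧ s.reg 8 < (V (B b)).1

/-- The measure `K` counts the chain edges not yet passed, and `m + K ≤ p + q` bounds the number of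
columns. The current nodes are described only before the last abscissa, because the final round
moves a pointer off its chain. -/
def LoopInv (V : ZMod n → ℤ × ℤ) (e : ZMod n) (T B : ℕ → ZMod n) (p q : ℕ) (f g : ℤ → ℤ)
    (adr : ZMod n → ℤ) (M w h : ℤ) (K : ℕ) (s : State) : Prop :=
  ∃ m X G N, Inv V e T B p q f g adr M w h m X G N s ∧ m + K ≤ p + q ∧
    (s.reg 8 < (V (T p)).1 → ∃ a b, At V T B p q adr a b s ∧ K = (p - a) + (q - b))

theorem top_le_end (hV : IsClosedRectilinearArc V) (C : Chains V e T B p q) {a : ℕ} (ha : a < p) :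
    (V (T a + 1)).1 ≤ (V (T p)).1 ∧ ((V (T a + 1)).1 < (V (T p)).1 → a + 1 < p) := by
  rw [C.top_right hV ha]
  rcases (show a + 1 ≤ p from ha).eq_or_lt with h | h
  · rw [h]; exact ⟨le_rfl, fun h => absurd h (lt_irrefl _)⟩
  · exact ⟨(C.top_lt hV h le_rfl).le, fun _ => h⟩

theorem bot_le_end (hV : IsClosedRectilinearArc V) (C : Chains V e T B p q)
    (hend : T p = B (q - 1)) {b : ℕ} (hb : b < q) :
    (V (B b)).1 ≤ (V (T p)).1 ∧ ((V (B b)).1 < (V (T p)).1 → b + 1 < q) := by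
  rw [hend]
  rcases (show b ≤ q - 1 by omega).eq_or_lt with h | h
  · rw [h]; exact ⟨le_rfl, fun h => absurd h (lt_irrefl _)⟩
  · exact ⟨(C.bot_lt hV h (by omega)).le, fun _ => by omega⟩

theorem body_step (hV : IsClosedRectilinearArc V) (C : Chains V e T B p q)
    (hend : T p = B (q - 1)) (F : Follows V T B p q f g) {adr : ZMod n → ℤ} {M w h : ℤ} {K : ℕ}
    {s : State} (hs : LoopInv V e T B p q f g adr M w h K s) (hg : guard.eval s) :
    ∃ K' < K, LoopInv V e T B p q f g adr M w h K' (body.exec s) := by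
  obtain ⟨m, X, G, N, hI, hK, hat⟩ := hs
  have hlt : s.reg 8 < (V (T p)).1 := by
    have h1 : ¬ s.reg 9 ≤ s.reg 8 := hg
    rw [hI.reg9] at h1
    omega
  obtain ⟨a, b, ⟨ha, hb, h6, h7, a1, a2, b1, b2⟩, hKab⟩ := hat hlt
  have hL := hI.list
  have l1 := hL.lt (T a)
  have l2 := hL.lt (B b + 1)
  have h10 := hI.reg10
  obtain ⟨r10, rreg, rm0, rm1, rm2, rmem⟩ := exec_record s (by omega) (by omega)
  have hmemM : ∀ x < M, (record.exec s).mem x = s.mem x := fun x hx => rmem x (by omega)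
  have hL' : HoldsList (record.exec s).mem M V adr := by
    refine ⟨hL.lt, fun i => ?_, fun i => ?_, fun i => ?_, fun i => ?_⟩
    · rw [hmemM _ (by have := hL.lt i; omega), hL.fst]
    · rw [hmemM _ (by have := hL.lt i; omega), hL.snd]
    · rw [hmemM _ (by have := hL.lt i; omega), hL.next]
    · rw [hmemM _ (by have := hL.lt (i + 1); omega), hL.prev]
  obtain ⟨amem, a8, a6, a7, areg⟩ := exec_advance (record.exec s) (t := adr (T a + 1))
    (b := adr (B b)) (xt := (V (T a + 1)).1) (xb := (V (B b)).1)
    (by rw [rreg 6 (by decide), h6, hL'.next]) (by rw [rreg 7 (by decide), h7, hL'.prev])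
    (hL'.fst _) (hL'.fst _)
  have hbody : body.exec s = advance.exec (record.exec s) := rfl
  rw [← hbody] at amem a8 a6 a7 areg
  rw [rreg 6 (by decide), h6, hL'.next, ← C.top_succ] at a6
  rw [rreg 7 (by decide), h7] at a7
  have e1 := top_le_end hV C ha
  have e2 := bot_le_end hV C hend hb
  have h8 := hI.reg8
  set x := min (V (T a + 1)).1 (V (B b)).1 with hx
  have hCol := hI.columns.snoc (x := x) (a := (V (B b)).2) (b := -(V (T a)).2) (by omega) (by
    intro j j1 j2
    rw [F.top a ha j (by omega) (by omega), F.bot b hb j (by omega) (by omega)]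
    simp)
  have hHold := hI.holds.snoc (x := x) (a := (V (B b)).2) (b := -(V (T a)).2)
    (mem' := (body.exec s).mem) (by rw [← h10, amem]; exact rmem)
    (by rw [← h10, amem, rm0, h8])
    (by rw [← h10, amem, rm1, h7, hL.snd, (C.bot b hb).1])
    (by rw [← h10, amem, rm2, h6, hL.snd])
  have hInv : Inv V e T B p q f g adr M w h (m + 1) _ _ _ (body.exec s) :=
    { reg3 := by rw [areg 3 (by decide), rreg 3 (by decide), hI.reg3]
      reg4 := by rw [areg 4 (by decide), rreg 4 (by decide), hI.reg4]
      reg5 := by rw [areg 5 (by decide), rreg 5 (by decide), hI.reg5]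
      reg8 := by rw [a8, Function.update_self]
      reg9 := by rw [areg 9 (by decide), rreg 9 (by decide), hI.reg9]
      reg10 := by rw [areg 10 (by decide), r10, h10]; push_cast; ring
      list := by rw [amem]; exact hL'
      columns := hCol
      holds := hHold
      le := by rw [Function.update_self]; omega }
  -- Before the last abscissa at least one of the chains advances. At the last abscissa the loop is
  -- over, and the measure is set to `0`.
  by_cases hxe : x < (V (T p)).1
  · set a' := if (V (T a + 1)).1 ≤ (V (B b)).1 then a + 1 else a with ha'
    set b' := if (V (B b)).1 ≤ (V (T a + 1)).1 then b + 1 else b with hb'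
    have hap : a' < p := by
      rw [ha']; split_ifs with hc
      · exact e1.2 (by omega)
      · exact ha
    have hbq : b' < q := by
      rw [hb']; split_ifs with hc
      · exact e2.2 (by omega)
      · exact hb
    refine ⟨(p - a') + (q - b'), ?_, m + 1, _, _, _, hInv, ?_, fun _ => ⟨a', b', ?_, rfl⟩⟩
    · rw [hKab]
      rcases le_total (V (T a + 1)).1 (V (B b)).1 with hc | hc
      · have : a' = a + 1 := if_pos hc
        have : b ≤ b' := by rw [hb']; split_ifs <;> omega
        omega
      · have : b' = b + 1 := if_pos hc
        have : a ≤ a' := by rw [ha']; split_ifs <;> omega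
        omega
    · rcases le_total (V (T a + 1)).1 (V (B b)).1 with hc | hc
      · have : a' = a + 1 := if_pos hc
        have : b ≤ b' := by rw [hb']; split_ifs <;> omega
        omega
      · have : b' = b + 1 := if_pos hc
        have : a ≤ a' := by rw [ha']; split_ifs <;> omega
        omega
    · refine ⟨hap, hbq, ?_, ?_, ?_⟩
      · rw [a6, ha']; split_ifs <;> rfl
      · rw [a7, hb']; split_ifs with hc
        · have := hL'.prev (B (b + 1) + 1)
          rwa [← C.bot_succ] at this
        · rfl
      · rw [a8]
        have t1 : (V (T a')).1 ≤ x ∧ x < (V (T a' + 1)).1 := by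
          by_cases hc : (V (T a + 1)).1 ≤ (V (B b)).1
          · have hh : a' = a + 1 := if_pos hc
            have := (C.top a' hap).2
            rw [hh, ← C.top_right hV ha] at *
            omega
          · have hh : a' = a := if_neg hc
            rw [hh]; omega
        have t2 : (V (B b' + 1)).1 ≤ x ∧ x < (V (B b')).1 := by
          by_cases hc : (V (B b)).1 ≤ (V (T a + 1)).1
          · have hh : b' = b + 1 := if_pos hc
            have hbq' : b + 1 < q := by omega
            have := (C.bot _ hbq').2
            rw [hh, C.bot_left hV hbq'] at *
            omega
          · have hh : b' = b := if_neg hc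
            rw [hh]; omega
        exact ⟨t1.1, t1.2, t2.1, t2.2⟩
  · refine ⟨0, by omega, m + 1, _, _, _, hInv, by omega, fun hcon => ?_⟩
    rw [a8] at hcon
    exact absurd hcon hxe

theorem loopInv_init (hV : IsClosedRectilinearArc V) (C : Chains V e T B p q)
    {adr : ZMod n → ℤ} {s : State}
    (hL : HoldsList s.mem (s.reg 5) V adr) (h0 : s.reg 0 = adr e)
    (h1 : s.mem (s.reg 1) = (V (T p)).1) :
    LoopInv V e T B p q f g adr (s.reg 5) (s.reg 3) (s.reg 4) (p + q) (init.exec s) := by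
  obtain ⟨i0, i6, i7, i8, i9, i10, i3, i4, i5⟩ := exec_init s
  have hp := C.top_pos
  have hq := C.bot_pos
  have ht := (C.top 0 hp).2
  have hb := (C.bot 0 hq).2
  have hl := C.leftmost.1
  have hge := C.top_ge hV (a := p) le_rfl
  refine ⟨0, fun _ => (V e).1, fun _ => 0, fun _ => 0, ⟨i3, i4, i5, ?_, ?_, ?_, ?_, ?_, ?_, ?_⟩,
    by omega, fun _ => ⟨0, 0, ⟨hp, hq, ?_, ?_, ?_⟩, by omega⟩⟩
  · rw [i8, h0, hL.fst]
  · rw [i9, h1]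
  · rw [i10]; simp
  · rw [i0]; exact hL
  · exact ⟨rfl, by simp, by simp⟩
  · intro k hk; omega
  · omega
  · rw [i6, h0, hL.next, C.top_zero]
  · rw [i7, h0, ← C.bot_zero]
  · rw [i8, h0, hL.fst]
    rw [C.top_zero] at ht ⊢
    rw [← C.bot_zero] at hb ⊢
    omega

end Merge

/-! ### Stable locations in terms of columns -/

section ColumnLocations

variable {f g : ℤ → ℤ} {x₀ : ℤ} {m : ℕ} {X G N : ℕ → ℤ}

theorem Columns.lt_of_lt (C : Columns f g x₀ m X G N) {i j : ℕ} (hij : i < j) (hj : j ≤ m) :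
    X i < X j := by
  induction j, hij using Nat.le_induction with
  | base => exact C.lt i hj
  | succ j hij ih => exact (ih (by omega)).trans (C.lt j hj)

theorem Columns.le_of_le (C : Columns f g x₀ m X G N) {i j : ℕ} (hij : i ≤ j) (hj : j ≤ m) :
    X i ≤ X j := by
  rcases hij.eq_or_lt with rfl | h
  · rfl
  · exact (C.lt_of_lt h hj).le

theorem exists_column {j : ℤ} (h1 : X 0 ≤ j) (h2 : j < X m) :
    ∃ k < m, X k ≤ j ∧ j < X (k + 1) := by
  classical
  have hex : ∃ k, j < X k := ⟨m, h2⟩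
  have hm : Nat.find hex ≤ m := Nat.find_min' hex h2
  have hpos : Nat.find hex ≠ 0 := by
    intro h0
    have := Nat.find_spec hex
    rw [h0] at this; omega
  obtain ⟨k, hk⟩ := Nat.exists_eq_succ_of_ne_zero hpos
  have h3 := Nat.find_min hex (m := k) (by omega)
  have h4 := Nat.find_spec hex
  rw [hk] at h4
  exact ⟨k, by omega, by omega, h4⟩

/-- The columns which a rectangle of width `w` with its left side at the column `i` meets. -/
def window (X : ℕ → ℤ) (m : ℕ) (w : ℤ) (i : ℕ) : Set ℕ := {k | i ≤ k ∧ k < m ∧ X k < X i + w}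

/-- The stable location with the left side at the column `i`. -/
structure StableAt (X G N : ℕ → ℤ) (m : ℕ) (w h : ℤ) (i : ℕ) (x y : ℤ) : Prop where
  eq : x = X i
  le_right : X i + w ≤ X m
  isGreatest : IsGreatest (G '' window X m w i) y
  le_top : ∀ k ∈ window X m w i, y + h ≤ -N k
  blocked : i = 0 ∨ y < G (i - 1) ∨ -N (i - 1) < y + h

theorem Columns.image_window (C : Columns f g x₀ m X G N) {w : ℤ} {i : ℕ} (hi : i < m)
    (hle : X i + w ≤ X m) : G '' window X m w i = g '' Ico (X i) (X i + w) := by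
  ext y
  constructor
  · rintro ⟨k, ⟨h1, h2, h3⟩, rfl⟩
    exact ⟨X k, ⟨C.le_of_le h1 h2.le, h3⟩, (C.val k h2 _ le_rfl (C.lt k h2)).1⟩
  · rintro ⟨j, ⟨h1, h2⟩, rfl⟩
    obtain ⟨k, hk, k1, k2⟩ := exists_column (X := X) (m := m) (j := j)
      ((C.le_of_le (Nat.zero_le i) hi.le).trans h1) (by omega)
    refine ⟨k, ⟨?_, hk, by omega⟩, ((C.val k hk _ k1 k2).1).symm⟩
    by_contra! hlt
    have := C.le_of_le (i := k + 1) (j := i) (by omega) hi.le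
    omega

theorem Columns.stableIn_iff (C : Columns f g x₀ m X G N) {w h : ℤ} (hw : 0 < w) (x y : ℤ) :
    StableIn f g x₀ (X m) w h x y ↔ ∃ i < m, StableAt X G N m w h i x y := by
  have top_iff : ∀ i < m, X i + w ≤ X m → ((∀ k ∈ Ico (X i) (X i + w), y + h ≤ f k) ↔
      ∀ k ∈ window X m w i, y + h ≤ -N k) := by
    intro i hi hle
    constructor
    · rintro H k ⟨h1, h2, h3⟩
      rw [← (C.val k h2 _ le_rfl (C.lt k h2)).2]
      exact H _ ⟨C.le_of_le h1 h2.le, h3⟩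
    · rintro H j ⟨h1, h2⟩
      obtain ⟨k, hk, k1, k2⟩ := exists_column (X := X) (m := m) (j := j)
        ((C.le_of_le (Nat.zero_le i) hi.le).trans h1) (by omega)
      rw [(C.val k hk _ k1 k2).2]
      refine H k ⟨?_, hk, by omega⟩
      by_contra! hlt
      have := C.le_of_le (i := k + 1) (j := i) (by omega) hi.le
      omega
  have prev : ∀ i < m, i ≠ 0 → g (X i - 1) = G (i - 1) ∧ f (X i - 1) = -N (i - 1) := by
    intro i hi h0
    obtain ⟨i, rfl⟩ : ∃ i', i = i' + 1 := Nat.exists_eq_succ_of_ne_zero h0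
    have := C.lt i (by omega)
    exact C.val i (by omega) _ (by omega) (by omega)
  constructor
  · rintro ⟨h1, h2, h3, h4, h5⟩
    obtain ⟨i, hi, i1, i2⟩ := exists_column (X := X) (m := m) (j := x) (by rw [C.zero]; exact h1) (by omega)
    -- Strictly inside a column, the unit interval to the left of `x` has the same floor and ceiling
    -- as the one to its right, so it cannot block the shift.
    obtain rfl : x = X i := by
      by_contra hne
      obtain ⟨c1, c2⟩ := C.val i hi x i1 i2
      obtain ⟨c3, c4⟩ := C.val i hi (x - 1) (by omega) (by omega)
      have hx0 := C.le_of_le (Nat.zero_le i) hi.le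
      rw [C.zero] at hx0
      have hmem : x ∈ Ico x (x + w) := ⟨le_rfl, by omega⟩
      have c5 := h3.2 ⟨x, hmem, rfl⟩
      have c6 := h4 x hmem
      rcases h5 with h5 | h5 | h5 <;> omega
    refine ⟨i, hi, rfl, h2, by rwa [C.image_window hi h2], (top_iff i hi h2).1 h4, ?_⟩
    by_cases h0 : i = 0
    · exact .inl h0
    · obtain ⟨c1, c2⟩ := prev i hi h0
      rw [c1, c2] at h5
      rcases h5 with h5 | h5
      · have := C.lt_of_lt (Nat.pos_of_ne_zero h0) hi.le
        rw [C.zero] at this; omega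
      · exact .inr h5
  · rintro ⟨i, hi, rfl, h2, h3, h4, h5⟩
    refine ⟨?_, h2, by rwa [← C.image_window hi h2], (top_iff i hi h2).2 h4, ?_⟩
    · rw [← C.zero]; exact C.le_of_le (Nat.zero_le i) hi.le
    · by_cases h0 : i = 0
      · left; rw [h0, C.zero]
      · obtain ⟨c1, c2⟩ := prev i hi h0
        rw [c1, c2]
        exact .inr (h5.resolve_left h0)

end ColumnLocations

/-! ### Maxima over a sliding window -/

namespace Slide

/-- Register `r` becomes the maximum of itself and the value of `e`. -/
def maxWith (r : ℕ) (e : AExp) : Program :=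
  .ifElse (.le (.reg r) e) (.assign r e) .skip

/-- Extend the window by one column on the right. -/
def absorb : Program :=
  .seq (maxWith 12 (.load (.add (.reg 7) (.lit 1)))) <|
  .seq (maxWith 13 (.load (.add (.reg 7) (.lit 2)))) <|
  .assign 7 (.add (.reg 7) (.lit 5))

/-- Start the computation of new suffix maxima. -/
def restart : Program :=
  .seq (.assign 8 (.reg 7)) <|
  .seq (.assign 9 (.reg 7)) <|
  -- The addresses `reg 7 - 4` and `reg 7 - 3` hold the two values of the last column of the window,
  -- in the record before the one that register `7` points to.
  .seq (.assign 12 (.load (.sub (.reg 7) (.lit 4)))) <|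
  .seq (.assign 13 (.load (.sub (.reg 7) (.lit 3)))) <|
  .seq (.assign 14 (.reg 12)) <|
  .assign 15 (.reg 13)

/-- Compute the next suffix maximum. -/
def suffix : Program :=
  .seq (.assign 9 (.sub (.reg 9) (.lit 5))) <|
  .seq (maxWith 14 (.load (.add (.reg 9) (.lit 1)))) <|
  .seq (maxWith 15 (.load (.add (.reg 9) (.lit 2)))) <|
  .seq (.store (.add (.reg 9) (.lit 3)) (.reg 14)) <|
  .store (.add (.reg 9) (.lit 4)) (.reg 15)

/-- The maxima over the window. -/
def query : Program :=
  .seq (.assign 17 (.load (.add (.reg 6) (.lit 3)))) <|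
  .seq (maxWith 17 (.reg 12)) <|
  .seq (.assign 18 (.load (.add (.reg 6) (.lit 4)))) <|
  maxWith 18 (.reg 13)

/-- The rectangle fits below the top. -/
def fits : BExp := .le (.add (.reg 17) (.reg 4)) (.sub (.lit 0) (.reg 18))

/-- There is a previous column into which the rectangle can be shifted. -/
def shiftable : BExp :=
  .and (.not (.le (.reg 6) (.reg 5))) <|
  .and (.le (.load (.sub (.reg 6) (.lit 4))) (.reg 17)) <|
  .le (.add (.reg 17) (.reg 4)) (.sub (.lit 0) (.load (.sub (.reg 6) (.lit 3))))

/-- Output a point. -/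
def output : Program :=
  .seq (.store (.reg 16) (.load (.reg 6))) <|
  .seq (.store (.add (.reg 16) (.lit 1)) (.reg 17)) <|
  .seq (.assign 16 (.add (.reg 16) (.lit 2))) <|
  .assign 0 (.add (.reg 0) (.lit 1))

/-- Test the current column, and go to the next one. -/
def test : Program :=
  .seq query <|
  .seq (.ifElse (.and fits (.not shiftable)) output .skip) <|
  .assign 6 (.add (.reg 6) (.lit 5))

def guard : BExp := .le (.add (.load (.reg 6)) (.reg 3)) (.reg 11)

def inWindow : BExp := .not (.le (.add (.load (.reg 6)) (.reg 3)) (.load (.reg 7)))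

/-- Each round makes one elementary move. The order of the conditions ensures that `test` runs only
when the window is complete and the suffix maxima for its first column are available. -/
def body : Program :=
  .ifElse inWindow absorb <|
  .ifElse (.le (.reg 8) (.reg 6)) restart <|
  .ifElse (.not (.le (.reg 9) (.reg 6))) suffix test

/-- Registers `6`, `7`, `8`, `9` point to the records of the current column, of the first column
behind the window, of the first column without a suffix maximum, and of the first column with a
suffix maximum. Registers `12` and `13` contain the maxima over the columns behind the suffixes,
registers `14` and `15` the latest suffix maxima, register `16` the address for the next output. -/
def init : Program :=
  -- The right end of the hole is stored as a sentinel abscissa behind the last record, so that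
  -- pointers to column `m` can be read. The output starts five cells later.
  .seq (.store (.reg 10) (.reg 9)) <|
  .seq (.assign 11 (.reg 9)) <|
  .seq (.assign 6 (.reg 5)) <|
  .seq (.assign 7 (.reg 5)) <|
  .seq (.assign 8 (.reg 5)) <|
  .seq (.assign 9 (.reg 5)) <|
  .seq (.assign 1 (.add (.reg 10) (.lit 5))) <|
  .seq (.assign 16 (.reg 1)) <|
  .assign 0 (.lit 0)

theorem exec_init (s : State) :
    (init.exec s).mem = Function.update s.mem (s.reg 10) (s.reg 9) ∧
    (init.exec s).reg 11 = s.reg 9 ∧ (init.exec s).reg 6 = s.reg 5 ∧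
    (init.exec s).reg 7 = s.reg 5 ∧ (init.exec s).reg 8 = s.reg 5 ∧
    (init.exec s).reg 9 = s.reg 5 ∧ (init.exec s).reg 1 = s.reg 10 + 5 ∧
    (init.exec s).reg 16 = s.reg 10 + 5 ∧ (init.exec s).reg 0 = 0 ∧
    (init.exec s).reg 3 = s.reg 3 ∧ (init.exec s).reg 4 = s.reg 4 ∧
    (init.exec s).reg 5 = s.reg 5 := by
  simp [init, Program.exec, AExp.eval]

theorem exec_maxWith (r : ℕ) (e : AExp) (s : State) :
    (maxWith r e).exec s = ⟨Function.update s.reg r (max (s.reg r) (e.eval s)), s.mem⟩ := by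
  by_cases h : s.reg r ≤ e.eval s
  · simp [maxWith, Program.exec, BExp.eval, AExp.eval, h]
  · simp [maxWith, Program.exec, BExp.eval, AExp.eval, h, max_eq_left (not_le.1 h).le]

theorem exec_absorb (s : State) :
    (absorb.exec s).mem = s.mem ∧ (absorb.exec s).reg 7 = s.reg 7 + 5 ∧
    (absorb.exec s).reg 12 = max (s.reg 12) (s.mem (s.reg 7 + 1)) ∧
    (absorb.exec s).reg 13 = max (s.reg 13) (s.mem (s.reg 7 + 2)) ∧
    ∀ i ∉ ({7, 12, 13} : Finset ℕ), (absorb.exec s).reg i = s.reg i := by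
  refine ⟨?_, ?_, ?_, ?_, fun i hi => ?_⟩
  on_goal 5 => simp only [Finset.mem_insert, Finset.mem_singleton, not_or] at hi
  all_goals simp [absorb, Program.exec, AExp.eval, exec_maxWith, *]

theorem exec_restart (s : State) :
    (restart.exec s).mem = s.mem ∧ (restart.exec s).reg 8 = s.reg 7 ∧
    (restart.exec s).reg 9 = s.reg 7 ∧ (restart.exec s).reg 12 = s.mem (s.reg 7 - 4) ∧
    (restart.exec s).reg 13 = s.mem (s.reg 7 - 3) ∧
    (restart.exec s).reg 14 = s.mem (s.reg 7 - 4) ∧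
    (restart.exec s).reg 15 = s.mem (s.reg 7 - 3) ∧
    ∀ i ∉ ({8, 9, 12, 13, 14, 15} : Finset ℕ), (restart.exec s).reg i = s.reg i := by
  refine ⟨?_, ?_, ?_, ?_, ?_, ?_, ?_, fun i hi => ?_⟩
  on_goal 8 => simp only [Finset.mem_insert, Finset.mem_singleton, not_or] at hi
  all_goals simp [restart, Program.exec, AExp.eval, *]

theorem exec_suffix (s : State) :
    (suffix.exec s).reg 9 = s.reg 9 - 5 ∧
    (suffix.exec s).reg 14 = max (s.reg 14) (s.mem (s.reg 9 - 5 + 1)) ∧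
    (suffix.exec s).reg 15 = max (s.reg 15) (s.mem (s.reg 9 - 5 + 2)) ∧
    (suffix.exec s).mem (s.reg 9 - 5 + 3) = max (s.reg 14) (s.mem (s.reg 9 - 5 + 1)) ∧
    (suffix.exec s).mem (s.reg 9 - 5 + 4) = max (s.reg 15) (s.mem (s.reg 9 - 5 + 2)) ∧
    (∀ a, a ≠ s.reg 9 - 5 + 3 → a ≠ s.reg 9 - 5 + 4 → (suffix.exec s).mem a = s.mem a) ∧
    ∀ i ∉ ({9, 14, 15} : Finset ℕ), (suffix.exec s).reg i = s.reg i := by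
  refine ⟨?_, ?_, ?_, ?_, ?_, fun a h3 h4 => ?_, fun i hi => ?_⟩
  on_goal 7 => simp only [Finset.mem_insert, Finset.mem_singleton, not_or] at hi
  all_goals simp [suffix, Program.exec, AExp.eval, exec_maxWith, *]

theorem exec_query (s : State) :
    (query.exec s).mem = s.mem ∧
    (query.exec s).reg 17 = max (s.mem (s.reg 6 + 3)) (s.reg 12) ∧
    (query.exec s).reg 18 = max (s.mem (s.reg 6 + 4)) (s.reg 13) ∧
    ∀ i ∉ ({17, 18} : Finset ℕ), (query.exec s).reg i = s.reg i := by
  refine ⟨?_, ?_, ?_, fun i hi => ?_⟩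
  on_goal 4 => simp only [Finset.mem_insert, Finset.mem_singleton, not_or] at hi
  all_goals simp [query, Program.exec, AExp.eval, exec_maxWith, *]

theorem exec_output (s : State) :
    (output.exec s).mem (s.reg 16) = s.mem (s.reg 6) ∧
    (output.exec s).mem (s.reg 16 + 1) = s.reg 17 ∧
    (∀ a < s.reg 16, (output.exec s).mem a = s.mem a) ∧
    (output.exec s).reg 16 = s.reg 16 + 2 ∧ (output.exec s).reg 0 = s.reg 0 + 1 ∧
    ∀ i ∉ ({0, 16} : Finset ℕ), (output.exec s).reg i = s.reg i := by
  refine ⟨?_, ?_, fun a ha => ?_, ?_, ?_, fun i hi => ?_⟩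
  on_goal 6 => simp only [Finset.mem_insert, Finset.mem_singleton, not_or] at hi
  on_goal 3 =>
    have h1 : a ≠ s.reg 16 := ha.ne
    have h2 : a ≠ s.reg 16 + 1 := by omega
  all_goals simp [output, Program.exec, AExp.eval, *]

end Slide

/-! ### Invariant and potential of the sliding window -/

namespace Slide

variable {f g : ℤ → ℤ} {x₀ : ℤ} {m : ℕ} {X G N : ℕ → ℤ} {M w h : ℤ}

/-- The maxima for the windows which start before the column `d`, end at the column `r`, and
start at the column `q` or later. -/
structure Maxima (G N : ℕ → ℤ) (M : ℤ) (r d q : ℕ) (s : State) : Prop where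
  reg12 : IsGreatest (G '' Ico (d - 1) r) (s.reg 12)
  reg13 : IsGreatest (N '' Ico (d - 1) r) (s.reg 13)
  reg14 : IsGreatest (G '' Ico (min q (d - 1)) d) (s.reg 14)
  reg15 : IsGreatest (N '' Ico (min q (d - 1)) d) (s.reg 15)
  suffix : ∀ k, q ≤ k → k < d → IsGreatest (G '' Ico k d) (s.mem (M + 5 * k + 3)) ∧
    IsGreatest (N '' Ico k d) (s.mem (M + 5 * k + 4))

/-- The invariant of the loop: the columns before `i` are tested, and `c` points are output. -/
structure Inv (X G N : ℕ → ℤ) (m : ℕ) (M w h : ℤ) (i r d q c : ℕ) (s : State) : Prop where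
  reg0 : s.reg 0 = c
  reg1 : s.reg 1 = M + 5 * m + 5
  reg3 : s.reg 3 = w
  reg4 : s.reg 4 = h
  reg5 : s.reg 5 = M
  reg6 : s.reg 6 = M + 5 * i
  reg7 : s.reg 7 = M + 5 * r
  reg8 : s.reg 8 = M + 5 * d
  reg9 : s.reg 9 = M + 5 * q
  reg11 : s.reg 11 = X m
  reg16 : s.reg 16 = M + 5 * m + 5 + 2 * c
  holds : HoldsColumns s.mem M m X G N
  last : s.mem (M + 5 * m) = X m
  le_right : i ≤ r
  right_le : r ≤ m
  le_mid : q ≤ d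
  mid_le : d ≤ r
  window : ∀ k < r, i ≤ k → X k < X i + w
  maxima : i < d → Maxima G N M r d q s
  out : ∀ x y, (∃ j < c, x = s.mem (M + 5 * m + 5 + 2 * j) ∧
    y = s.mem (M + 5 * m + 5 + 2 * j + 1)) ↔ ∃ k < i, StableAt X G N m w h k x y

/-- The potential of the amortized analysis, with truncated subtraction. `absorb`, `suffix` and
`test` lower `m - r`, `q - i` and `m - i` by one. `restart` sets `d` and `q` to `r` when `d ≤ i`:
the term `q - i` rises from `0` to `r - i ≤ r - d`, while the factor `2` makes the second term fall
by twice `r - d`. -/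
def LoopInv (X G N : ℕ → ℤ) (m : ℕ) (M w h : ℤ) (K : ℕ) (s : State) : Prop :=
  ∃ i r d q c, Inv X G N m M w h i r d q c s ∧ K = (m - r) + 2 * (m - d) + (q - i) + (m - i)

theorem isGreatest_image_max {F : ℕ → ℤ} {A B C : Set ℕ} {a b : ℤ}
    (ha : IsGreatest (F '' A) a) (hb : IsGreatest (F '' B) b) (hC : ∀ k, k ∈ C ↔ k ∈ A ∨ k ∈ B) :
    IsGreatest (F '' C) (max a b) := by
  have : C = A ∪ B := Set.ext hC
  rw [this, image_union]
  exact ha.union hb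

theorem isGreatest_image_of_unique {F : ℕ → ℤ} {A : Set ℕ} (k : ℕ) (hA : ∀ j, j ∈ A ↔ j = k) :
    IsGreatest (F '' A) (F k) := by
  have : A = {k} := Set.ext hA
  rw [this, image_singleton]
  exact isGreatest_singleton

theorem Inv.mem_eq {i r d q c : ℕ} {s : State} (hI : Inv X G N m M w h i r d q c s) {k : ℕ}
    (hk : k ≤ m) : s.mem (M + 5 * k) = X k := by
  rcases hk.eq_or_lt with rfl | hk
  · exact hI.last
  · exact (hI.holds k hk).1

theorem absorb_step {i r d q c : ℕ} {s : State}
    (hI : Inv X G N m M w h i r d q c s) (hr : X r < X i + w) (hrm : r < m) :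
    Inv X G N m M w h i (r + 1) d q c (absorb.exec s) := by
  obtain ⟨amem, a7, a12, a13, areg⟩ := exec_absorb s
  obtain ⟨-, hG, hN⟩ := hI.holds r hrm
  have h1 := hI.le_right
  have h2 := hI.mid_le
  constructor
  · rw [areg 0 (by decide), hI.reg0]
  · rw [areg 1 (by decide), hI.reg1]
  · rw [areg 3 (by decide), hI.reg3]
  · rw [areg 4 (by decide), hI.reg4]
  · rw [areg 5 (by decide), hI.reg5]
  · rw [areg 6 (by decide), hI.reg6]
  · rw [a7, hI.reg7]; push_cast; ring
  · rw [areg 8 (by decide), hI.reg8]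
  · rw [areg 9 (by decide), hI.reg9]
  · rw [areg 11 (by decide), hI.reg11]
  · rw [areg 16 (by decide), hI.reg16]
  · rw [amem]; exact hI.holds
  · rw [amem]; exact hI.last
  · omega
  · omega
  · exact hI.le_mid
  · omega
  · intro k hk hik
    rcases (Nat.lt_succ_iff.1 hk).eq_or_lt with rfl | hk
    · exact hr
    · exact hI.window k hk hik
  · intro hid
    have hM := hI.maxima hid
    have hset : ∀ k, k ∈ Ico (d - 1) (r + 1) ↔ k ∈ Ico (d - 1) r ∨ k ∈ ({r} : Set ℕ) := by
      intro k
      simp only [mem_Ico, mem_singleton_iff]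
      omega
    constructor
    · rw [a12, hI.reg7, hG]
      exact isGreatest_image_max hM.reg12 (isGreatest_image_of_unique r fun _ => Iff.rfl) hset
    · rw [a13, hI.reg7, hN]
      exact isGreatest_image_max hM.reg13 (isGreatest_image_of_unique r fun _ => Iff.rfl) hset
    · rw [areg 14 (by decide)]; exact hM.reg14
    · rw [areg 15 (by decide)]; exact hM.reg15
    · rw [amem]; exact hM.suffix
  · rw [amem]; exact hI.out

/-- The back part `[d - 1, r)` retains the last column of the front part. This is harmless for
maxima and keeps the back part nonempty when `d = r`, so no value for an empty maximum is needed. -/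
theorem restart_step {i r d q c : ℕ} {s : State}
    (hI : Inv X G N m M w h i r d q c s) (hir : i < r) :
    Inv X G N m M w h i r r r c (restart.exec s) := by
  obtain ⟨amem, a8, a9, a12, a13, a14, a15, areg⟩ := exec_restart s
  have hrm := hI.right_le
  obtain ⟨r, rfl⟩ : ∃ r', r = r' + 1 := Nat.exists_eq_succ_of_ne_zero (by omega)
  obtain ⟨-, hG, hN⟩ := hI.holds r (by omega)
  have e1 : s.reg 7 - 4 = M + 5 * r + 1 := by rw [hI.reg7]; push_cast; ring
  have e2 : s.reg 7 - 3 = M + 5 * r + 2 := by rw [hI.reg7]; push_cast; ring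
  rw [e1, hG] at a12 a14
  rw [e2, hN] at a13 a15
  constructor
  · rw [areg 0 (by decide), hI.reg0]
  · rw [areg 1 (by decide), hI.reg1]
  · rw [areg 3 (by decide), hI.reg3]
  · rw [areg 4 (by decide), hI.reg4]
  · rw [areg 5 (by decide), hI.reg5]
  · rw [areg 6 (by decide), hI.reg6]
  · rw [areg 7 (by decide), hI.reg7]
  · rw [a8, hI.reg7]
  · rw [a9, hI.reg7]
  · rw [areg 11 (by decide), hI.reg11]
  · rw [areg 16 (by decide), hI.reg16]
  · rw [amem]; exact hI.holds
  · rw [amem]; exact hI.last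
  · omega
  · omega
  · omega
  · omega
  · exact hI.window
  · intro _
    have hset : ∀ k, k ∈ Ico (r + 1 - 1) (r + 1) ↔ k = r := by
      intro k; simp only [mem_Ico]; omega
    have hset' : ∀ k, k ∈ Ico (min (r + 1) (r + 1 - 1)) (r + 1) ↔ k = r := by
      intro k; simp only [mem_Ico]; omega
    constructor
    · rw [a12]; exact isGreatest_image_of_unique r hset
    · rw [a13]; exact isGreatest_image_of_unique r hset
    · rw [a14]; exact isGreatest_image_of_unique r hset'
    · rw [a15]; exact isGreatest_image_of_unique r hset'
    · intro k h1 h2; omega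
  · rw [amem]; exact hI.out

theorem suffix_step {i r d q c : ℕ} {s : State}
    (hI : Inv X G N m M w h i r d (q + 1) c s) (hid : i < d) :
    Inv X G N m M w h i r d q c (suffix.exec s) := by
  obtain ⟨a9, a14, a15, am3, am4, amem, areg⟩ := exec_suffix s
  have h1 := hI.le_mid
  have h2 := hI.mid_le
  have h3 := hI.right_le
  obtain ⟨-, hG, hN⟩ := hI.holds q (by omega)
  have e : s.reg 9 - 5 = M + 5 * q := by rw [hI.reg9]; push_cast; ring
  rw [e] at a9 a14 a15 am3 am4 amem
  rw [hG] at a14 am3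
  rw [hN] at a15 am4
  have hM := hI.maxima hid
  have hset : ∀ k, k ∈ Ico (min q (d - 1)) d ↔
      k ∈ Ico (min (q + 1) (d - 1)) d ∨ k ∈ ({q} : Set ℕ) := by
    intro k
    simp only [mem_Ico, mem_singleton_iff]
    omega
  have g1 := isGreatest_image_max hM.reg14 (isGreatest_image_of_unique q fun _ => Iff.rfl) hset
  have g2 := isGreatest_image_max hM.reg15 (isGreatest_image_of_unique q fun _ => Iff.rfl) hset
  constructor
  · rw [areg 0 (by decide), hI.reg0]
  · rw [areg 1 (by decide), hI.reg1]
  · rw [areg 3 (by decide), hI.reg3]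
  · rw [areg 4 (by decide), hI.reg4]
  · rw [areg 5 (by decide), hI.reg5]
  · rw [areg 6 (by decide), hI.reg6]
  · rw [areg 7 (by decide), hI.reg7]
  · rw [areg 8 (by decide), hI.reg8]
  · exact a9
  · rw [areg 11 (by decide), hI.reg11]
  · rw [areg 16 (by decide), hI.reg16]
  · intro k hk
    rw [amem _ (by omega) (by omega), amem _ (by omega) (by omega), amem _ (by omega) (by omega)]
    exact hI.holds k hk
  · rw [amem _ (by omega) (by omega)]; exact hI.last
  · exact hI.le_right
  · exact h3
  · omega
  · exact h2
  · exact hI.window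
  · intro _
    constructor
    · rw [areg 12 (by decide)]; exact hM.reg12
    · rw [areg 13 (by decide)]; exact hM.reg13
    · rw [a14]; exact g1
    · rw [a15]; exact g2
    · intro k k1 k2
      rcases k1.eq_or_lt with rfl | k1
      · rw [am3, am4]
        rw [min_eq_left (by omega)] at g1 g2
        exact ⟨g1, g2⟩
      · rw [amem _ (by omega) (by omega), amem _ (by omega) (by omega)]
        exact hM.suffix k k1 k2
  · intro x y
    rw [← hI.out x y]
    refine exists_congr fun j => and_congr_right fun _ => ?_
    rw [amem _ (by omega) (by omega), amem _ (by omega) (by omega)]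

/-- The window is `[i, r)`, the union of `[i, d)` and `[d - 1, r)`. Hence the stored suffix maxima
at `i` combined with registers `12` and `13` give its maxima, the only possible height of a stable
location and the negated lowest ceiling. -/
theorem test_step (C : Columns f g x₀ m X G N) {i r d q c : ℕ} {s : State}
    (hI : Inv X G N m M w h i r d q c s) (hid : i < d) (hqi : q ≤ i) (hle : X i + w ≤ X m)
    (hr : X i + w ≤ X r) : Inv X G N m M w h (i + 1) r d q c (test.exec s) ∨
      Inv X G N m M w h (i + 1) r d q (c + 1) (test.exec s) := by
  obtain ⟨bmem, b17, b18, breg⟩ := exec_query s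
  have hM := hI.maxima hid
  have h2 := hI.mid_le
  have h3 := hI.right_le
  have hset : ∀ k, k ∈ window X m w i ↔ k ∈ Ico i d ∨ k ∈ Ico (d - 1) r := by
    intro k
    simp only [window, mem_ofPred_eq, mem_Ico]
    constructor
    · rintro ⟨h4, h5, h6⟩
      have : k < r := by
        by_contra! hc
        have := C.le_of_le hc h5.le
        omega
      omega
    · intro hk
      have hik : i ≤ k ∧ k < r := by omega
      exact ⟨hik.1, by omega, hI.window k hik.2 hik.1⟩
  obtain ⟨s1, s2⟩ := hM.suffix i hqi hid
  have hy := isGreatest_image_max s1 hM.reg12 hset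
  have hν := isGreatest_image_max s2 hM.reg13 hset
  rw [hI.reg6] at b17 b18
  rw [← b17] at hy
  rw [← b18] at hν
  set u := query.exec s with hu
  have u0 : u.reg 0 = c := by rw [breg 0 (by decide), hI.reg0]
  have u4 : u.reg 4 = h := by rw [breg 4 (by decide), hI.reg4]
  have u5 : u.reg 5 = M := by rw [breg 5 (by decide), hI.reg5]
  have u6 : u.reg 6 = M + 5 * i := by rw [breg 6 (by decide), hI.reg6]
  have u16 : u.reg 16 = M + 5 * m + 5 + 2 * c := by rw [breg 16 (by decide), hI.reg16]
  have hfits : fits.eval u ↔ ∀ k ∈ window X m w i, u.reg 17 + h ≤ -N k := by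
    have : fits.eval u ↔ u.reg 17 + h ≤ 0 - u.reg 18 := by rw [← u4]; exact Iff.rfl
    rw [this]
    constructor
    · intro h4 k hk
      have := hν.2 ⟨k, hk, rfl⟩
      omega
    · intro h4
      obtain ⟨k, hk, hkν⟩ := hν.1
      have := h4 k hk
      omega
  have hshift : ¬ shiftable.eval u ↔ i = 0 ∨ u.reg 17 < G (i - 1) ∨ -N (i - 1) < u.reg 17 + h := by
    have : shiftable.eval u ↔ ¬ (M + 5 * i ≤ M) ∧ s.mem (M + 5 * i - 4) ≤ u.reg 17 ∧
        u.reg 17 + h ≤ 0 - s.mem (M + 5 * i - 3) := by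
      rw [← u4, ← u5, ← bmem, u5, ← u6, ← u5]; exact Iff.rfl
    rw [this]
    rcases Nat.eq_zero_or_pos i with rfl | hpos
    · simp
    · obtain ⟨i, rfl⟩ : ∃ i', i = i' + 1 := Nat.exists_eq_succ_of_ne_zero hpos.ne'
      obtain ⟨-, hG, hN⟩ := hI.holds i (by omega)
      have e1 : M + 5 * ((i + 1 : ℕ) : ℤ) - 4 = M + 5 * i + 1 := by push_cast; ring
      have e2 : M + 5 * ((i + 1 : ℕ) : ℤ) - 3 = M + 5 * i + 2 := by push_cast; ring
      rw [e1, e2, hG, hN, Nat.add_sub_cancel]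
      omega
  have hstable : ∀ x y, StableAt X G N m w h i x y ↔
      (x = X i ∧ y = u.reg 17) ∧ fits.eval u ∧ ¬ shiftable.eval u := by
    intro x y
    rw [hfits, hshift]
    constructor
    · rintro ⟨a1, a2, a3, a4, a5⟩
      obtain rfl := a3.unique hy
      exact ⟨⟨a1, rfl⟩, a4, a5⟩
    · rintro ⟨⟨rfl, rfl⟩, a4, a5⟩
      exact ⟨rfl, hle, hy, a4, a5⟩
  -- Whether or not a point is output, only registers `0` and `16` and the output area can change
  -- before the column advances, so both branches share this verification.
  have key : ∀ (v : State) (c' : ℕ), (∀ k ∉ ({0, 16} : Finset ℕ), v.reg k = u.reg k) →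
      v.reg 0 = c' → v.reg 16 = M + 5 * m + 5 + 2 * c' →
      (∀ a < M + 5 * m + 5, v.mem a = s.mem a) →
      (∀ x y, (∃ j < c', x = v.mem (M + 5 * m + 5 + 2 * j) ∧
        y = v.mem (M + 5 * m + 5 + 2 * j + 1)) ↔ ∃ k < i + 1, StableAt X G N m w h k x y) →
      Inv X G N m M w h (i + 1) r d q c' ⟨Function.update v.reg 6 (v.reg 6 + 5), v.mem⟩ := by
    intro v c' vreg v0 v16 vmem vout
    have vs : ∀ k ∉ ({0, 6, 16, 17, 18} : Finset ℕ),
        Function.update v.reg 6 (v.reg 6 + 5) k = s.reg k := by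
      intro k hk
      simp only [Finset.mem_insert, Finset.mem_singleton, not_or] at hk
      rw [Function.update_of_ne hk.2.1, vreg k (by simp [hk]), breg k (by simp [hk])]
    constructor
    · simp [v0]
    · rw [← hI.reg1]; exact vs 1 (by decide)
    · rw [← hI.reg3]; exact vs 3 (by decide)
    · rw [← hI.reg4]; exact vs 4 (by decide)
    · rw [← hI.reg5]; exact vs 5 (by decide)
    · simp only [Function.update_self]
      rw [vreg 6 (by decide), u6]; push_cast; ring
    · rw [← hI.reg7]; exact vs 7 (by decide)
    · rw [← hI.reg8]; exact vs 8 (by decide)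
    · rw [← hI.reg9]; exact vs 9 (by decide)
    · rw [← hI.reg11]; exact vs 11 (by decide)
    · simp [v16]
    · intro k hk
      rw [vmem _ (by omega), vmem _ (by omega), vmem _ (by omega)]
      exact hI.holds k hk
    · rw [vmem _ (by omega)]; exact hI.last
    · omega
    · exact h3
    · exact hI.le_mid
    · exact h2
    · intro k hk hik
      have := hI.window k hk (by omega)
      have := C.lt i (by omega)
      omega
    · intro hid'
      refine ⟨?_, ?_, ?_, ?_, ?_⟩ <;> dsimp only
      · rw [vs 12 (by decide)]; exact hM.reg12
      · rw [vs 13 (by decide)]; exact hM.reg13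
      · rw [vs 14 (by decide)]; exact hM.reg14
      · rw [vs 15 (by decide)]; exact hM.reg15
      · intro k k1 k2
        rw [vmem _ (by omega), vmem _ (by omega)]
        exact hM.suffix k k1 k2
    · exact vout
  have hexec : test.exec s = (Program.assign 6 (.add (.reg 6) (.lit 5))).exec
      ((Program.ifElse (.and fits (.not shiftable)) output .skip).exec u) := rfl
  rw [hexec]
  by_cases hc : fits.eval u ∧ ¬ shiftable.eval u
  · have hif : (Program.ifElse (.and fits (.not shiftable)) output .skip).exec u = output.exec u :=
      if_pos hc
    rw [hif]
    right
    obtain ⟨c0, c1, cmem, c16, c00, creg⟩ := exec_output u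
    rw [u16] at c0 c1 cmem c16
    rw [bmem] at cmem c0
    rw [u6, hI.mem_eq (by omega)] at c0
    refine key _ _ creg ?_ ?_ (fun a ha => cmem a (by omega)) fun x y => ?_
    · rw [c00, u0]; push_cast; rfl
    · rw [c16]; push_cast; ring
    · constructor
      · rintro ⟨j, hj, hx, hy'⟩
        rcases (Nat.lt_succ_iff.1 hj).eq_or_lt with rfl | hj
        · exact ⟨i, by omega, (hstable x y).2 ⟨⟨hx.trans c0, hy'.trans c1⟩, hc⟩⟩
        · rw [cmem _ (by omega)] at hx hy'
          obtain ⟨k, hk, hkS⟩ := (hI.out x y).1 ⟨j, hj, hx, hy'⟩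
          exact ⟨k, by omega, hkS⟩
      · rintro ⟨k, hk, hkS⟩
        rcases (Nat.lt_succ_iff.1 hk).eq_or_lt with rfl | hk
        · obtain ⟨⟨rfl, rfl⟩, -⟩ := (hstable x y).1 hkS
          exact ⟨c, by omega, c0.symm, c1.symm⟩
        · obtain ⟨j, hj, hx, hy'⟩ := (hI.out x y).2 ⟨k, hk, hkS⟩
          refine ⟨j, by omega, ?_, ?_⟩
          · rw [cmem _ (by omega), hx]
          · rw [cmem _ (by omega), hy']
  · have hif : (Program.ifElse (.and fits (.not shiftable)) output .skip).exec u = u := if_neg hc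
    rw [hif]
    left
    refine key u c (fun _ _ => rfl) u0 u16 (fun a _ => by rw [bmem]) fun x y => ?_
    rw [bmem, hI.out x y]
    constructor
    · rintro ⟨k, hk, hkS⟩
      exact ⟨k, by omega, hkS⟩
    · rintro ⟨k, hk, hkS⟩
      rcases (Nat.lt_succ_iff.1 hk).eq_or_lt with rfl | hk
      · exact absurd ((hstable x y).1 hkS).2 hc
      · exact ⟨k, hk, hkS⟩

theorem body_step (C : Columns f g x₀ m X G N) (hw : 0 < w) {K : ℕ} {s : State}
    (hs : LoopInv X G N m M w h K s) (hg : guard.eval s) :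
    ∃ K' < K, LoopInv X G N m M w h K' (body.exec s) := by
  obtain ⟨i, r, d, q, c, hI, rfl⟩ := hs
  have h1 := hI.le_right
  have h2 := hI.right_le
  have h3 := hI.le_mid
  have h4 := hI.mid_le
  have hg' : s.mem (s.reg 6) + s.reg 3 ≤ s.reg 11 := hg
  rw [hI.reg6, hI.reg3, hI.reg11, hI.mem_eq (by omega)] at hg'
  have him : i < m := by
    refine (h1.trans h2).lt_of_ne ?_
    rintro rfl; omega
  by_cases c1 : inWindow.eval s
  · have c1' : ¬ (s.mem (s.reg 6) + s.reg 3 ≤ s.mem (s.reg 7)) := c1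
    rw [hI.reg6, hI.reg7, hI.reg3, hI.mem_eq him.le, hI.mem_eq h2] at c1'
    have hrm : r < m := by
      refine h2.lt_of_ne ?_
      rintro rfl; omega
    have hb : body.exec s = absorb.exec s := by simp only [body, Program.exec, if_pos c1]
    rw [hb]
    exact ⟨_, by omega, i, r + 1, d, q, c, absorb_step hI (by omega) hrm, rfl⟩
  have c1' : ¬ ¬ (s.mem (s.reg 6) + s.reg 3 ≤ s.mem (s.reg 7)) := c1
  rw [hI.reg6, hI.reg7, hI.reg3, hI.mem_eq him.le, hI.mem_eq h2, not_not] at c1'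
  have hir : i < r := by
    refine h1.lt_of_ne ?_
    rintro rfl; omega
  by_cases c2 : (BExp.le (.reg 8) (.reg 6)).eval s
  · have c2' : s.reg 8 ≤ s.reg 6 := c2
    rw [hI.reg8, hI.reg6] at c2'
    have hb : body.exec s = restart.exec s := by
      simp only [body, Program.exec, if_neg c1, if_pos c2]
    rw [hb]
    exact ⟨_, by omega, i, r, r, r, c, restart_step hI hir, rfl⟩
  have c2' : ¬ s.reg 8 ≤ s.reg 6 := c2
  rw [hI.reg8, hI.reg6] at c2'
  by_cases c3 : (BExp.not (.le (.reg 9) (.reg 6))).eval s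
  · have c3' : ¬ s.reg 9 ≤ s.reg 6 := c3
    rw [hI.reg9, hI.reg6] at c3'
    have hb : body.exec s = suffix.exec s := by
      simp only [body, Program.exec, if_neg c1, if_neg c2, if_pos c3]
    rw [hb]
    obtain ⟨q, rfl⟩ : ∃ q', q = q' + 1 := Nat.exists_eq_succ_of_ne_zero (by omega)
    exact ⟨_, by omega, i, r, d, q, c, suffix_step hI (by omega), rfl⟩
  have c3' : ¬ ¬ s.reg 9 ≤ s.reg 6 := c3
  rw [hI.reg9, hI.reg6] at c3'
  have hb : body.exec s = test.exec s := by
    simp only [body, Program.exec, if_neg c1, if_neg c2, if_neg c3]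
  rw [hb]
  rcases test_step C hI (by omega) (by omega) hg' c1' with h5 | h5
  · exact ⟨_, by omega, i + 1, r, d, q, c, h5, rfl⟩
  · exact ⟨_, by omega, i + 1, r, d, q, c + 1, h5, rfl⟩

theorem loopInv_init {s : State} (h9 : s.reg 9 = X m) (h10 : s.reg 10 = s.reg 5 + 5 * m)
    (hH : HoldsColumns s.mem (s.reg 5) m X G N) :
    LoopInv X G N m (s.reg 5) (s.reg 3) (s.reg 4) (4 * m) (init.exec s) := by
  obtain ⟨i0, i11, i6, i7, i8, i9, i1, i16, i00, i3, i4, i5⟩ := exec_init s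
  refine ⟨0, 0, 0, 0, 0, ?_, by omega⟩
  constructor
  · simp [i00]
  · rw [i1, h10]
  · exact i3
  · exact i4
  · exact i5
  · simp [i6]
  · simp [i7]
  · simp [i8]
  · simp [i9]
  · rw [i11, h9]
  · rw [i16, h10]; simp
  · intro k hk
    rw [i0, h10, Function.update_of_ne (by omega), Function.update_of_ne (by omega),
      Function.update_of_ne (by omega)]
    exact hH k hk
  · rw [i0, h10, Function.update_self, h9]
  · omega
  · omega
  · omega
  · omega
  · intro k hk; omega
  · intro hk; omega
  · simp

/-- When the guard fails, a rectangle starting at column `i` exceeds the right end of the hole, and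
so does one starting at any later column. -/
theorem outputPoints_eq (C : Columns f g x₀ m X G N) (hw : 0 < w) {K : ℕ} {s : State}
    (hs : LoopInv X G N m M w h K s) (hg : ¬ guard.eval s) :
    outputPoints s = {p | StableIn f g x₀ (X m) w h p.1 p.2} := by
  obtain ⟨i, r, d, q, c, hI, rfl⟩ := hs
  have h1 := hI.le_right
  have h2 := hI.right_le
  have hg' : ¬ (s.mem (s.reg 6) + s.reg 3 ≤ s.reg 11) := hg
  rw [hI.reg6, hI.reg3, hI.reg11, hI.mem_eq (by omega)] at hg'
  ext ⟨x, y⟩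
  simp only [outputPoints, mem_ofPred_eq, hI.reg0, hI.reg1, C.stableIn_iff hw, Nat.cast_lt,
    Prod.mk.injEq]
  rw [hI.out x y]
  constructor
  · rintro ⟨k, hk, hkS⟩; exact ⟨k, by omega, hkS⟩
  · rintro ⟨k, hk, hkS⟩
    refine ⟨k, ?_, hkS⟩
    by_contra! hc
    have := C.le_of_le hc hk.le
    have := hkS.le_right
    omega

end Slide

/-! ### The complete program and its running time -/

/-- The program which computes the stable locations in a nice hole. -/
def locate : Program :=
  .seq Merge.init <| .seq (.loop Merge.guard Merge.body) <|
    .seq Slide.init <| .loop Slide.guard Slide.body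

/-- The time for each vertex of the hole. -/
def locateCost : ℕ :=
  Merge.init.bound + 3 * (Merge.guard.cost + 1 + Merge.body.bound) + Slide.init.bound +
    9 * (Slide.guard.cost + 1 + Slide.body.bound)

theorem HoldsInput.holdsList {n : ℕ} {s : State} {V : ZMod n → ℤ × ℤ} {w h : ℤ}
    (H : HoldsInput s V w h) : ∃ adr, Merge.HoldsList s.mem (s.reg 5) V adr ∧
      (∃ i, IsLeftmostEdge V i ∧ s.reg 0 = adr i) ∧ (∃ i, IsRightmostEdge V i ∧ s.reg 1 = adr i) ∧
      s.reg 3 = w ∧ s.reg 4 = h := by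
  obtain ⟨adr, h1, -, h3, h4, h5, -, h7, h8⟩ := H
  refine ⟨adr, ⟨fun i => (h1 i).2, fun i => (h3 i).1, fun i => (h3 i).2.1, fun i => (h3 i).2.2.1,
    fun i => ?_⟩, h4, h5, h7, h8⟩
  rw [(h3 (i + 1)).2.2.2, add_sub_cancel_right]

theorem runs_locate {n : ℕ} [NeZero n] {V : ZMod n → ℤ × ℤ} {e : ZMod n} {T B : ℕ → ZMod n}
    {p q : ℕ} {f g : ℤ → ℤ} (hV : IsClosedRectilinearArc V) (C : Chains V e T B p q)
    (hend : T p = B (q - 1)) (F : Follows V T B p q f g) {adr : ZMod n → ℤ} {s : State}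
    (hL : Merge.HoldsList s.mem (s.reg 5) V adr) (h0 : s.reg 0 = adr e)
    (h1 : s.mem (s.reg 1) = (V (T p)).1) (hw : 0 < s.reg 3) :
    ∃ t s', Runs locate s t s' ∧ t ≤ locateCost * n ∧
      outputPoints s' =
        {z | StableIn f g (V e).1 (V (T p)).1 (s.reg 3) (s.reg 4) z.1 z.2} := by
  obtain ⟨t₁, ht₁, r₁⟩ := Program.runs_exec (c := Merge.init)
    (by simp [Merge.init, Program.LoopFree]) s
  obtain ⟨t₂, s₂, ht₂, r₂, ⟨K, hK⟩, hg⟩ := runs_loop (b := Merge.guard) (c := Merge.body)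
    (by simp [Merge.body, Merge.record, Merge.advance, Program.LoopFree])
    (fun K s hs hg => Merge.body_step hV C hend F hs hg)
    (Merge.loopInv_init (f := f) (g := g) hV C hL h0 h1)
  obtain ⟨m, X, G, N, hI, hm, -⟩ := hK
  have hXm : X m = (V (T p)).1 := by
    have hg' : ¬ ¬ (s₂.reg 9 ≤ s₂.reg 8) := hg
    rw [hI.reg9, hI.reg8, not_not] at hg'
    exact le_antisymm hI.le hg'
  obtain ⟨t₃, ht₃, r₃⟩ := Program.runs_exec (c := Slide.init)
    (by simp [Slide.init, Program.LoopFree]) s₂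
  have hinit := Slide.loopInv_init (s := s₂) (X := X) (G := G) (N := N) (m := m)
    (by rw [hI.reg9, hXm]) (by rw [hI.reg10, hI.reg5]) (by rw [hI.reg5]; exact hI.holds)
  rw [hI.reg3, hI.reg4] at hinit
  obtain ⟨t₄, s₄, ht₄, r₄, ⟨K', hK'⟩, hg'⟩ := runs_loop (b := Slide.guard) (c := Slide.body)
    (by simp [Slide.body, Slide.absorb, Slide.restart, Slide.suffix, Slide.test, Slide.query,
      Slide.output, Slide.maxWith, Program.LoopFree])
    (fun K s hs hg => Slide.body_step hI.columns hw hs hg) hinit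
  refine ⟨_, s₄, .seq r₁ (.seq r₂ (.seq r₃ r₄)), ?_, ?_⟩
  · obtain ⟨hp, hq⟩ := C.length_le hV
    have hn : 1 ≤ n := NeZero.pos n
    -- The merge starts with the measure `p + q ≤ 2 * n`, and the final guard test adds one, hence
    -- `3 * n`. It yields `m ≤ 2 * n` columns, so the second loop starts with `4 * m ≤ 8 * n`, hence
    -- `9 * n` with its final test.
    have e₂ : t₂ ≤ (Merge.guard.cost + 1 + Merge.body.bound) * (3 * n) :=
      ht₂.trans (Nat.mul_le_mul_left _ (by omega))
    have e₄ : t₄ ≤ (Slide.guard.cost + 1 + Slide.body.bound) * (9 * n) :=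
      ht₄.trans (Nat.mul_le_mul_left _ (by omega))
    have e₁ : t₁ ≤ Merge.init.bound * n := ht₁.trans (Nat.le_mul_of_pos_right _ hn)
    have e₃ : t₃ ≤ Slide.init.bound * n := ht₃.trans (Nat.le_mul_of_pos_right _ hn)
    calc t₁ + (t₂ + (t₃ + t₄)) ≤ _ := Nat.add_le_add e₁ (Nat.add_le_add e₂ (Nat.add_le_add e₃ e₄))
      _ = locateCost * n := by unfold locateCost; ring
  · rw [Slide.outputPoints_eq hI.columns hw hK' hg', hXm]

end StripPacking

/-- There are a fixed program and a constant `c` such that, for every nice hole `S` of a feasible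
partial packing and every new rectangle `r`, the program computes from the linked list of the
vertices of `S` and the dimensions of `r` exactly the set of all feasible BL-stable locations for
placing `r` within `S`, in at most `c` times the number `n` of vertices of `S` time units. -/
theorem mainTheorem5 :
    ∃ (P : Program) (c : ℕ),
      ∀ (I : Instance) (sp : PartialPacking I) (S : Set (ℝ × ℝ))
        (n : ℕ) [NeZero n] (V : ZMod n → ℤ × ℤ) (r : Rectangle) (w h : ℤ) (s : State),
        Feasible I sp →
        (∀ i, sp i ≠ none → 0 < (I.rect i).width ∧ 0 < (I.rect i).height) →
        IsHoleOfPacking I sp S →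
        IsNiceHole V S →
        r.width = (w : ℝ) → r.height = (h : ℝ) → 0 < w → 0 < h →
        HoldsInput s V w h →
        ∃ (t : ℕ) (s' : State),
          Runs P s t s' ∧ t ≤ c * n ∧
          toPlane '' outputPoints s' =
            {p | FeasibleLocation I sp r p ∧ BLStableLocation I sp r p ∧ r.closedAt p ⊆ S} := by
  refine ⟨locate, locateCost, ?_⟩
  intro I sp S n _ V r w h s _ hpos hS hnice hrw hrh hw hh hin
  obtain ⟨⟨⟨hV, -, hSV⟩, hR, -, -⟩, hL⟩ := hnice
  obtain ⟨adr, hlist, ⟨e, he, h0⟩, ⟨e', he', h1⟩, rfl, rfl⟩ := hin.holdsList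
  obtain ⟨T, B, p, q, C, hend, hsep⟩ := exists_monotone_chains hV hR hL he
  obtain ⟨f, g, F⟩ := C.exists_follows hV
  have P := C.profile hV hend hsep F
  have hreg : S = profileRegion f g (V e).1 (V (T p)).1 := by
    rw [hSV]
    exact P.union_innerRegion (C.bounds hV hend F) (C.curve_subset hV hend F P)
  -- The rightmost edge is followed by `T p`, so its abscissa, read from its first node, is the
  -- right end of the hole.
  have hright : s.mem (s.reg 1) = (V (T p)).1 := by
    rw [h1, hlist.fst, ← C.rightmost_unique hend he', he'.2.1.1]
  obtain ⟨t, s', hrun, ht, hout⟩ := runs_locate hV C hend F hlist h0 hright hw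
  refine ⟨t, s', hrun, ht, ?_⟩
  have hrw' : 0 < r.width := by rw [hrw]; exact_mod_cast hw
  have hrh' : 0 < r.height := by rw [hrh]; exact_mod_cast hh
  rw [hout, ← stable_profileRegion hrw hrh hw]
  ext z
  rw [mem_ofPred_eq, mem_ofPred_eq, hS.stable_iff hpos hrw' hrh' z, hreg]
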